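/- **Conventions.** Graphs are finite, simple and undirected with vertices numbered $0,\dots,n-1$, given by their adjacency matrix; graph polynomials need not be invariant under isomorphism. Numbers are written in binary. A problem whose instances have parameters $n$ and $m$ *has a $2^{o(n)}$ time algorithm on instances with $m=O(n)$* if there is one algorithm that, for every constant $c$, solves all instances with $m\le c\,n$ in time $2^{s(n)}$ for some function $s(n)=o(n)$, which may depend on $c$. $\#\mathsf{ETH}$ is the hypothesis that counting the satisfying assignments of 3-CNF formulas with $n$ variables and $m$ clauses has no $2^{o(n)}$ time algorithm on formulas with $m=O(n)$. **Polynomials.** Let a sieve function $\chi$ and a weight selector $\omega$ assign to each graph $G$ and each $A\subseteq V(G)\cup E(G)$ a number $\chi(G,A)\in\mathbb Q$ and a set $\omega(G,A)\subseteq V(G)\cup E(G)$; neither is assumed to be computable. They induce the *subset-admissible* polynomial and its multivariate generalization $$p(G;x)=\sum_{A\subseteq V(G)\cup E(G)}\chi(G,A)\,x^{|\omega(G,A)|},\qquad \vec p(G;\mathbf x)=\sum_{A\subseteq V(G)\cup E(G)}\chi(G,A)\prod_{a\in\omega(G,A)}x_a .$$ $\mathsf{Coeff}(p)$ asks, given $G$,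 for all coefficients of $p(G)$. For fixed $\xi\in\mathbb Q$, $\mathsf{Eval}_\xi(p)$ asks, given an unweighted graph $G$, for $p(G;\xi)$. For both, $n=|V(G)|$ and $m=|E(G)|$. **Gadgets.** A vertex-gadget is a graph with one attachment vertex, an edge-gadget is a graph with two distinct ordered attachment vertices. Let $W=(w_0,w_1,\dots)$ be a sequence of pairwise distinct rationals, $(A_i)_{i\in\mathbb N}$ a sequence of vertex-gadgets and $(B_i)_{i\in\mathbb N}$ a sequence of edge-gadgets. For a graph $G$ with weights from $W$ on its vertices and edges, $T(G)$ is the unweighted graph in which the attachment vertex of a fresh copy of $A_i$ is identified with each vertex of weight $w_i$, and each edge $uv$ ($u<v$) of weight $w_i$ is replaced with a fresh copy of $B_i$ whose two attachment vertices are identified with $u$ and $v$, in this order. The vertices of $T(G)$ are numbered canonically: first those of $G$, then the other vertices of the copies of the $A_i$, then those of the copies of the $B_i$. (One-vertex gadgets $A_i$, or single edges $B_i$, leave the vertices, or the edges, unchanged, so that pure edge-gadget and pure vertex-gadget families are included.) A *factor function* $F$ maps weighted graphs to non-zero rationals and is computable by an algorithm which, for every fixed $d$, runs in time polynomial in $n$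 on $n$-vertex graphs with weights from $\{w_0,\dots,w_d\}$. **Theorem.** Let $p$ be the subset-admissible polynomial induced by $(\chi,\omega)$, with multivariate generalization $\vec p$, and let $\xi\in\mathbb Q$ be fixed. Assume: * *Coefficient hardness:* assuming $\#\mathsf{ETH}$, the problem $\mathsf{Coeff}(p)$ has no $2^{o(n)}$ time algorithm on graphs with $n$ vertices and $O(n)$ edges. * *Weight simulation:* there are a computable sequence $W$ of pairwise distinct rationals, computable sequences $(A_i)$ of vertex-gadgets and $(B_i)$ of edge-gadgets, and a factor function $F$ such that, for every graph $G$ with weights from $W$ on its vertices and edges, $$\vec p(G)=\frac{p(T(G);\xi)}{F(G)},$$ where $\vec p(G)$ is the value of $\vec p$ on the underlying graph when the weights are substituted for the indeterminates. Then, assuming $\#\mathsf{ETH}$, the problem $\mathsf{Eval}_\xi(p)$ has no $2^{o(n)}$ time algorithm on unweighted graphs with $n$ vertices and $O(n)$ edges. -/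

import Mathlib

open Polynomial Asymptotics Filter

namespace BlockInterp

/-! ### A machine model with a step count

Programs act on binary trees.  Every elementary operation takes one step, and duplicating a tree
costs its size.  Hence the memory in use never exceeds input size plus running time, and the model
and multi-tape Turing machines simulate each other with polynomial overhead. -/

/-- Binary trees, the data on which programs operate. -/
inductive Data : Type
  | leaf : Data
  | node : Data → Data → Data

namespace Data

/-- Left subtree (the leaf is its own left subtree). -/
def fst : Data → Data
  | leaf => leaf
  | node a _ => a

/-- Right subtree (the leaf is its own right subtree). -/
def snd : Data → Data
  | leaf => leaf
  | node _ b => b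

/-- Number of nodes, leaves included. -/
def size : Data → ℕ
  | leaf => 1
  | node a b => a.size + b.size + 1

end Data

/-- Programs. -/
inductive Code : Type
  /-- return the input -/
  | id : Code
  /-- return the leaf -/
  | leaf : Code
  /-- return the left subtree of the input -/
  | fst : Code
  /-- return the right subtree of the input -/
  | snd : Code
  /-- run both programs on the input and join their outputs -/
  | pair : Code → Code → Code
  /-- `comp g f` runs `f` and then `g` on the output of `f` -/
  | comp : Code → Code → Code
  /-- `cond f g` runs, on the right subtree of the input, `f` if the left subtree is the leaf,
  and `g` otherwise -/
  | cond : Code → Code → Code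
  /-- `loop f` applies `f` as long as the left subtree is not the leaf, and then returns the right
  subtree -/
  | loop : Code → Code

/-- `Runs M x y t`: the program `M` halts on input `x` with output `y` after exactly `t` steps. -/
inductive Runs : Code → Data → Data → ℕ → Prop
  | id (x : Data) : Runs Code.id x x 1
  | leaf (x : Data) : Runs Code.leaf x Data.leaf 1
  | fst (x : Data) : Runs Code.fst x x.fst 1
  | snd (x : Data) : Runs Code.snd x x.snd 1
  | pair {f g : Code} {x a b : Data} {s t : ℕ} :
      Runs f x a s → Runs g x b t → Runs (Code.pair f g) x (Data.node a b) (s + t + x.size + 1)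
  | comp {f g : Code} {x y z : Data} {s t : ℕ} :
      Runs f x y s → Runs g y z t → Runs (Code.comp g f) x z (s + t + 1)
  | cond_leaf {f g : Code} {x y : Data} {t : ℕ} :
      x.fst = Data.leaf → Runs f x.snd y t → Runs (Code.cond f g) x y (t + 1)
  | cond_node {f g : Code} {x y : Data} {t : ℕ} :
      x.fst ≠ Data.leaf → Runs g x.snd y t → Runs (Code.cond f g) x y (t + 1)
  | loop_stop {f : Code} {x : Data} :
      x.fst = Data.leaf → Runs (Code.loop f) x x.snd 1
  | loop_step {f : Code} {x y z : Data} {s t : ℕ} :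
      x.fst ≠ Data.leaf → Runs f x y s → Runs (Code.loop f) y z t →
        Runs (Code.loop f) x z (s + t + 1)

/-! ### Encodings (numbers are written in binary) -/

def encBool : Bool → Data
  | false => Data.leaf
  | true => Data.node Data.leaf Data.leaf

def encList {α : Type} (f : α → Data) (l : List α) : Data :=
  l.foldr (fun a d => Data.node (f a) d) Data.leaf

def encNat (n : ℕ) : Data := encList encBool n.bits

def encInt (z : ℤ) : Data := Data.node (encBool (decide (z < 0))) (encNat z.natAbs)

def encRat (q : ℚ) : Data := Data.node (encInt q.num) (encNat q.den)

open Classical in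
/-- The adjacency matrix, row by row. -/
noncomputable def encGraph {n : ℕ} (G : SimpleGraph (Fin n)) : Data :=
  encList (fun i => encList (fun j => encBool (decide (G.Adj i j))) (List.finRange n))
    (List.finRange n)

/-- The sequence `a` is computable: some program computes `a i` from `i`. -/
def ComputableSeq {α : Type} (enc : α → Data) (a : ℕ → α) : Prop :=
  ∃ M : Code, ∀ i, ∃ t, Runs M (encNat i) (enc (a i)) t

/-! ### Computational problems and `2^{o(n)}` time -/

/-- A computational problem: instances with their size parameter `n` and the parameter `m`
(the number of edges or clauses) in which sparsity is measured, and the required output. -/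
structure Problem where
  Inst : Type
  n : Inst → ℕ
  m : Inst → ℕ
  input : Inst → Data
  output : Inst → Data

/-- The problem has a `2^{o(n)}` time algorithm on instances with `m = O(n)`: there is a program
that, for every constant `c`, solves the instances with `m ≤ c n` in time `2^{s(n)}` for some
`s = o(n)` (which may depend on `c`). -/
def Problem.SubexpOnSparse (P : Problem) : Prop :=
  ∃ M : Code, ∀ c : ℕ, ∃ s : ℕ → ℝ, s =o[atTop] (fun n : ℕ => (n : ℝ)) ∧
    ∀ I : P.Inst, P.m I ≤ c * P.n I →
      ∃ t : ℕ, Runs M (P.input I) (P.output I) t ∧ (t : ℝ) ≤ (2 : ℝ) ^ s (P.n I)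

/-! ### The counting exponential-time hypothesis -/

/-- A 3-CNF formula on `n` variables; a literal is a variable with the truth value that
satisfies it. -/
structure CNF3 where
  n : ℕ
  clauses : List (List (Fin n × Bool))
  length_le : ∀ C ∈ clauses, C.length ≤ 3

def CNF3.Satisfies (φ : CNF3) (a : Fin φ.n → Bool) : Prop :=
  ∀ C ∈ φ.clauses, ∃ l ∈ C, a l.1 = l.2

/-- The problem of counting the satisfying assignments of a 3-CNF formula. -/
noncomputable def sharp3SAT : Problem where
  Inst := CNF3
  n φ := φ.n
  m φ := φ.clauses.length
  input φ := Data.node (encNat φ.n)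
    (encList (encList fun l => Data.node (encNat l.1.val) (encBool l.2)) φ.clauses)
  output φ := encNat (Nat.card {a : Fin φ.n → Bool // φ.Satisfies a})

/-- `#ETH`: satisfying assignments of 3-CNF formulas with `n` variables and `O(n)` clauses cannot
be counted in time `2^{o(n)}`. -/
def SharpETH : Prop := ¬ sharp3SAT.SubexpOnSparse

/-! ### Subset-admissible graph polynomials

Graphs are finite simple graphs with vertices numbered `0, …, n - 1`. -/

/-- The edges of `G`, each given by its pair of endpoints in increasing order. -/
abbrev Edge {n : ℕ} (G : SimpleGraph (Fin n)) : Type :=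
  {e : Fin n × Fin n // e.1 < e.2 ∧ G.Adj e.1 e.2}

noncomputable instance {n : ℕ} (G : SimpleGraph (Fin n)) : Fintype (Edge G) := Fintype.ofFinite _

/-- The elements of `V(G) ∪ E(G)`. -/
abbrev Elt {n : ℕ} (G : SimpleGraph (Fin n)) : Type := Fin n ⊕ Edge G

/-- Univariate graph polynomials (not required to be invariant under isomorphism). -/
abbrev GraphPoly : Type := ∀ n : ℕ, SimpleGraph (Fin n) → ℚ[X]

abbrev SieveFunction : Type := ∀ (n : ℕ) (G : SimpleGraph (Fin n)), Finset (Elt G) → ℚ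

abbrev WeightSelector : Type :=
  ∀ (n : ℕ) (G : SimpleGraph (Fin n)), Finset (Elt G) → Finset (Elt G)

/-- The subset-admissible polynomial
`p(G; x) = ∑_{A ⊆ V(G) ∪ E(G)} χ(G, A) x ^ |ω(G, A)|` induced by `(χ, ω)`. -/
noncomputable def inducedPoly (χ : SieveFunction) (ω : WeightSelector) : GraphPoly :=
  fun n G => ∑ A : Finset (Elt G), Polynomial.C (χ n G A) * Polynomial.X ^ (ω n G A).card

/-- The multivariate generalization `∑_{A ⊆ V(G) ∪ E(G)} χ(G, A) ∏_{a ∈ ω(G, A)} x_a`. -/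
noncomputable def multiPoly (χ : SieveFunction) (ω : WeightSelector) {n : ℕ}
    (G : SimpleGraph (Fin n)) : MvPolynomial (Elt G) ℚ :=
  ∑ A : Finset (Elt G), MvPolynomial.C (χ n G A) * ∏ a ∈ ω n G A, MvPolynomial.X a

/-- `Coeff(p)`: given `G`, list the coefficients of `x^0, …, x^(|V(G)| + |E(G)|)` in `p(G)`
(for subset-admissible `p` these are all coefficients that can be non-zero). -/
noncomputable def coeffProblem (p : GraphPoly) : Problem where
  Inst := Σ n : ℕ, SimpleGraph (Fin n)
  n G := G.1
  m G := Fintype.card (Edge G.2)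
  input G := encGraph G.2
  output G := encList encRat
    ((List.range (G.1 + Fintype.card (Edge G.2) + 1)).map fun k => (p G.1 G.2).coeff k)

/-- `Eval_ξ(p)`: given an unweighted graph `G`, compute `p(G; ξ)`. -/
noncomputable def evalProblem (ξ : ℚ) (p : GraphPoly) : Problem where
  Inst := Σ n : ℕ, SimpleGraph (Fin n)
  n G := G.1
  m G := Fintype.card (Edge G.2)
  input G := encGraph G.2
  output G := encRat ((p G.1 G.2).eval ξ)

/-! ### Weight simulation by gadgets -/

/-- A graph with weights from a sequence `W` of pairwise distinct weights on its vertices and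
edges: the element `a` has weight `W (idx a)`. -/
structure WGraph where
  n : ℕ
  graph : SimpleGraph (Fin n)
  idx : Elt graph → ℕ

open Classical in
/-- The adjacency matrix, the weight indices of the vertices, and the matrix of the weight indices
of the edges (`0` where there is no edge). -/
noncomputable def encWGraph (G : WGraph) : Data :=
  Data.node (encGraph G.graph) (Data.node
    (encList (fun v => encNat (G.idx (Sum.inl v))) (List.finRange G.n))
    (encList (fun u => encList (fun v => encNat
      (if h : u < v ∧ G.graph.Adj u v then G.idx (Sum.inr ⟨(u, v), h⟩) else 0))
      (List.finRange G.n)) (List.finRange G.n)))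

/-- A vertex-gadget: a graph with attachment vertex `0` and `inner` further vertices. -/
structure VertexGadget where
  inner : ℕ
  graph : SimpleGraph (Fin (inner + 1))

/-- An edge-gadget: a graph with attachment vertices `0` and `1` and `inner` further vertices. -/
structure EdgeGadget where
  inner : ℕ
  graph : SimpleGraph (Fin (inner + 2))

/-- The vertices of `T(G)`: those of `G`, the inner vertices of the copy of the vertex-gadget at
each vertex, and those of the copy of the edge-gadget at each edge. -/
abbrev TVertex (HV : ℕ → VertexGadget) (HE : ℕ → EdgeGadget) (G : WGraph) : Type :=
  Fin G.n ⊕ (Σ v : Fin G.n, Fin (HV (G.idx (Sum.inl v))).inner) ⊕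
    (Σ e : Edge G.graph, Fin (HE (G.idx (Sum.inr e))).inner)

variable (HV : ℕ → VertexGadget) (HE : ℕ → EdgeGadget) (G : WGraph)

/-- The vertex of `T(G)` at which a given vertex of the gadget at `v` is placed. -/
def placeV (v : Fin G.n) : Fin ((HV (G.idx (Sum.inl v))).inner + 1) → TVertex HV HE G :=
  Fin.cases (Sum.inl v) (fun j => Sum.inr (Sum.inl ⟨v, j⟩))

/-- The vertex of `T(G)` at which a given vertex of the gadget at the edge `e` is placed. -/
def placeE (e : Edge G.graph) : Fin ((HE (G.idx (Sum.inr e))).inner + 2) → TVertex HV HE G :=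
  Fin.cases (Sum.inl e.1.1) (Fin.cases (Sum.inl e.1.2) (fun j => Sum.inr (Sum.inr ⟨e, j⟩)))

/-- The graph `T(G)`: every vertex of weight `W i` is identified with the attachment vertex of a
fresh copy of `HV i`, and every edge of weight `W i` is replaced with a fresh copy of `HE i` whose
attachment vertices are identified with its endpoints. -/
def TGraph : SimpleGraph (TVertex HV HE G) :=
  SimpleGraph.fromRel fun a b =>
    (∃ v x y, (HV (G.idx (Sum.inl v))).graph.Adj x y ∧
      placeV HV HE G v x = a ∧ placeV HV HE G v y = b) ∨
    (∃ e x y, (HE (G.idx (Sum.inr e))).graph.Adj x y ∧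
      placeE HV HE G e x = a ∧ placeE HV HE G e y = b)

open Classical in
/-- The edges of a graph in lexicographic order. -/
noncomputable def edgeList {n : ℕ} (G : SimpleGraph (Fin n)) : List (Edge G) :=
  (List.finRange n).flatMap fun u => (List.finRange n).filterMap fun v =>
    if h : u < v ∧ G.Adj u v then some ⟨(u, v), h⟩ else none

/-- The numbering of the vertices of `T(G)`: first those of `G`, then the inner vertices of the
vertex-gadgets, then those of the edge-gadgets. -/
noncomputable def TList : List (TVertex HV HE G) :=
  (List.finRange G.n).map Sum.inl ++
  ((List.finRange G.n).flatMap fun v =>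
    (List.finRange (HV (G.idx (Sum.inl v))).inner).map fun j => Sum.inr (Sum.inl ⟨v, j⟩)) ++
  ((edgeList G.graph).flatMap fun e =>
    (List.finRange (HE (G.idx (Sum.inr e))).inner).map fun j => Sum.inr (Sum.inr ⟨e, j⟩))

/-- `T(G)` with its vertices numbered. -/
noncomputable def gadgetGraph : SimpleGraph (Fin (TList HV HE G).length) :=
  (TGraph HV HE G).comap (TList HV HE G).get

/-- The factor function `F` has non-zero values and is computable by a program that runs in
polynomial time on the graphs with weights from `{W 0, …, W d}`, for every fixed `d`. -/
def IsFactorFunction (F : WGraph → ℚ) : Prop :=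
  (∀ G, F G ≠ 0) ∧
  ∃ M : Code, ∀ d : ℕ, ∃ k : ℕ, ∀ G : WGraph, (∀ a, G.idx a ≤ d) →
    ∃ t : ℕ, Runs M (encWGraph G) (encRat (F G)) t ∧ t ≤ (G.n + 2) ^ k

/-- `(HV, HE, F)` allows to reduce the evaluation of the multivariate generalization at weights
from `W` to the evaluation of `p` at `ξ`. -/
def AllowsReduction (χ : SieveFunction) (ω : WeightSelector) (ξ : ℚ) (W : ℕ → ℚ)
    (HV : ℕ → VertexGadget) (HE : ℕ → EdgeGadget) (F : WGraph → ℚ) : Prop :=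
  ∀ G : WGraph, MvPolynomial.eval (fun a => W (G.idx a)) (multiPoly χ ω G.graph) =
    (inducedPoly χ ω _ (gadgetGraph HV HE G)).eval ξ / F G

/-- The weight simulation condition. -/
def WeightSimulation (χ : SieveFunction) (ω : WeightSelector) (ξ : ℚ) : Prop :=
  ∃ W : ℕ → ℚ, ComputableSeq encRat W ∧ Function.Injective W ∧
  ∃ (HV : ℕ → VertexGadget) (HE : ℕ → EdgeGadget),
    ComputableSeq (fun H => encGraph H.graph) HV ∧
    ComputableSeq (fun H => encGraph H.graph) HE ∧
  ∃ F : WGraph → ℚ, IsFactorFunction F ∧ AllowsReduction χ ω ξ W HV HE F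

end BlockInterp

namespace BlockInterp

/-! ### Running times and sizes -/

/-! The argument is block interpolation. Let `N = |V| + |E|`, which is `O(n)` on sparse graphs, and
cut `V ∪ E` into `N / d + 1` blocks of at most `d` elements. If all elements of a block share one
weight, `multiPoly` has degree at most `d` in each block weight, because it is multilinear in the
element weights. Hence `d + 1` weights per block determine it, and setting all block weights equal
to `X` gives `inducedPoly`. Concretely, if `L c` is the Lagrange polynomial of the weight `v c`,
then `∑ c, v c ^ e * L c = X ^ e` for `e ≤ d`. Taking the product over the blocks, the sum over all
words `w` of the value of `multiPoly` at `w` times `∏ L (w b)` is `inducedPoly` (`sum_words`,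
`sum_words_inducedPoly`, `addLists_trueTerm`).

There are `(d + 1) ^ (N / d + 1)` words, and the exponent `log (d + 1) / d` can be made as small as
desired (`exists_block_size`). By weight simulation, each value is one evaluation at `ξ` on `T(G)`,
divided by the factor. For fixed `d` only finitely many gadgets occur, so `T(G)` has `O(n)` vertices
and edges (`length_TList_le`, `card_edge_gadgetGraph_le`) and the assumed algorithm evaluates it in
time `2 ^ o(n)`. So for every `ε` some `d` yields time `2 ^ (ε n)` for large `n`.

One program has to achieve this for all `ε`, although the right `d` and the running times of the
programs for weights and gadgets are unknown. It therefore tries fuel `0, 1, 2, …`. With a given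
fuel it tries every block size below it and abandons every subcomputation that exceeds it (`search`,
`exists_search`). Whatever is found is correct (`search_sound`), since all given programs are
deterministic and correct on every input, and the first success comes no later than the fuel
sufficient for the best `d` (`exists_fuel`). The cost is polynomial in the final fuel, and the
polynomial does not depend on `d`, so it is absorbed by choosing the exponents small enough
(`exists_eventually_bound`).

The remaining work is to show that an attempt with given fuel takes polynomial time in the machine
model. `PT` is closed under composition, pairing, case distinction and size-controlled folds.
`Code.run` executes a program with a clock, exactly matching `Runs` (`Code.run_sound`,
`Code.run_complete`), and is itself polynomial (`Code.pt_run_aux`). -/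

theorem Data.one_le_size (x : Data) : 1 ≤ x.size := by
  cases x <;> simp [Data.size]

theorem Data.fst_size_le (x : Data) : x.fst.size ≤ x.size := by
  cases x <;> simp [Data.fst, Data.size]; omega

theorem Data.snd_size_le (x : Data) : x.snd.size ≤ x.size := by
  cases x <;> simp [Data.snd, Data.size]; omega

/-- The charge for copying in `pair` is essential: both branches read the same input, so the joined
output may contain it twice. -/
theorem Runs.size_le {M : Code} {x y : Data} {t : ℕ} (h : Runs M x y t) :
    y.size ≤ x.size + t := by
  induction h with
  | id x => omega
  | leaf x => simp [Data.size]
  | fst x => have := x.fst_size_le; omega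
  | snd x => have := x.snd_size_le; omega
  | pair _ _ h₁ h₂ => simp only [Data.size]; omega
  | comp _ _ h₁ h₂ => omega
  | @cond_leaf f g x y t hx _ h₁ => have := x.snd_size_le; omega
  | @cond_node f g x y t hx _ h₁ => have := x.snd_size_le; omega
  | loop_stop _ => exact (Data.snd_size_le _).trans (Nat.le_add_right _ _)
  | loop_step _ _ _ h₁ h₂ => omega

/-- Time bounds are polynomials over `ℕ`, so upper bounds on sizes can be substituted into them. -/
theorem eval_mono (p : ℕ[X]) {a b : ℕ} (h : a ≤ b) : p.eval a ≤ p.eval b := by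
  induction p using Polynomial.induction_on' with
  | add p q hp hq => simp only [eval_add]; omega
  | monomial n c => simp only [eval_monomial]; gcongr

/-- Types whose elements are represented by data. The measure `sz` agrees with the size of the
representation up to a factor of eight. -/
class Enc (α : Type) where
  enc : α → Data
  sz : α → ℕ
  sz_le : ∀ a, sz a ≤ (enc a).size
  size_le : ∀ a, (enc a).size ≤ 8 * sz a

open Enc

instance : Enc Data where
  enc := fun x => x
  sz := Data.size
  sz_le _ := le_rfl
  size_le _ := by omega

instance : Enc Unit where
  enc _ := Data.leaf
  sz _ := 1
  sz_le _ := by simp [Data.size]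
  size_le _ := by simp [Data.size]

instance : Enc Bool where
  enc := encBool
  sz _ := 1
  sz_le b := by cases b <;> simp [encBool, Data.size]
  size_le b := by cases b <;> simp [encBool, Data.size]

/-- The measure of a list. -/
def listSz {α : Type} (f : α → ℕ) (l : List α) : ℕ := (l.map fun a => f a + 1).sum + 1

instance {α : Type} [Enc α] : Enc (List α) where
  enc := encList enc
  sz := listSz sz
  sz_le l := by
    induction l with
    | nil => simp [encList, listSz, Data.size]
    | cons a l ih =>
      have := sz_le a
      simp only [encList, listSz, List.foldr_cons, List.map_cons, List.sum_cons, Data.size] at ih ⊢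
      omega
  size_le l := by
    induction l with
    | nil => simp [encList, listSz, Data.size]
    | cons a l ih =>
      have := size_le a
      simp only [encList, listSz, List.foldr_cons, List.map_cons, List.sum_cons, Data.size] at ih ⊢
      omega

instance {α β : Type} [Enc α] [Enc β] : Enc (α × β) where
  enc p := Data.node (enc p.1) (enc p.2)
  sz p := sz p.1 + sz p.2 + 1
  sz_le p := by
    have := sz_le p.1
    have := sz_le p.2
    simp only [Data.size]; omega
  size_le p := by
    have := size_le p.1
    have := size_le p.2
    simp only [Data.size]; omega

instance {α : Type} [Enc α] : Enc (Option α) where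
  enc o := o.elim Data.leaf fun a => Data.node (enc a) Data.leaf
  sz o := o.elim 1 fun a => sz a + 2
  sz_le o := by
    cases o with
    | none => simp [Data.size]
    | some a => have := sz_le a; simp only [Option.elim, Data.size]; omega
  size_le o := by
    cases o with
    | none => simp [Data.size]
    | some a => have := size_le a; simp only [Option.elim, Data.size]; omega

variable {α β γ δ : Type} [Enc α] [Enc β] [Enc γ] [Enc δ]

@[simp] theorem enc_data (x : Data) : enc x = x := rfl
@[simp] theorem sz_data (x : Data) : sz x = x.size := rfl
@[simp] theorem sz_unit (x : Unit) : sz x = 1 := rfl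
@[simp] theorem sz_bool (x : Bool) : sz x = 1 := rfl
@[simp] theorem enc_nil : enc ([] : List α) = Data.leaf := rfl
@[simp] theorem enc_cons (a : α) (l : List α) : enc (a :: l) = Data.node (enc a) (enc l) := rfl
@[simp] theorem sz_nil : sz ([] : List α) = 1 := rfl
@[simp] theorem sz_cons (a : α) (l : List α) : sz (a :: l) = sz a + sz l + 1 := by
  change listSz sz (a :: l) = sz a + listSz sz l + 1
  simp only [listSz, List.map_cons, List.sum_cons]; omega
@[simp] theorem enc_mk (a : α) (b : β) : enc (a, b) = Data.node (enc a) (enc b) := rfl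
@[simp] theorem sz_mk (a : α) (b : β) : sz (a, b) = sz a + sz b + 1 := rfl
@[simp] theorem enc_none : enc (none : Option α) = Data.leaf := rfl
@[simp] theorem enc_some (a : α) : enc (some a) = Data.node (enc a) Data.leaf := rfl
@[simp] theorem sz_none : sz (none : Option α) = 1 := rfl
@[simp] theorem sz_some (a : α) : sz (some a) = sz a + 2 := rfl

theorem one_le_sz (a : α) : 1 ≤ sz a := by
  have := size_le a
  have := (enc a).one_le_size
  omega

@[simp] theorem sz_append (l m : List α) : sz (l ++ m) + 1 = sz l + sz m := by
  induction l with
  | nil => simp; omega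
  | cons a l ih => simp; omega

theorem length_lt_sz (l : List α) : l.length < sz l := by
  induction l with
  | nil => simp
  | cons a l ih => simp only [List.length_cons, sz_cons]; omega

theorem sz_le_of_mem {a : α} {l : List α} (h : a ∈ l) : sz a ≤ sz l := by
  induction l with
  | nil => simp at h
  | cons b l ih =>
    rcases List.mem_cons.1 h with rfl | h
    · simp only [sz_cons]; omega
    · have := ih h; simp only [sz_cons]; omega

theorem sz_list_le {l : List α} {b : ℕ} (h : ∀ a ∈ l, sz a ≤ b) :
    sz l ≤ l.length * (b + 1) + 1 := by
  induction l with
  | nil => simp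
  | cons a l ih =>
    have h₁ := h a (by simp)
    have h₂ := ih fun a ha => h a (by simp [ha])
    simp only [sz_cons, List.length_cons, add_mul, one_mul]; omega

/-! ### Functions computable in polynomial time -/

/-- The function `f` is computable in polynomial time. -/
@[fun_prop]
def PT (f : α → β) : Prop :=
  ∃ (M : Code) (p : ℕ[X]), ∀ a, ∃ t, Runs M (enc a) (enc (f a)) t ∧ t ≤ p.eval (sz a)

/-- A program cannot produce more output than its input size plus its running time. This is what
makes composition polynomial. -/
theorem PT.sz_bound {f : α → β} (hf : PT f) : ∃ q : ℕ[X], ∀ a, sz (f a) ≤ q.eval (sz a) := by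
  obtain ⟨M, p, h⟩ := hf
  refine ⟨8 * X + p, fun a => ?_⟩
  obtain ⟨t, ht, htp⟩ := h a
  have h₁ := ht.size_le
  have h₂ := sz_le (f a)
  have h₃ := size_le a
  simp only [eval_add, eval_mul, eval_ofNat, eval_X]
  omega

/-- Programs only see encodings, so passing between types with the same representation (a number and
its digits, a cons cell and a pair) costs nothing. -/
theorem PT.of_enc_eq {f : α → β} {g : α → γ} (hf : PT f) (h : ∀ a, enc (f a) = enc (g a)) :
    PT g := by
  obtain ⟨M, p, hM⟩ := hf
  exact ⟨M, p, fun a => h a ▸ hM a⟩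

@[fun_prop]
theorem PT.id : PT (fun x : α => x) :=
  ⟨Code.id, 1, fun a => ⟨1, Runs.id _, by simp⟩⟩

@[fun_prop]
theorem PT.comp {g : β → γ} {f : α → β} (hg : PT g) (hf : PT f) : PT (fun x => g (f x)) := by
  obtain ⟨q, hq⟩ := hf.sz_bound
  obtain ⟨M, p, hM⟩ := hf
  obtain ⟨M', p', hM'⟩ := hg
  refine ⟨Code.comp M' M, p + p'.comp q + 1, fun a => ?_⟩
  obtain ⟨t, ht, htp⟩ := hM a
  obtain ⟨t', ht', htp'⟩ := hM' (f a)
  refine ⟨_, Runs.comp ht ht', ?_⟩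
  have := htp'.trans (eval_mono p' (hq a))
  simp only [eval_add, eval_comp, eval_one]
  omega

@[fun_prop]
theorem PT.prodMk {f : α → β} {g : α → γ} (hf : PT f) (hg : PT g) :
    PT (fun x => (f x, g x)) := by
  obtain ⟨M, p, hM⟩ := hf
  obtain ⟨M', p', hM'⟩ := hg
  refine ⟨Code.pair M M', p + p' + 8 * X + 1, fun a => ?_⟩
  obtain ⟨t, ht, htp⟩ := hM a
  obtain ⟨t', ht', htp'⟩ := hM' a
  refine ⟨_, Runs.pair ht ht', ?_⟩
  have := size_le a
  simp only [eval_add, eval_mul, eval_ofNat, eval_X, eval_one]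
  omega

theorem PT.of_fst {f : α → β} (h : ∀ a, enc (f a) = (enc a).fst) : PT f :=
  ⟨Code.fst, 1, fun a => ⟨1, h a ▸ Runs.fst _, by simp⟩⟩

theorem PT.of_snd {f : α → β} (h : ∀ a, enc (f a) = (enc a).snd) : PT f :=
  ⟨Code.snd, 1, fun a => ⟨1, h a ▸ Runs.snd _, by simp⟩⟩

@[fun_prop]
theorem PT.fst {f : α → β × γ} (hf : PT f) : PT (fun x => (f x).1) :=
  (PT.of_fst (f := fun p : β × γ => p.1) fun _ => rfl).comp hf

@[fun_prop]
theorem PT.snd {f : α → β × γ} (hf : PT f) : PT (fun x => (f x).2) :=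
  (PT.of_snd (f := fun p : β × γ => p.2) fun _ => rfl).comp hf

@[fun_prop]
theorem PT.encoding : PT (fun x : α => enc x) := 
  PT.id.of_enc_eq fun _ => rfl

@[fun_prop]
theorem PT.const (b : β) : PT (fun _ : α => b) := by
  suffices h : ∀ x : Data, PT (fun _ : α => x) from (h (enc b)).of_enc_eq fun _ => rfl
  intro x
  induction x with
  | leaf => exact ⟨Code.leaf, 1, fun a => ⟨1, Runs.leaf _, by simp⟩⟩
  | node x y hx hy => exact (hx.prodMk hy).of_enc_eq fun _ => rfl

open Classical in
-- The instruction `cond` discards the tag that it tests, so the tag `c a` is first paired with an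
-- intact copy of the input.
theorem PT.cond_leaf {f g : α → γ} {c : α → Data} (hc : PT c) (hf : PT f) (hg : PT g) {h : α → γ}
    (h₁ : ∀ a, c a = Data.leaf → h a = f a) (h₂ : ∀ a, c a ≠ Data.leaf → h a = g a) : PT h := by
  obtain ⟨M, p, hM⟩ := hf
  obtain ⟨M', p', hM'⟩ := hg
  have h₀ : PT (fun x : Data × α => if x.1 = Data.leaf then f x.2 else g x.2) := by
    refine ⟨Code.cond M M', p.comp X + p' + 1, fun a => ?_⟩
    have hs : sz a.2 ≤ sz a := by change _ ≤ _ + _ + 1; omega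
    by_cases ha : a.1 = Data.leaf
    · obtain ⟨t, ht, htp⟩ := hM a.2
      refine ⟨t + 1, Runs.cond_leaf ha ?_, ?_⟩
      · simp only [if_pos ha]; exact ht
      · have := htp.trans (eval_mono p hs)
        simp only [eval_add, comp_X, eval_one]; omega
    · obtain ⟨t, ht, htp⟩ := hM' a.2
      refine ⟨t + 1, Runs.cond_node ha ?_, ?_⟩
      · simp only [if_neg ha]; exact ht
      · have := htp.trans (eval_mono p' hs)
        simp only [eval_add, comp_X, eval_one]; omega
  refine (h₀.comp (hc.prodMk PT.id)).of_enc_eq fun a => ?_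
  by_cases ha : c a = Data.leaf
  · simp [ha, h₁ a ha]
  · simp [ha, h₂ a ha]

@[fun_prop]
theorem PT.ite_bool {c : α → Bool} {f g : α → β} (hc : PT c) (hf : PT f) (hg : PT g) :
    PT (fun x => if c x then f x else g x) := by
  refine PT.cond_leaf (PT.encoding.comp hc) hg hf (fun a ha => ?_) (fun a ha => ?_)
  all_goals
    cases h : c a
    all_goals simp [h, enc, encBool] at ha ⊢

@[fun_prop]
theorem PT.ite {c : α → Prop} [DecidablePred c] {f g : α → β} (hc : PT (fun x => decide (c x)))
    (hf : PT f) (hg : PT g) : PT (fun x => if c x then f x else g x) := by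
  simpa using PT.ite_bool hc hf hg

@[fun_prop]
theorem PT.not {c : α → Bool} (hc : PT c) : PT (fun x => !c x) := by
  have : PT (fun x => if c x then false else true) := by fun_prop
  convert this using 2 with x
  cases c x <;> rfl

@[fun_prop]
theorem PT.and {c d : α → Bool} (hc : PT c) (hd : PT d) : PT (fun x => c x && d x) := by
  have : PT (fun x => if c x then d x else false) := by fun_prop
  convert this using 2 with x
  cases c x <;> rfl

@[fun_prop]
theorem PT.or {c d : α → Bool} (hc : PT c) (hd : PT d) : PT (fun x => c x || d x) := by
  have : PT (fun x => if c x then true else d x) := by fun_prop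
  convert this using 2 with x
  cases c x <;> rfl

@[fun_prop]
theorem PT.xor {c d : α → Bool} (hc : PT c) (hd : PT d) : PT (fun x => c x ^^ d x) := by
  have : PT (fun x => if c x then !d x else d x) := by fun_prop
  convert this using 2 with x
  cases c x <;> cases d x <;> rfl

@[fun_prop]
theorem PT.decide_and {c d : α → Prop} [DecidablePred c] [DecidablePred d]
    (hc : PT (fun x => decide (c x))) (hd : PT (fun x => decide (d x))) :
    PT (fun x => decide (c x ∧ d x)) := by
  simpa using hc.and hd

@[fun_prop]
theorem PT.decide_not {c : α → Prop} [DecidablePred c] (hc : PT (fun x => decide (c x))) :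
    PT (fun x => decide (¬ c x)) := by
  simpa using hc.not

@[fun_prop]
theorem PT.decide_bool {c : α → Bool} (hc : PT c) : PT (fun x => decide (c x = true)) := by
  simpa using hc

@[fun_prop]
theorem PT.cons {f : α → β} {l : α → List β} (hf : PT f) (hl : PT l) :
    PT (fun x => f x :: l x) :=
  (hf.prodMk hl).of_enc_eq fun _ => rfl

@[fun_prop]
theorem PT.option_some {f : α → β} (hf : PT f) : PT (fun x => some (f x)) :=
  (hf.prodMk (PT.const Data.leaf)).of_enc_eq fun _ => rfl

@[fun_prop]
theorem PT.tail {l : α → List β} (hl : PT l) : PT (fun x => (l x).tail) :=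
  (PT.of_snd (f := fun l : List β => l.tail) fun l => by cases l <;> rfl).comp hl

theorem PT.node {f g : α → Data} (hf : PT f) (hg : PT g) : PT (fun x => Data.node (f x) (g x)) :=
  (hf.prodMk hg).of_enc_eq fun _ => rfl

@[fun_prop]
theorem PT.data_fst {f : α → Data} (hf : PT f) : PT (fun x => (f x).fst) :=
  (PT.of_fst (f := fun d : Data => d.fst) fun _ => rfl).comp hf

@[fun_prop]
theorem PT.data_snd {f : α → Data} (hf : PT f) : PT (fun x => (f x).snd) :=
  (PT.of_snd (f := fun d : Data => d.snd) fun _ => rfl).comp hf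

attribute [fun_prop] PT.node

@[fun_prop]
theorem PT.head? {l : α → List β} (hl : PT l) : PT (fun x => (l x).head?) := by
  refine PT.comp (g := fun l : List β => l.head?) ?_ hl
  have h : PT (fun l : List β => Data.node (enc l).fst Data.leaf) := by fun_prop
  have h' : PT (fun l : List β => (enc l.head? : Data)) :=
    PT.cond_leaf PT.encoding (PT.const Data.leaf) h (fun l hl => by cases l <;> simp_all)
      (fun l hl => by cases l <;> simp_all [Data.fst])
  exact h'.of_enc_eq fun _ => rfl

/-- Case distinction on an option. -/
theorem PT.elim {o : α → Option β} {f : α → γ} {g : α → β → γ} (ho : PT o) (hf : PT f)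
    (hg : PT (fun p : α × β => g p.1 p.2)) : PT (fun x => (o x).elim (f x) (g x)) := by
  obtain ⟨M, p, hM⟩ := hf
  obtain ⟨M', p', hM'⟩ := hg
  have h₀ : PT (fun x : Option β × α => x.1.elim (f x.2) (g x.2)) := by
    obtain ⟨M₁, p₁, hM₁⟩ : PT (fun x : β × α => (x.2, x.1)) := by fun_prop
    -- The encoding of `some b` is a node, so a copy of the option serves as the tag. In the second
    -- branch `fst` after `fst` strips first the pair and then the `some`.
    refine ⟨Code.comp (Code.cond (Code.comp M Code.snd)
      (Code.comp M' (Code.pair Code.snd (Code.comp Code.fst Code.fst)))) (Code.pair Code.fst Code.id),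
      p + p' + 32 * X + 32, fun a => ?_⟩
    have hs := size_le a
    obtain ⟨o, x⟩ := a
    have h₁ : Runs (Code.pair Code.fst Code.id) (enc (o, x))
      (Data.node (enc o) (enc (o, x))) (1 + 1 + (enc (o, x)).size + 1) :=
      Runs.pair (Runs.fst _) (Runs.id _)
    cases o with
    | none =>
      obtain ⟨t, ht, htp⟩ := hM x
      refine ⟨_, Runs.comp h₁ (Runs.cond_leaf rfl (Runs.comp (Runs.snd _) ht)), ?_⟩
      have h₂ := htp.trans (eval_mono p (show sz x ≤ sz ((none : Option β), x) by simp; omega))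
      simp only [eval_add, eval_mul, eval_ofNat, eval_X]
      omega
    | some b =>
      obtain ⟨t, ht, htp⟩ := hM' (x, b)
      refine ⟨_, Runs.comp h₁ (Runs.cond_node (by simp [Data.fst])
        (Runs.comp (Runs.pair (Runs.snd _) (Runs.comp (Runs.fst _) (Runs.fst _))) ht)), ?_⟩
      have h₂ := htp.trans (eval_mono p' (show sz (x, b) ≤ sz (some b, x) by simp; omega))
      simp only [eval_add, eval_mul, eval_ofNat, eval_X, Data.snd]
      omega
  exact h₀.comp (ho.prodMk PT.id)

attribute [fun_prop] PT.elim

@[fun_prop]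
theorem PT.bind {o : α → Option β} {g : α → β → Option γ} (ho : PT o)
    (hg : PT (fun p : α × β => g p.1 p.2)) : PT (fun x => (o x).bind (g x)) := by
  have : PT (fun x => (o x).elim none (g x)) := by fun_prop
  convert this using 2 with x
  cases o x <;> rfl

@[fun_prop]
theorem PT.option_map {o : α → Option β} {g : α → β → γ} (ho : PT o)
    (hg : PT (fun p : α × β => g p.1 p.2)) : PT (fun x => (o x).map (g x)) := by
  have : PT (fun x => (o x).elim none (fun b => some (g x b))) := by fun_prop
  convert this using 2 with x
  cases o x <;> rfl

@[fun_prop]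
theorem PT.isSome {o : α → Option β} (ho : PT o) : PT (fun x => (o x).isSome) := by
  have : PT (fun x => (o x).elim false (fun _ => true)) := by fun_prop
  convert this using 2 with x
  cases o x <;> rfl

@[fun_prop]
theorem PT.isEmpty {l : α → List β} (hl : PT l) : PT (fun x => (l x).isEmpty) := by
  have : PT (fun x => !(l x).head?.isSome) := by fun_prop
  convert this using 2 with x
  cases l x <;> rfl

/-! ### Loops -/

/-- The loop is given by an explicit trajectory `s` with a uniform bound on the rounds. The
induction shifts the trajectory by one. -/
theorem Runs.loop_of_steps {M : Code} (s : ℕ → Data) (T : ℕ) :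
    ∀ n : ℕ, (∀ i < n, (s i).fst ≠ Data.leaf ∧ ∃ t, Runs M (s i) (s (i + 1)) t ∧ t ≤ T) →
      (s n).fst = Data.leaf → ∃ t, Runs (Code.loop M) (s 0) (s n).snd t ∧ t ≤ n * (T + 1) + 1 := by
  intro n
  induction n generalizing s with
  | zero => exact fun _ h => ⟨1, Runs.loop_stop h, by simp⟩
  | succ n ih =>
    intro h h'
    obtain ⟨t, ht, htT⟩ := ih (fun i => s (i + 1)) (fun i hi => h (i + 1) (by omega)) h'
    obtain ⟨h₁, t', ht', htT'⟩ := h 0 (by omega)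
    refine ⟨_, Runs.loop_step h₁ ht' ht, ?_⟩
    rw [add_mul]
    omega

/-- Iterating a polynomial-time step may blow up the state, hence the size bound on the accumulator
after every prefix. The loop state is the remaining list, the parameter and the accumulator, and the
loop stops when the list is the leaf. -/
theorem PT.foldl_of_bound {g : α → γ → β → γ} {l : α → List β} {i : α → γ}
    (hg : PT (fun p : α × γ × β => g p.1 p.2.1 p.2.2)) (hl : PT l) (hi : PT i) (q : ℕ[X])
    (hq : ∀ x m, m <+: l x → sz (m.foldl (g x) (i x)) ≤ q.eval (sz x)) :
    PT (fun x => (l x).foldl (g x) (i x)) := by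
  have hstep : PT (fun p : (β × List β) × α × γ => (p.1.2, p.2.1, g p.2.1 p.2.2 p.1.1)) :=
    PT.prodMk (by fun_prop) (PT.prodMk (by fun_prop)
      (hg.comp (f := fun p : (β × List β) × α × γ => (p.2.1, p.2.2, p.1.1)) (by fun_prop)))
  obtain ⟨ql, hql⟩ := hl.sz_bound
  have hinit : PT (fun x => (l x, x, i x)) := by fun_prop
  obtain ⟨M, p, hM⟩ := hstep
  have hloop : ∃ p' : ℕ[X], ∀ x, ∃ t, Runs (Code.loop M) (enc (l x, x, i x))
      (enc (x, (l x).foldl (g x) (i x))) t ∧ t ≤ p'.eval (sz x) := by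
    refine ⟨ql * (p.comp (ql + X + q + 2) + 1) + 1, fun x => ?_⟩
    obtain ⟨t, ht, htp⟩ := Runs.loop_of_steps (M := M)
      (fun j => enc ((l x).drop j, x, ((l x).take j).foldl (g x) (i x)))
      (p.eval (ql.eval (sz x) + sz x + q.eval (sz x) + 2)) (l x).length
      (fun j hj => by
        have hd := List.drop_eq_getElem_cons hj
        refine ⟨by rw [hd]; exact nofun, ?_⟩
        obtain ⟨t, ht, htp⟩ := hM (((l x)[j], (l x).drop (j + 1)), x,
          ((l x).take j).foldl (g x) (i x))
        refine ⟨t, ?_, htp.trans (eval_mono p ?_)⟩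
        · have ht' : (l x).take (j + 1) = (l x).take j ++ [(l x)[j]] := by simp
          rw [hd, ht', List.foldl_append]
          exact ht
        · have h₁ := hq x ((l x).take j) (List.take_prefix _ _)
          have h₂ : sz ((l x).drop j) ≤ sz (l x) := by
            have := sz_append ((l x).take j) ((l x).drop j)
            rw [List.take_append_drop] at this
            have := one_le_sz ((l x).take j)
            omega
          rw [hd] at h₂
          have h₃ := hql x
          simp only [sz_mk, sz_cons] at h₂ ⊢
          omega)
      (by simp [Data.fst])
    refine ⟨t, by simpa [Data.snd] using ht, htp.trans ?_⟩
    have h₁ := (length_lt_sz (l x)).le.trans (hql x)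
    simp only [eval_add, eval_mul, eval_comp, eval_X, eval_one, eval_ofNat]
    gcongr
  obtain ⟨p', hp'⟩ := hloop
  obtain ⟨M₁, p₁, hM₁⟩ := hinit
  -- The loop returns the parameter together with the accumulator; the outer `snd` drops the
  -- parameter.
  refine ⟨Code.comp Code.snd (Code.comp (Code.loop M) M₁), p₁ + p' + 3, fun x => ?_⟩
  obtain ⟨t₁, ht₁, htp₁⟩ := hM₁ x
  obtain ⟨t, ht, htp⟩ := hp' x
  refine ⟨_, Runs.comp (Runs.comp ht₁ ht) (Runs.snd _), ?_⟩
  simp only [eval_add, eval_ofNat]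
  omega

/-- Additive growth of `μ` per round sums to at most the number of rounds times the largest
increment, and `r` converts `μ` back into size. -/
theorem PT.foldl_of_measure {g : α → γ → β → γ} {l : α → List β} {i : α → γ} (μ : γ → ℕ)
    (q r : ℕ[X])
    (hg : PT (fun p : α × γ × β => g p.1 p.2.1 p.2.2)) (hl : PT l) (hi : PT i)
    (h₀ : ∀ x, μ (i x) ≤ q.eval (sz x))
    (h₁ : ∀ x c b, μ (g x c b) ≤ μ c + q.eval (sz x + sz b))
    (h₂ : ∀ c, sz c ≤ r.eval (μ c)) :
    PT (fun x => (l x).foldl (g x) (i x)) := by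
  obtain ⟨s, hs⟩ := hl.sz_bound
  refine PT.foldl_of_bound hg hl hi (r.comp (q + s * q.comp (X + s))) fun x m hm => ?_
  have key : ∀ m : List β, (∀ b ∈ m, sz b ≤ s.eval (sz x)) → μ (m.foldl (g x) (i x)) ≤
      q.eval (sz x) + m.length * q.eval (sz x + s.eval (sz x)) := by
    intro m
    induction m using List.reverseRecOn with
    | nil => intro _; simpa using h₀ x
    | append_singleton m b ih =>
      intro hb
      rw [List.foldl_append, List.foldl_cons, List.foldl_nil]
      refine (h₁ _ _ _).trans ?_
      have h₃ := ih fun b hb' => hb b (by simp [hb'])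
      have h₄ := eval_mono q (Nat.add_le_add_left (hb b (by simp)) (sz x))
      simp only [List.length_append, List.length_singleton, add_mul, one_mul]
      omega
  refine (h₂ _).trans ?_
  rw [eval_comp]
  refine eval_mono r ((key m fun b hb => (sz_le_of_mem (hm.subset hb)).trans (hs x)).trans ?_)
  have := hm.length_le.trans ((length_lt_sz (l x)).le.trans (hs x))
  simp only [eval_add, eval_mul, eval_comp, eval_X]
  gcongr

/-- A loop is polynomial if each round adds a bounded amount to the size of the state. -/
theorem PT.foldl {g : α → γ → β → γ} {l : α → List β} {i : α → γ}
    (hg : PT (fun p : α × γ × β => g p.1 p.2.1 p.2.2)) (hl : PT l) (hi : PT i) (q : ℕ[X])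
    (hq : ∀ x c b, sz (g x c b) ≤ sz c + q.eval (sz x + sz b)) :
    PT (fun x => (l x).foldl (g x) (i x)) := by
  obtain ⟨s, hs⟩ := hi.sz_bound
  refine PT.foldl_of_measure sz (q + s) X hg hl hi (fun x => ?_) (fun x c b => ?_) (by simp)
  · have := hs x
    simp only [eval_add]; omega
  · have := hq x c b
    simp only [eval_add]; omega

/-! ### Lists -/

@[fun_prop]
theorem PT.reverse {l : α → List β} (hl : PT l) : PT (fun x => (l x).reverse) := by
  have : PT (fun x => (l x).foldl (fun acc a => a :: acc) []) :=
    PT.foldl (g := fun _ acc a => a :: acc) (by fun_prop) hl (PT.const _) (X + 1) fun x c b => by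
      simp only [sz_cons, eval_add, eval_X, eval_one]; omega
  convert this using 2 with x
  simp

@[fun_prop]
theorem PT.map {f : α → β → γ} {l : α → List β} (hf : PT (fun p : α × β => f p.1 p.2))
    (hl : PT l) : PT (fun x => (l x).map (f x)) := by
  obtain ⟨q, hq⟩ := hf.sz_bound
  have : PT (fun x => ((l x).foldl (fun acc a => f x a :: acc) []).reverse) :=
    PT.reverse (PT.foldl (g := fun x acc a => f x a :: acc)
      (PT.cons (hf.comp (f := fun p : α × List γ × β => (p.1, p.2.2)) (by fun_prop)) (by fun_prop))
      hl (PT.const _) (q.comp (X + 1) + 1) fun x c b => by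
        have := hq (x, b)
        simp only [sz_mk] at this
        simp only [sz_cons, eval_add, eval_X, eval_one, eval_comp]; omega)
  convert this using 2 with x
  have (l : List β) (m : List γ) :
      l.foldl (fun acc a => f x a :: acc) m = (l.map (f x)).reverse ++ m := by
    induction l generalizing m with
    | nil => rfl
    | cons a l ih => simp [ih]
  simp [this]

@[fun_prop]
theorem PT.append {l m : α → List β} (hl : PT l) (hm : PT m) : PT (fun x => l x ++ m x) := by
  have : PT (fun x => (l x).reverse.foldl (fun acc a => a :: acc) (m x)) :=
    PT.foldl (g := fun _ acc a => a :: acc) (by fun_prop) hl.reverse hm (X + 1) fun x c b => by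
      simp only [sz_cons, eval_add, eval_X, eval_one]; omega
  convert this using 2 with x
  simp

@[fun_prop]
theorem PT.flatten {l : α → List (List β)} (hl : PT l) : PT (fun x => (l x).flatten) := by
  have : PT (fun x => (l x).foldl (fun acc a => acc ++ a) []) :=
    PT.foldl (g := fun _ acc a => acc ++ a) (by fun_prop) hl (PT.const _) X fun x c b => by
      have := sz_append c b
      simp only [eval_X]; omega
  convert this using 2 with x
  have (l : List (List β)) (m : List β) :
      l.foldl (fun acc a => acc ++ a) m = m ++ l.flatten := by
    induction l generalizing m with
    | nil => simp
    | cons a l ih => simp [ih]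
  simp [this]

@[fun_prop]
theorem PT.flatMap {f : α → β → List γ} {l : α → List β} (hf : PT (fun p : α × β => f p.1 p.2))
    (hl : PT l) : PT (fun x => (l x).flatMap (f x)) := by
  simpa only [List.flatMap_def] using (hf.map hl).flatten

@[fun_prop]
theorem PT.filter {c : α → β → Bool} {l : α → List β} (hc : PT (fun p : α × β => c p.1 p.2))
    (hl : PT l) : PT (fun x => (l x).filter (c x)) := by
  have : PT (fun x => (l x).flatMap fun a => if c x a then [a] else []) := by fun_prop
  convert this using 2 with x
  induction l x with
  | nil => rfl
  | cons a l ih => by_cases h : c x a <;> simp [h, ih]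

@[fun_prop]
theorem PT.any {c : α → β → Bool} {l : α → List β} (hc : PT (fun p : α × β => c p.1 p.2))
    (hl : PT l) : PT (fun x => (l x).any (c x)) := by
  have : PT (fun x => !((l x).filter (c x)).isEmpty) := by fun_prop
  convert this using 2 with x
  rw [Bool.eq_iff_iff]
  simp

@[fun_prop]
theorem PT.drop_length {l : α → List β} {m : α → List γ} (hl : PT l) (hm : PT m) :
    PT (fun x => (l x).drop (m x).length) := by
  have : PT (fun x => (m x).foldl (fun acc _ => acc.tail) (l x)) :=
    PT.foldl (g := fun _ acc _ => acc.tail) (by fun_prop) hm hl 0 fun x c b => by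
      cases c
      · simp
      · simp; omega
  convert this using 2 with x
  have (m : List γ) (l : List β) : m.foldl (fun acc _ => acc.tail) l = l.drop m.length := by
    induction m generalizing l with
    | nil => simp
    | cons a m ih =>
      rw [List.foldl_cons, ih, ← List.drop_one, List.drop_drop, List.length_cons, Nat.add_comm]
  rw [this]

@[fun_prop]
theorem PT.zip {l : α → List β} {m : α → List γ} (hl : PT l) (hm : PT m) :
    PT (fun x => (l x).zip (m x)) := by
  have : PT (fun x => ((l x).foldl (fun s a => s.1.head?.elim s fun b => (s.1.tail, (a, b) :: s.2))
      (m x, [])).2.reverse) := by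
    refine PT.reverse (PT.snd (PT.foldl (g := fun (_ : α) (s : List γ × List (β × γ)) a =>
      s.1.head?.elim s fun b => (s.1.tail, (a, b) :: s.2))
      (by fun_prop) hl (by fun_prop) (X + 2) fun x c b => ?_))
    obtain ⟨_ | ⟨c, l⟩, m⟩ := c
    · simp
    · simp; omega
  convert this using 2 with x
  have (l : List β) (m : List γ) (o : List (β × γ)) :
      (l.foldl (fun s a => s.1.head?.elim s fun b => (s.1.tail, (a, b) :: s.2)) (m, o)).2 =
        (l.zip m).reverse ++ o := by
    induction l generalizing m o with
    | nil => rfl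
    | cons a l ih =>
      cases m with
      | nil =>
        simp only [List.foldl_cons, List.head?_nil, Option.elim_none]
        rw [ih]; simp
      | cons b m =>
        simp only [List.foldl_cons, List.head?_cons, Option.elim_some, List.tail_cons]
        rw [ih]; simp
  rw [this]; simp

@[fun_prop]
theorem PT.zipWith {f : β → γ → δ} {l : α → List β} {m : α → List γ}
    (hf : PT (fun p : β × γ => f p.1 p.2)) (hl : PT l) (hm : PT m) :
    PT (fun x => List.zipWith f (l x) (m x)) := by
  have : PT (fun x => ((l x).zip (m x)).map fun p => f p.1 p.2) :=
    PT.map (hf.comp (f := fun p : α × β × γ => p.2) (by fun_prop)) (hl.zip hm)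
  convert this using 2 with x
  rw [List.zip, List.map_zipWith]

/-- The list of the values of a list of options, if all of them have one. -/
def allSome {α : Type} (l : List (Option α)) : Option (List α) :=
  l.foldr (fun a acc => acc.bind fun t => a.map fun b => b :: t) (some [])

@[fun_prop]
theorem pt_allSome {l : α → List (Option β)} (hl : PT l) : PT (fun x => allSome (l x)) := by
  have : PT (fun x => (l x).reverse.foldl
      (fun acc a => acc.bind fun t => a.map fun b => b :: t) (some [])) := by
    refine PT.foldl (g := fun (_ : α) (acc : Option (List β)) (a : Option β) =>
      acc.bind fun t => a.map fun b => b :: t) (by fun_prop) hl.reverse (PT.const _) (X + 2)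
      fun x c b => ?_
    cases c <;> cases b <;> simp <;> omega
  convert this using 2 with x
  rw [List.foldl_reverse]; rfl

/-! ### Natural numbers -/

instance : Enc ℕ where
  enc := encNat
  sz n := n.size + 1
  sz_le n := by
    have : ∀ l : List Bool, l.length + 1 ≤ (encList encBool l).size := by
      intro l
      induction l with
      | nil => simp [encList, Data.size]
      | cons a l ih => simp only [encList, List.foldr_cons, Data.size, List.length_cons] at ih ⊢; omega
    rw [← Nat.size_eq_bits_len]
    exact this _
  size_le n := by
    have : ∀ l : List Bool, (encList encBool l).size ≤ 8 * (l.length + 1) := by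
      intro l
      induction l with
      | nil => simp [encList, Data.size]
      | cons a l ih =>
        have : (encBool a).size ≤ 3 := by cases a <;> simp [encBool, Data.size]
        simp only [encList, List.foldr_cons, Data.size, List.length_cons] at ih ⊢; omega
    rw [← Nat.size_eq_bits_len]
    exact this _

@[simp] theorem sz_nat (n : ℕ) : sz n = n.size + 1 := rfl
theorem enc_nat (n : ℕ) : enc n = enc n.bits := rfl

@[fun_prop]
theorem PT.bits {f : α → ℕ} (hf : PT f) : PT (fun x => (f x).bits) :=
  hf.of_enc_eq fun _ => rfl

@[fun_prop]
theorem PT.eq_zero {f : α → ℕ} (hf : PT f) : PT (fun x => decide (f x = 0)) := by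
  have : PT (fun x => (f x).bits.isEmpty) := by fun_prop
  convert this using 2 with x
  rw [Bool.eq_iff_iff, List.isEmpty_iff, ← List.length_eq_zero_iff, Nat.size_eq_bits_len]
  simp [Nat.size_eq_zero]

@[fun_prop]
theorem PT.bit {b : α → Bool} {f : α → ℕ} (hb : PT b) (hf : PT f) :
    PT (fun x => Nat.bit (b x) (f x)) := by
  -- Digit lists are canonical: a zero digit put below the number `0` must give the empty list.
  have : PT (fun x => if !(b x) && decide (f x = 0) then [] else b x :: (f x).bits) := by fun_prop
  refine this.of_enc_eq fun x => ?_
  rw [enc_nat]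
  split_ifs with h
  · simp only [Bool.and_eq_true, Bool.not_eq_eq_eq_not, Bool.not_true, decide_eq_true_eq] at h
    simp [h]
  · rw [Nat.bits_append_bit]
    intro h'
    simpa [h'] using h

@[fun_prop]
theorem PT.bodd {f : α → ℕ} (hf : PT f) : PT (fun x => (f x).bodd) := by
  have : PT (fun x => (f x).bits.head?.elim false fun b => b) := by fun_prop
  convert this using 2 with x
  rw [Nat.bodd_eq_bits_head]
  cases (f x).bits <;> rfl

@[fun_prop]
theorem PT.div2 {f : α → ℕ} (hf : PT f) : PT (fun x => (f x).div2) := by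
  have : PT (fun x => (f x).bits.tail) := by fun_prop
  refine this.of_enc_eq fun x => ?_
  rw [enc_nat, Nat.div2_bits_eq_tail]

/-- The number with the given binary digits, the least significant first. -/
def ofBits (l : List Bool) : ℕ := l.foldr Nat.bit 0

theorem ofBits_bits (n : ℕ) : ofBits n.bits = n := by
  induction n using Nat.binaryRec' with
  | zero => simp [ofBits]
  | bit b n h ih => 
    rw [Nat.bits_append_bit _ _ h]
    exact congrArg (Nat.bit b) ih

theorem size_bit_le (b : Bool) (n : ℕ) : (Nat.bit b n).size ≤ n.size + 1 := by
  rw [Nat.size_le, pow_succ]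
  have := Nat.lt_size_self n
  cases b <;> simp <;> omega

theorem size_mono {m n : ℕ} (h : m ≤ n) : m.size ≤ n.size := Nat.size_le_size h

theorem size_add_le (m n : ℕ) : (m + n).size ≤ max m.size n.size + 1 := by
  rw [Nat.size_le, pow_succ]
  have h₁ := (Nat.lt_size_self m).trans_le (Nat.pow_le_pow_right two_pos (le_max_left _ n.size))
  have h₂ := (Nat.lt_size_self n).trans_le (Nat.pow_le_pow_right two_pos (le_max_right m.size _))
  omega

theorem size_mul_le (m n : ℕ) : (m * n).size ≤ m.size + n.size := by
  rcases Nat.eq_zero_or_pos n with rfl | hn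
  · simp
  rw [Nat.size_le, pow_add]
  exact Nat.mul_lt_mul_of_lt_of_le (Nat.lt_size_self m) (Nat.lt_size_self n).le (by positivity)

@[fun_prop]
theorem pt_ofBits {l : α → List Bool} (hl : PT l) : PT (fun x => ofBits (l x)) := by
  have : PT (fun x => (l x).reverse.foldl (fun n b => Nat.bit b n) 0) :=
    PT.foldl (g := fun _ n b => Nat.bit b n) (by fun_prop) hl.reverse (PT.const _) 1
      fun x c b => by
        have := size_bit_le b c
        simp; omega
  convert this using 2 with x
  rw [List.foldl_reverse]; rfl

/-! ### Binary addition and subtraction. -/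

theorem ofBits_append_singleton (l : List Bool) (b : Bool) :
    ofBits (l ++ [b]) = ofBits l + 2 ^ l.length * b.toNat := by
  induction l with
  | nil => cases b <;> simp [ofBits]
  | cons a l ih =>
    simp only [ofBits, List.cons_append, List.foldr_cons, Nat.bit_val, List.length_cons] at ih ⊢
    rw [ih]; ring

theorem ofBits_lt (l : List Bool) : ofBits l < 2 ^ l.length := by
  induction l with
  | nil => simp [ofBits]
  | cons a l ih =>
    simp only [ofBits, List.foldr_cons, List.length_cons, pow_succ, Nat.bit_val] at ih ⊢
    have : a.toNat ≤ 1 := Bool.toNat_le a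
    omega

theorem bodd_add_two_mul_div2 (n : ℕ) : n.bodd.toNat + 2 * n.div2 = n := by
  conv_rhs => rw [← Nat.bit_bodd_div2 n]
  rw [Nat.bit_val]; omega

theorem size_div2_le (n : ℕ) : n.div2.size ≤ n.size := by
  have := bodd_add_two_mul_div2 n
  exact size_mono (by omega)

/-- One round of binary addition or subtraction: the remaining digits of both numbers, the carry,
and the digits of the result. -/
def carryStep (neg : Bool) (s : ℕ × ℕ × Bool × List Bool) : ℕ × ℕ × Bool × List Bool :=
  (s.1.div2, s.2.1.div2,
    -- If the second digit and the carry agree, the new carry equals them. Otherwise the first digit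
    -- decides, complemented in the case of a borrow.
    if s.2.1.bodd ^^ s.2.2.1 then s.1.bodd ^^ neg else s.2.2.1,
    (s.1.bodd ^^ (s.2.1.bodd ^^ s.2.2.1)) :: s.2.2.2)

/-- Loop invariant: the digits already produced plus the remaining sum, shifted by their number,
keep the same total value. -/
theorem carryStep_add (s : ℕ × ℕ × Bool × List Bool) :
    ofBits (carryStep false s).2.2.2.reverse + 2 ^ (carryStep false s).2.2.2.length *
      ((carryStep false s).1 + (carryStep false s).2.1 + (carryStep false s).2.2.1.toNat) =
    ofBits s.2.2.2.reverse + 2 ^ s.2.2.2.length * (s.1 + s.2.1 + s.2.2.1.toNat) := by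
  obtain ⟨a, b, c, o⟩ := s
  simp only [carryStep, List.reverse_cons, ofBits_append_singleton, List.length_reverse,
    List.length_cons, pow_succ]
  conv_rhs => rw [← bodd_add_two_mul_div2 a, ← bodd_add_two_mul_div2 b]
  cases a.bodd <;> cases b.bodd <;> cases c <;> simp <;> ring

/-- The corresponding invariant for subtraction, rearranged so that no truncated difference occurs;
`e` and `f` stand for the original minuend and subtrahend. -/
theorem carryStep_sub (s : ℕ × ℕ × Bool × List Bool) (e f : ℕ)
    (h : e + 2 ^ s.2.2.2.length * (s.2.1 + s.2.2.1.toNat) =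
      f + (ofBits s.2.2.2.reverse + 2 ^ s.2.2.2.length * s.1)) :
    e + 2 ^ (carryStep true s).2.2.2.length *
      ((carryStep true s).2.1 + (carryStep true s).2.2.1.toNat) =
    f + (ofBits (carryStep true s).2.2.2.reverse +
      2 ^ (carryStep true s).2.2.2.length * (carryStep true s).1) := by
  obtain ⟨a, b, c, o⟩ := s
  simp only at h
  rw [← bodd_add_two_mul_div2 a, ← bodd_add_two_mul_div2 b] at h
  simp only [carryStep, List.reverse_cons, ofBits_append_singleton, List.length_reverse,
    List.length_cons, pow_succ]
  revert h
  cases a.bodd <;> cases b.bodd <;> cases c <;> simp <;> intro h <;> ring_nf at h ⊢ <;> omega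

/-- The result of all rounds of binary addition or subtraction. -/
def carryLoop (neg : Bool) (a b : ℕ) : ℕ × ℕ × Bool × List Bool :=
  -- The list only counts rounds. They exceed the total number of digits by one, so that both
  -- operands are exhausted and the last carry of a sum is written out.
  (true :: (a.bits ++ b.bits)).foldl (fun s _ => carryStep neg s) (a, b, false, [])

theorem pt_carryLoop (neg : Bool) {f g : α → ℕ} (hf : PT f) (hg : PT g) :
    PT (fun x => carryLoop neg (f x) (g x)) := by
  refine PT.foldl (g := fun _ s _ => carryStep neg s) (by unfold carryStep; fun_prop) (by fun_prop)
    (by fun_prop) 2 fun x s b => ?_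
  have h₁ := size_div2_le s.1
  have h₂ := size_div2_le s.2.1
  obtain ⟨a, b, c, o⟩ := s
  simp [carryStep] at h₁ h₂ ⊢
  omega

theorem carryLoop_length (neg : Bool) (a b : ℕ) :
    (carryLoop neg a b).2.2.2.length = a.size + b.size + 1 := by
  have : ∀ (l : List Bool) s, (l.foldl (fun s _ => carryStep neg s) s).2.2.2.length =
      l.length + s.2.2.2.length := by
    intro l
    induction l with
    | nil => simp
    | cons a l ih => intro s; rw [List.foldl_cons, ih]; simp [carryStep]; omega
  rw [carryLoop, this]
  simp [Nat.size_eq_bits_len]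

theorem lt_two_pow_of_size (a b : ℕ) : a < 2 ^ (a.size + b.size) :=
  (Nat.lt_size_self a).trans_le (Nat.pow_le_pow_right two_pos (by omega))

theorem carryLoop_zero (neg : Bool) (a b : ℕ) :
    (carryLoop neg a b).1 = 0 ∧ (carryLoop neg a b).2.1 = 0 := by
  have h : ∀ (l : List Bool) s, (l.foldl (fun s _ => carryStep neg s) s).1 = s.1 / 2 ^ l.length ∧
      (l.foldl (fun s _ => carryStep neg s) s).2.1 = s.2.1 / 2 ^ l.length := by
    intro l
    induction l with
    | nil => simp
    | cons a l ih =>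
      intro s
      rw [List.foldl_cons, (ih _).1, (ih _).2]
      simp only [carryStep, List.length_cons, pow_succ', Nat.div2_val, Nat.div_div_eq_div_mul,
        and_self]
  rw [carryLoop, (h _ _).1, (h _ _).2]
  have h₁ := lt_two_pow_of_size a b
  have h₂ := lt_two_pow_of_size b a
  rw [add_comm] at h₂
  simp only [List.length_cons, List.length_append, Nat.size_eq_bits_len, pow_succ]
  exact ⟨Nat.div_eq_of_lt (by omega), Nat.div_eq_of_lt (by omega)⟩

theorem add_eq_carryLoop (a b : ℕ) : a + b = ofBits (carryLoop false a b).2.2.2.reverse := by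
  have h : ∀ (l : List Bool) (s : ℕ × ℕ × Bool × List Bool),
      (let t := l.foldl (fun s _ => carryStep false s) s;
        ofBits t.2.2.2.reverse + 2 ^ t.2.2.2.length * (t.1 + t.2.1 + t.2.2.1.toNat)) =
      ofBits s.2.2.2.reverse + 2 ^ s.2.2.2.length * (s.1 + s.2.1 + s.2.2.1.toNat) := by
    intro l
    induction l with
    | nil => simp
    | cons a l ih => intro s; exact (ih _).trans (carryStep_add s)
  have h' := h (true :: (a.bits ++ b.bits)) (a, b, false, [])
  change (let t := carryLoop false a b;
    ofBits t.2.2.2.reverse + 2 ^ t.2.2.2.length * (t.1 + t.2.1 + t.2.2.1.toNat)) = _ at h'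
  have h₁ := lt_two_pow_of_size a b
  have h₂ := lt_two_pow_of_size b a
  rw [add_comm] at h₂
  simp only [carryLoop_zero, carryLoop_length, List.reverse_nil, List.length_nil, pow_zero,
    Bool.toNat_false, pow_succ, zero_add, one_mul, add_zero] at h'
  rw [show ofBits [] = 0 from rfl, zero_add] at h'
  cases hc : (carryLoop false a b).2.2.1 <;> simp only [hc, Bool.toNat_true, Bool.toNat_false] at h'
  · omega
  · omega

@[fun_prop]
theorem PT.add {f g : α → ℕ} (hf : PT f) (hg : PT g) : PT (fun x => f x + g x) := by
  have := pt_carryLoop false hf hg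
  have : PT (fun x => ofBits (carryLoop false (f x) (g x)).2.2.2.reverse) := by fun_prop
  simpa only [← add_eq_carryLoop] using this

/-- The digits produced represent less than two to the power of their number, so a final borrow
occurs exactly if `a < b`, where truncated subtraction is zero. -/
theorem sub_eq_carryLoop (a b : ℕ) : a - b = if (carryLoop true a b).2.2.1 then 0 else
    ofBits (carryLoop true a b).2.2.2.reverse := by
  have h : ∀ (l : List Bool) (s : ℕ × ℕ × Bool × List Bool), a + 2 ^ s.2.2.2.length *
        (s.2.1 + s.2.2.1.toNat) = b + (ofBits s.2.2.2.reverse + 2 ^ s.2.2.2.length * s.1) →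
      (let t := l.foldl (fun s _ => carryStep true s) s;
        a + 2 ^ t.2.2.2.length * (t.2.1 + t.2.2.1.toNat) =
          b + (ofBits t.2.2.2.reverse + 2 ^ t.2.2.2.length * t.1)) := by
    intro l
    induction l with
    | nil => simp
    | cons a l ih => intro s hs; exact ih _ (carryStep_sub s _ _ hs)
  have h' := h (true :: (a.bits ++ b.bits)) (a, b, false, []) (by simp [ofBits, add_comm])
  change (let t := carryLoop true a b;
    a + 2 ^ t.2.2.2.length * (t.2.1 + t.2.2.1.toNat) =
          b + (ofBits t.2.2.2.reverse + 2 ^ t.2.2.2.length * t.1)) at h'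
  have h₁ := ofBits_lt (carryLoop true a b).2.2.2.reverse
  simp only [carryLoop_zero, List.length_reverse] at h' h₁
  cases hc : (carryLoop true a b).2.2.1 <;> simp [hc] at h' ⊢ <;> omega

@[fun_prop]
theorem PT.sub {f g : α → ℕ} (hf : PT f) (hg : PT g) : PT (fun x => f x - g x) := by
  have := pt_carryLoop true hf hg
  have : PT (fun x => if (carryLoop true (f x) (g x)).2.2.1 then 0 else
    ofBits (carryLoop true (f x) (g x)).2.2.2.reverse) := by fun_prop
  simpa only [← sub_eq_carryLoop] using this

@[fun_prop]
theorem PT.le {f g : α → ℕ} (hf : PT f) (hg : PT g) : PT (fun x => decide (f x ≤ g x)) := by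
  have : PT (fun x => decide (f x - g x = 0)) := by fun_prop
  simpa only [Nat.sub_eq_zero_iff_le] using this

@[fun_prop]
theorem PT.lt {f g : α → ℕ} (hf : PT f) (hg : PT g) : PT (fun x => decide (f x < g x)) := by
  have : PT (fun x => decide (f x + 1 ≤ g x)) := by fun_prop
  simpa only [Nat.add_one_le_iff] using this

@[fun_prop]
theorem PT.eq {f g : α → ℕ} (hf : PT f) (hg : PT g) : PT (fun x => decide (f x = g x)) := by
  have : PT (fun x => decide (f x ≤ g x ∧ g x ≤ f x)) := by fun_prop
  simpa only [← le_antisymm_iff] using this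

@[fun_prop]
theorem PT.mul {f g : α → ℕ} (hf : PT f) (hg : PT g) : PT (fun x => f x * g x) := by
  have : PT (fun x => (g x).bits.reverse.foldl
      (fun n (b : Bool) => Nat.bit false n + if b then f x else 0) 0) := by
    obtain ⟨q, hq⟩ := hf.sz_bound
    refine PT.foldl (g := fun x n (b : Bool) => Nat.bit false n + if b then f x else 0) (by fun_prop)
      (by fun_prop) (by fun_prop) (q.comp X + 2) fun x c b => ?_
    have h₁ := size_bit_le false c
    have h₂ := size_add_le (Nat.bit false c) (if b then f x else 0)
    have h₃ : (if b then f x else 0).size ≤ (f x).size := by cases b <;> simp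
    have h₄ := (hq x).trans (eval_mono q (Nat.le_add_right (sz x) (sz b)))
    simp only [sz_nat] at h₄
    simp only [sz_nat, eval_add, eval_comp, eval_X, eval_ofNat]
    omega
  convert this using 2 with x
  rw [List.foldl_reverse]
  conv_lhs => rw [← ofBits_bits (g x)]
  induction (g x).bits with
  | nil => rfl
  | cons b l ih =>
    simp only [ofBits, List.foldr_cons] at ih ⊢
    rw [← ih, Nat.bit_val, Nat.bit_val]
    cases b <;> simp <;> ring

/-- Binary long division by `d` of the number with the given digits. -/
def divModBits (d : ℕ) (l : List Bool) : ℕ × ℕ :=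
  l.foldr (fun b s => if d ≤ Nat.bit b s.2 then (Nat.bit true s.1, Nat.bit b s.2 - d)
    else (Nat.bit false s.1, Nat.bit b s.2)) (0, 0)

theorem pt_divModBits {f : α → ℕ} {l : α → List Bool} (hf : PT f) (hl : PT l) :
    PT (fun x => divModBits (f x) (l x)) := by
  have : PT (fun x => (l x).reverse.foldl
      (fun s b => if f x ≤ Nat.bit b s.2 then (Nat.bit true s.1, Nat.bit b s.2 - f x)
    else (Nat.bit false s.1, Nat.bit b s.2)) (0, 0)) := by
    refine PT.foldl (g := fun x s b => if f x ≤ Nat.bit b s.2 then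
      (Nat.bit true s.1, Nat.bit b s.2 - f x) else (Nat.bit false s.1, Nat.bit b s.2)) (by fun_prop)
      (by fun_prop) (by fun_prop) 2 fun x c b => ?_
    have h₁ := size_bit_le true c.1
    have h₂ := size_bit_le false c.1
    have h₃ := size_bit_le b c.2
    have h₄ := size_mono (Nat.sub_le (Nat.bit b c.2) (f x))
    obtain ⟨c, c'⟩ := c
    split_ifs <;> simp only [sz_mk, sz_nat, eval_ofNat] at * <;> omega
  convert this using 2 with x
  rw [List.foldl_reverse]; rfl

/-- School division from the most significant digit: a remainder below `d` becomes at most `2 * d -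
1` when the next digit is appended, so one subtraction restores it. -/
theorem divModBits_spec {d : ℕ} (hd : 0 < d) (l : List Bool) :
    (divModBits d l).2 + d * (divModBits d l).1 = ofBits l ∧ (divModBits d l).2 < d := by
  induction l with
  | nil => simp [divModBits, ofBits, hd]
  | cons b l ih =>
    obtain ⟨h₁, h₂⟩ := ih
    have hs : divModBits d (b :: l) = if d ≤ Nat.bit b (divModBits d l).2 then
      (Nat.bit true (divModBits d l).1, Nat.bit b (divModBits d l).2 - d)
      else (Nat.bit false (divModBits d l).1, Nat.bit b (divModBits d l).2) := rfl
    have ho : ofBits (b :: l) = Nat.bit b (ofBits l) := rfl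
    rw [hs, ho, ← h₁]
    generalize divModBits d l = s at h₁ h₂
    simp only [Nat.bit_val]
    have hb : b.toNat ≤ 1 := Bool.toNat_le b
    split_ifs with h
    · refine ⟨?_, by dsimp only; omega⟩
      simp only [Bool.toNat_true, mul_add, mul_one]
      rw [mul_left_comm]
      omega
    · refine ⟨?_, by dsimp only; omega⟩
      simp only [Bool.toNat_false, mul_add, add_zero]
      rw [mul_left_comm]
      omega

@[fun_prop]
theorem PT.div {f g : α → ℕ} (hf : PT f) (hg : PT g) : PT (fun x => f x / g x) := by
  have := pt_divModBits hg hf.bits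
  have : PT (fun x => if g x = 0 then 0 else (divModBits (g x) (f x).bits).1) := by
    fun_prop
  convert this using 2 with x
  split_ifs with h
  · simp [h]
  · have := divModBits_spec (Nat.pos_of_ne_zero h) (f x).bits
    rw [ofBits_bits] at this
    exact ((Nat.div_mod_unique (Nat.pos_of_ne_zero h)).2 this).1

@[fun_prop]
theorem PT.mod {f g : α → ℕ} (hf : PT f) (hg : PT g) : PT (fun x => f x % g x) := by
  have : PT (fun x => f x - g x * (f x / g x)) := by fun_prop
  convert this using 2 with x
  have := Nat.mod_add_div (f x) (g x)
  omega

/-- One round of Euclid's algorithm. -/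
def gcdStep (s : ℕ × ℕ) : ℕ × ℕ := if s.2 = 0 then s else (s.2, s.1 % s.2)

theorem gcd_gcdStep (s : ℕ × ℕ) : (gcdStep s).1.gcd (gcdStep s).2 = s.1.gcd s.2 := by
  unfold gcdStep
  split_ifs with h
  · rfl
  · rw [Nat.gcd_comm s.2, ← Nat.gcd_rec, Nat.gcd_comm]

/-- For `b ≤ a` the remainder `a % b` is at most `a / 2`, so the product of the two numbers at least
halves in each round. As many rounds as both numbers have digits are therefore enough. -/
theorem gcdStep_loop {δ : Type} (l : List δ) (s : ℕ × ℕ) (h : s.2 ≤ s.1) (h' : s.1 * s.2 < 2 ^ l.length) :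
    (l.foldl (fun s _ => gcdStep s) s).1 = s.1.gcd s.2 := by
  induction l generalizing s with
  | nil =>
    have : s.2 = 0 := by
      by_contra h0
      have : 0 < s.1 * s.2 := Nat.mul_pos (by omega) (by omega)
      simp at h'; omega
    simp [this]
  | cons a l ih =>
    rw [List.foldl_cons, ih, gcd_gcdStep]
    · unfold gcdStep
      split_ifs with h0
      · exact h
      · exact (Nat.mod_lt _ (Nat.pos_of_ne_zero h0)).le
    · unfold gcdStep
      split_ifs with h0
      · simp [h0]
      · have h₁ : 2 * (s.1 % s.2) ≤ s.1 := by
          have h₂ := Nat.mod_add_div s.1 s.2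
          have h₃ := Nat.mod_lt s.1 (Nat.pos_of_ne_zero h0)
          have h₄ : 1 ≤ s.1 / s.2 := Nat.div_pos h (Nat.pos_of_ne_zero h0)
          have h₅ := Nat.mul_le_mul_left s.2 h₄
          omega
        have h₂ := Nat.mul_le_mul_left s.2 h₁
        simp only [List.length_cons, pow_succ] at h'
        rw [mul_left_comm, mul_comm s.2 s.1] at h₂
        dsimp only
        omega

@[fun_prop]
theorem PT.gcd {f g : α → ℕ} (hf : PT f) (hg : PT g) : PT (fun x => (f x).gcd (g x)) := by
  have : PT (fun x => (((f x).bits ++ (g x).bits).foldl (fun s _ => gcdStep s)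
      (if g x ≤ f x then (f x, g x) else (g x, f x))).1) := by
    refine PT.fst (PT.foldl (g := fun _ s _ => gcdStep s) (by unfold gcdStep; fun_prop)
      (by fun_prop) (by fun_prop) 0 fun x c b => ?_)
    unfold gcdStep
    have := size_mono (Nat.mod_le c.1 c.2)
    obtain ⟨c, c'⟩ := c
    split_ifs <;> simp at *
    omega
  convert this using 2 with x
  have h₁ : f x * g x < 2 ^ ((f x).bits ++ (g x).bits).length := by
    rw [List.length_append, Nat.size_eq_bits_len, Nat.size_eq_bits_len, ← Nat.size_le]
    exact size_mul_le _ _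
  split_ifs with h
  · rw [gcdStep_loop _ _ h h₁]
  · rw [gcdStep_loop _ _ (by dsimp only; omega) (by dsimp only; rwa [mul_comm]), Nat.gcd_comm]

/-! ### Integers -/

instance : Enc ℤ where
  enc := encInt
  sz z := z.natAbs.size + 3
  sz_le z := by
    have h₁ := sz_le (decide (z < 0))
    have h₂ := sz_le z.natAbs
    change _ ≤ (enc (decide (z < 0))).size + (enc z.natAbs).size + 1
    simp only [sz_bool, sz_nat] at h₁ h₂
    omega
  size_le z := by
    have h₁ := size_le (decide (z < 0))
    have h₂ := size_le z.natAbs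
    change (enc (decide (z < 0))).size + (enc z.natAbs).size + 1 ≤ _
    simp only [sz_bool, sz_nat] at h₁ h₂
    omega

@[simp] theorem sz_int (z : ℤ) : sz z = z.natAbs.size + 3 := rfl

@[fun_prop]
theorem PT.natAbs {f : α → ℤ} (hf : PT f) : PT (fun x => (f x).natAbs) :=
  (PT.of_snd (f := fun z : ℤ => z.natAbs) fun _ => rfl).comp hf

@[fun_prop]
theorem PT.int_neg_iff {f : α → ℤ} (hf : PT f) : PT (fun x => decide (f x < 0)) :=
  (PT.of_fst (f := fun z : ℤ => decide (z < 0)) fun _ => rfl).comp hf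

/-- The integer with the given sign and absolute value. -/
def mkInt (s : Bool) (n : ℕ) : ℤ := if s then -n else n

theorem mkInt_eq (z : ℤ) : mkInt (decide (z < 0)) z.natAbs = z := by
  unfold mkInt
  split_ifs with h <;> simp at h <;> omega

@[fun_prop]
theorem pt_mkInt {b : α → Bool} {f : α → ℕ} (hb : PT b) (hf : PT f) :
    PT (fun x => mkInt (b x) (f x)) := by
  -- Zero is encoded with non-negative sign, whatever sign was requested.
  have : PT (fun x => (b x && decide (¬ f x = 0), f x)) := by fun_prop
  refine this.of_enc_eq fun x => ?_
  have h₁ : (b x && decide (¬ f x = 0)) = decide (mkInt (b x) (f x) < 0) := by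
    unfold mkInt; cases b x <;> simp [Nat.pos_iff_ne_zero]
  have h₂ : f x = (mkInt (b x) (f x)).natAbs := by
    unfold mkInt; cases b x <;> simp
  conv_lhs => rw [h₁]
  conv_lhs => arg 1; arg 2; rw [h₂]
  rfl

@[fun_prop]
theorem PT.int_mul {f g : α → ℤ} (hf : PT f) (hg : PT g) : PT (fun x => f x * g x) := by
  have : PT (fun x => mkInt (decide (f x < 0) ^^ decide (g x < 0))
    ((f x).natAbs * (g x).natAbs)) := by fun_prop
  convert this using 2 with x
  conv_lhs => rw [← mkInt_eq (f x), ← mkInt_eq (g x)]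
  cases decide (f x < 0) <;> cases decide (g x < 0) <;> simp [mkInt]

@[fun_prop]
theorem PT.int_add {f g : α → ℤ} (hf : PT f) (hg : PT g) : PT (fun x => f x + g x) := by
  have : PT (fun x => if decide (f x < 0) ^^ decide (g x < 0) then
      (if (f x).natAbs ≤ (g x).natAbs then mkInt (decide (g x < 0)) ((g x).natAbs - (f x).natAbs)
        else mkInt (decide (f x < 0)) ((f x).natAbs - (g x).natAbs))
      else mkInt (decide (f x < 0)) ((f x).natAbs + (g x).natAbs)) := by fun_prop
  convert this using 2 with x
  by_cases h₁ : f x < 0 <;> by_cases h₂ : g x < 0 <;>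
    simp [mkInt, h₁, h₂, -Nat.cast_natAbs]
  all_goals try split_ifs
  all_goals omega

@[fun_prop]
theorem PT.int_neg {f : α → ℤ} (hf : PT f) : PT (fun x => -f x) := by
  have : PT (fun x => mkInt (!decide (f x < 0)) (f x).natAbs) := by fun_prop
  convert this using 2 with x
  by_cases h : f x < 0 <;> simp [mkInt, h, -Nat.cast_natAbs] <;> omega

@[fun_prop]
theorem PT.int_natCast {f : α → ℕ} (hf : PT f) : PT (fun x => (f x : ℤ)) := by
  have : PT (fun x => mkInt false (f x)) := by fun_prop
  simpa [mkInt] using this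

theorem sz_int_add_le (a b : ℤ) : sz (a + b) ≤ sz a + sz b := by
  have h₁ := size_mono (Int.natAbs_add_le a b)
  have h₂ := size_add_le a.natAbs b.natAbs
  simp only [sz_int]
  omega

/-! ### Rational numbers -/

/-- Taking the maximum of the two digit counts, not their sum, makes the measure subadditive under
addition as well as multiplication. Numerator and denominator take four nodes per digit each, which
leads to the factor eight. -/
instance : Enc ℚ where
  enc := encRat
  sz q := max q.num.natAbs.size q.den.size + 3
  sz_le q := by
    have h₁ := sz_le q.num
    have h₂ := sz_le q.den
    change _ ≤ (enc q.num).size + (enc q.den).size + 1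
    simp only [sz_int, sz_nat] at h₁ h₂
    omega
  size_le q := by
    have h₁ : ∀ n : ℕ, (enc n).size ≤ 4 * n.size + 4 := fun n => by
      have : ∀ l : List Bool, (encList encBool l).size ≤ 4 * l.length + 4 := by
        intro l
        induction l with
        | nil => simp [encList, Data.size]
        | cons a l ih =>
          have : (encBool a).size ≤ 3 := by cases a <;> simp [encBool, Data.size]
          simp only [encList, List.foldr_cons, Data.size, List.length_cons] at ih ⊢; omega
      rw [← Nat.size_eq_bits_len]
      exact this _
    have h₂ : (enc (decide (q.num < 0))).size ≤ 3 := by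
      cases decide (q.num < 0) <;> simp [enc, encBool, Data.size]
    have h₃ := h₁ q.num.natAbs
    have h₄ := h₁ q.den
    change ((enc (decide (q.num < 0))).size + (enc q.num.natAbs).size + 1) + (enc q.den).size + 1 ≤ _
    omega

theorem sz_rat (q : ℚ) : sz q = max q.num.natAbs.size q.den.size + 3 := rfl

@[fun_prop]
theorem PT.num {f : α → ℚ} (hf : PT f) : PT (fun x => (f x).num) :=
  (PT.of_fst (f := fun z : ℚ => z.num) fun _ => rfl).comp hf

@[fun_prop]
theorem PT.den {f : α → ℚ} (hf : PT f) : PT (fun x => (f x).den) :=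
  (PT.of_snd (f := fun z : ℚ => z.den) fun _ => rfl).comp hf

theorem mkRat_num_den (z : ℤ) (d : ℕ) (hd : d ≠ 0) :
    (mkRat z d).num = mkInt (decide (z < 0)) (z.natAbs / z.natAbs.gcd d) ∧
      (mkRat z d).den = d / z.natAbs.gcd d := by
  rw [← Rat.normalize_eq_mkRat hd, Rat.normalize_eq]
  refine ⟨?_, rfl⟩
  have hg : z.natAbs.gcd d ∣ z.natAbs := Nat.gcd_dvd_left _ _
  dsimp only
  generalize z.natAbs.gcd d = g at hg
  conv_lhs => rw [← mkInt_eq z]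
  unfold mkInt
  split_ifs
  · rw [Int.neg_ediv_of_dvd (by exact_mod_cast hg)]; simp
  · simp

@[fun_prop]
theorem pt_mkRat {f : α → ℤ} {g : α → ℕ} (hf : PT f) (hg : PT g) :
    PT (fun x => mkRat (f x) (g x)) := by
  have : PT (fun x => if g x = 0 then ((0 : ℤ), 1) else
    (mkInt (decide (f x < 0)) ((f x).natAbs / (f x).natAbs.gcd (g x)),
      g x / (f x).natAbs.gcd (g x))) := by fun_prop
  refine this.of_enc_eq fun x => ?_
  split_ifs with h
  · simp only [h, Rat.mkRat_zero]; rfl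
  · rw [← (mkRat_num_den _ _ h).1, ← (mkRat_num_den _ _ h).2]; rfl

@[fun_prop]
theorem PT.rat_add {f g : α → ℚ} (hf : PT f) (hg : PT g) : PT (fun x => f x + g x) := by
  simp only [Rat.add_def']
  fun_prop

@[fun_prop]
theorem PT.rat_mul {f g : α → ℚ} (hf : PT f) (hg : PT g) : PT (fun x => f x * g x) := by
  simp only [Rat.mul_def']
  fun_prop

@[fun_prop]
theorem PT.rat_neg {f : α → ℚ} (hf : PT f) : PT (fun x => -f x) := by
  have : PT (fun x => (-(f x).num, (f x).den)) := by fun_prop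
  exact this.of_enc_eq fun x => rfl

@[fun_prop]
theorem PT.rat_inv {f : α → ℚ} (hf : PT f) : PT (fun x => (f x)⁻¹) := by
  -- The sign moves to the new numerator. At zero the new denominator is `0`, where `mkRat` gives
  -- `0`, in accordance with `0⁻¹ = 0`.
  have : PT (fun x => mkRat (mkInt (decide ((f x).num < 0)) (f x).den) (f x).num.natAbs) := by
    fun_prop
  convert this using 2 with x
  conv_lhs => rw [← Rat.num_div_den (f x)]
  rw [Rat.mkRat_eq_div, inv_div]
  conv_lhs => rw [← mkInt_eq (f x).num]
  cases decide ((f x).num < 0) <;> simp [mkInt, div_neg, neg_div]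

@[fun_prop]
theorem PT.rat_intCast {f : α → ℤ} (hf : PT f) : PT (fun x => (f x : ℚ)) := by
  have : PT (fun x => (f x, 1)) := by fun_prop
  exact this.of_enc_eq fun x => rfl

theorem size_mkRat_le {z : ℤ} {d n : ℕ} (hd : d ≠ 0) (h₁ : z.natAbs.size ≤ n) (h₂ : d.size ≤ n) :
    sz (mkRat z d) ≤ n + 3 := by
  obtain ⟨h₃, h₄⟩ := mkRat_num_den z d hd
  have h₅ : (mkRat z d).num.natAbs = z.natAbs / z.natAbs.gcd d := by
    rw [h₃]; unfold mkInt; split_ifs <;> simp only [Int.natAbs_neg, Int.natAbs_natCast]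
  rw [sz_rat, h₄, h₅]
  have := size_mono (Nat.div_le_self z.natAbs (z.natAbs.gcd d))
  have := size_mono (Nat.div_le_self d (z.natAbs.gcd d))
  omega

/-- Cross-multiplication adds the digit counts and the carry costs one more; reduction only shrinks.
As no factor appears, a sum of many terms keeps a size linear in the total size of the terms. -/
theorem sz_rat_add_le (a b : ℚ) : sz (a + b) ≤ sz a + sz b := by
  rw [Rat.add_def']
  refine (size_mkRat_le (n := max a.num.natAbs.size a.den.size +
    max b.num.natAbs.size b.den.size + 1) (Nat.mul_ne_zero a.den_nz b.den_nz) ?_ ?_).trans ?_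
  · refine (size_mono (Int.natAbs_add_le _ _)).trans ((size_add_le _ _).trans ?_)
    have h₁ := size_mul_le a.num.natAbs b.den
    have h₂ := size_mul_le b.num.natAbs a.den
    simp only [Int.natAbs_mul, Int.natAbs_natCast]
    omega
  · have := size_mul_le a.den b.den
    omega
  · simp only [sz_rat]; omega

theorem sz_rat_mul_le (a b : ℚ) : sz (a * b) ≤ sz a + sz b := by
  rw [Rat.mul_def']
  refine (size_mkRat_le (n := max a.num.natAbs.size a.den.size +
    max b.num.natAbs.size b.den.size) (Nat.mul_ne_zero a.den_nz b.den_nz) ?_ ?_).trans ?_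
  · have := size_mul_le a.num.natAbs b.num.natAbs
    rw [Int.natAbs_mul]
    omega
  · have := size_mul_le a.den b.den
    omega
  · simp only [sz_rat]; omega

@[fun_prop]
theorem PT.rat_prod {l : α → List ℚ} (hl : PT l) : PT (fun x => (l x).prod) := by
  have : PT (fun x => (l x).foldl (fun a b => a * b) 1) :=
    PT.foldl (g := fun _ a b => a * b) (by fun_prop) hl (PT.const _) X fun x c b => by
      have := sz_rat_mul_le c b
      simp only [eval_X]; omega
  convert this using 2 with x
  rw [List.prod_eq_foldl]

/-! ### Decoding -/

/-- The list of data represented by a datum. -/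
def Data.toList : Data → List Data
  | leaf => []
  | node a b => a :: b.toList

theorem enc_toList (x : Data) : enc x.toList = x := by
  induction x with
  | leaf => rfl
  | node a b _ ih => simp only [Data.toList, enc_cons, ih, enc_data]

theorem toList_enc {α : Type} [Enc α] (l : List α) : (enc l).toList = l.map enc := by
  induction l with
  | nil => rfl
  | cons a l ih => simp [Data.toList, ih]

@[fun_prop]
-- A datum and its list of entries have the same encoding, so decoding a list is free.
theorem PT.toList {f : α → Data} (hf : PT f) : PT (fun x => (f x).toList) :=
  hf.of_enc_eq fun _ => (enc_toList _).symm

def decBool : Data → Bool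
  | Data.leaf => false
  | Data.node _ _ => true

@[fun_prop]
theorem pt_decBool {f : α → Data} (hf : PT f) : PT (fun x => decBool (f x)) :=
  PT.cond_leaf hf (PT.const false) (PT.const true) (fun a h => by rw [h]; rfl) fun a h => by
    cases h' : f a with
    | leaf => exact absurd h' h
    | node => rfl

def decNat (x : Data) : ℕ := ofBits (x.toList.map decBool)

def decRat (x : Data) : ℚ :=
  mkRat (mkInt (decBool x.fst.fst) (decNat x.fst.snd)) (decNat x.snd)

def decMatrix (x : Data) : List (List Bool) := x.toList.map fun r => r.toList.map decBool

theorem decBool_enc (b : Bool) : decBool (enc b) = b := by cases b <;> rfl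

theorem decNat_enc (n : ℕ) : decNat (enc n) = n := by
  rw [decNat, enc_nat, toList_enc, List.map_map]
  conv_rhs => rw [← ofBits_bits n]
  congr 1
  exact (List.map_congr_left fun b _ => decBool_enc b).trans (List.map_id _)

theorem decRat_enc (q : ℚ) : decRat (enc q) = q := by
  change mkRat (mkInt (decBool (enc (decide (q.num < 0)))) (decNat (enc q.num.natAbs)))
    (decNat (enc q.den)) = q
  rw [decBool_enc, decNat_enc, decNat_enc, mkInt_eq, Rat.mkRat_self]

theorem decMatrix_enc (M : List (List Bool)) : decMatrix (enc M) = M := by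
  simp only [decMatrix, toList_enc, List.map_map]
  refine (List.map_congr_left fun r _ => ?_).trans (List.map_id _)
  simp only [Function.comp, toList_enc, List.map_map]
  exact (List.map_congr_left fun b _ => decBool_enc b).trans (List.map_id _)

@[fun_prop]
theorem pt_decRat {f : α → Data} (hf : PT f) : PT (fun x => decRat (f x)) := by
  unfold decRat decNat; fun_prop

@[fun_prop]
theorem pt_decMatrix {f : α → Data} (hf : PT f) : PT (fun x => decMatrix (f x)) := by
  unfold decMatrix; fun_prop

/-! ### Numbering the elements of a list -/

theorem size_le_self (n : ℕ) : n.size ≤ n := Nat.size_le.2 Nat.lt_two_pow_self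

/-- The increments of the state contain the running counter, whose size depends on the round. The
bound is therefore stated for prefixes: an index is below the length of the list. -/
theorem pt_zipIdx_aux : PT (fun l : List β => l.zipIdx) := by
  have key : ∀ (l : List β) (n : ℕ) (o : List (β × ℕ)),
      l.foldl (fun s a => (s.1 + 1, (a, s.1) :: s.2)) (n, o) =
        (n + l.length, (l.zipIdx n).reverse ++ o) := by
    intro l
    induction l with
    | nil => simp
    | cons a l ih => intro n o; simp [ih]; omega
  have : PT (fun l : List β => (l.foldl (fun (s : ℕ × List (β × ℕ)) a =>
      (s.1 + 1, (a, s.1) :: s.2)) (0, [])).2.reverse) := by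
    refine PT.reverse (PT.snd (PT.foldl_of_bound
      (g := fun (_ : List β) (s : ℕ × List (β × ℕ)) a => (s.1 + 1, (a, s.1) :: s.2))
      (by fun_prop) (by fun_prop) (by fun_prop) (X * (2 * X + 4) + X + 3) fun l m hm => ?_))
    rw [key]
    have h₁ := hm.length_le.trans (length_lt_sz l).le
    have h₂ := size_le_self m.length
    have h₃ := sz_list_le (l := m.zipIdx.reverse) (b := 2 * sz l + 3) fun p hp => by
      obtain ⟨a, i⟩ := p
      have hp := List.mem_reverse.1 hp
      have h₄ := sz_le_of_mem (hm.subset (List.fst_mem_of_mem_zipIdx hp))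
      have h₅ := List.snd_lt_of_mem_zipIdx hp
      have h₆ := size_le_self i
      simp only [sz_mk, sz_nat] at h₄ h₅ ⊢
      omega
    have h₇ := Nat.mul_le_mul_right (2 * sz l + 4) h₁
    rw [List.length_reverse, List.length_zipIdx, show 2 * sz l + 3 + 1 = 2 * sz l + 4 from rfl] at h₃
    simp only [sz_mk, sz_nat, zero_add, List.append_nil, eval_add, eval_mul, eval_X, eval_ofNat]
    omega
  convert this using 2 with l
  simp [key]

@[fun_prop]
theorem PT.zipIdx {l : α → List β} (hl : PT l) : PT (fun x => (l x).zipIdx) :=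
  pt_zipIdx_aux.comp hl

@[fun_prop]
theorem PT.length {l : α → List β} (hl : PT l) : PT (fun x => (l x).length) := by
  have : PT (fun x => (l x).foldl (fun n _ => n + 1) 0) :=
    PT.foldl (g := fun _ n _ => n + 1) (by fun_prop) hl (PT.const _) 1 fun x c b => by
      have := size_add_le c 1
      have : Nat.size 1 = 1 := Nat.size_one
      have : c.size = 0 → c = 0 := Nat.size_eq_zero.1
      rcases Nat.eq_zero_or_pos c.size with h | h
      · simp [Nat.size_eq_zero.1 h]
      · simp; omega
  convert this using 2 with x
  have : ∀ (l : List β) n, l.foldl (fun n _ => n + 1) n = n + l.length := by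
    intro l
    induction l with
    | nil => simp
    | cons a l ih => intro n; rw [List.foldl_cons, ih, List.length_cons]; omega
  simp [this]

@[fun_prop]
theorem PT.range_length {l : α → List β} (hl : PT l) : PT (fun x => List.range (l x).length) := by
  have : PT (fun x => (l x).zipIdx.map fun p => p.2) := by fun_prop
  convert this using 2 with x
  rw [List.range_eq_range', ← List.zipIdx_map_snd 0 (l x)]

/-! ### Polynomials with integer coefficients, given by the lists of their coefficients -/

/-- Addition of coefficient lists. -/
def padd : List ℤ → List ℤ → List ℤ
  | [], m => m
  | l, [] => l
  | a :: l, b :: m => (a + b) :: padd l m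

/-- Multiplication of coefficient lists. -/
def pmul (p q : List ℤ) : List ℤ := p.foldr (fun a r => padd (q.map fun b => a * b) (0 :: r)) []

/-- The product of a list of coefficient lists. -/
def pprod (l : List (List ℤ)) : List ℤ := l.foldl (fun r p => pmul p r) [1]

/-- The polynomial with the given coefficients. -/
noncomputable def toPoly (l : List ℤ) : ℚ[X] := l.foldr (fun (a : ℤ) p => C (a : ℚ) + X * p) 0

theorem toPoly_cons (a : ℤ) (l : List ℤ) : toPoly (a :: l) = C (a : ℚ) + X * toPoly l := rfl

theorem toPoly_nil : toPoly [] = 0 := rfl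

theorem coeff_toPoly (l : List ℤ) (k : ℕ) : (toPoly l).coeff k = (l.getD k 0 : ℤ) := by
  induction l generalizing k with
  | nil => simp [toPoly]
  | cons a l ih => cases k <;> simp only [toPoly_cons, coeff_add, coeff_C_zero, coeff_C_succ, coeff_X_mul,
      coeff_X_mul_zero, ih, List.getD_cons_zero, List.getD_cons_succ, add_zero, zero_add]

theorem toPoly_padd (l m : List ℤ) : toPoly (padd l m) = toPoly l + toPoly m := by
  induction l, m using padd.induct with
  | case1 m => simp [padd, toPoly_nil]
  | case2 l h => cases l <;> simp [padd, toPoly_nil]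
  | case3 a l b m ih => simp only [padd, toPoly_cons, ih, Int.cast_add, C_add]; ring

theorem toPoly_map_mul (a : ℤ) (q : List ℤ) :
    toPoly (q.map fun b => a * b) = C (a : ℚ) * toPoly q := by
  induction q with
  | nil => simp [toPoly_nil]
  | cons b q ih => simp only [List.map_cons, toPoly_cons, ih, Int.cast_mul, C_mul]; ring

theorem toPoly_pmul (p q : List ℤ) : toPoly (pmul p q) = toPoly p * toPoly q := by
  induction p with
  | nil => simp [pmul, toPoly_nil]
  | cons a p ih =>
    simp only [pmul, List.foldr_cons] at ih ⊢
    rw [toPoly_padd, toPoly_map_mul, toPoly_cons, toPoly_cons, ih]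
    simp only [Int.cast_zero, C_0]; ring

theorem toPoly_pprod (l : List (List ℤ)) : toPoly (pprod l) = (l.map toPoly).prod := by
  have : ∀ (l : List (List ℤ)) r, toPoly (l.foldl (fun r p => pmul p r) r) =
      (l.map toPoly).prod * toPoly r := by
    intro l
    induction l with
    | nil => simp
    | cons p l ih => intro r; simp only [List.foldl_cons, ih, toPoly_pmul, List.map_cons,
        List.prod_cons]; ring
  rw [pprod, this]
  simp [toPoly]

theorem sz_padd_le (l m : List ℤ) : sz (padd l m) ≤ sz l + sz m := by
  induction l, m using padd.induct with
  | case1 m => simp only [padd]; omega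
  | case2 l h => cases l <;> simp only [padd] <;> omega
  | case3 a l b m ih =>
    have := sz_int_add_le a b
    simp only [padd, sz_cons]; omega

@[fun_prop]
theorem pt_padd {f g : α → List ℤ} (hf : PT f) (hg : PT g) : PT (fun x => padd (f x) (g x)) := by
  have : PT (fun x =>
      let s := (f x).foldl (fun (s : List ℤ × List ℤ) (a : ℤ) => s.1.head?.elim (s.1, a :: s.2)
        fun b => (s.1.tail, (a + b) :: s.2)) (g x, ([] : List ℤ))
      s.2.reverse ++ s.1) := by
    have h := PT.foldl (l := f) (i := fun x => (g x, ([] : List ℤ)))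
      (g := fun (_ : α) (s : List ℤ × List ℤ) (a : ℤ) =>
        s.1.head?.elim (s.1, a :: s.2) fun b => (s.1.tail, (a + b) :: s.2))
      (by fun_prop) (by fun_prop) (by fun_prop) (X + 2) fun x c b => by
        obtain ⟨_ | ⟨c, l⟩, m⟩ := c
        · simp only [List.head?_nil, Option.elim_none, sz_mk, sz_cons, eval_add, eval_X, eval_ofNat]
          omega
        · have := sz_int_add_le b c
          simp only [List.head?_cons, Option.elim_some, sz_mk, sz_cons, eval_add, eval_X, eval_ofNat,
            List.tail_cons]
          omega
    fun_prop
  convert this using 2 with x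
  have : ∀ l m o : List ℤ, (let s := l.foldl (fun (s : List ℤ × List ℤ) (a : ℤ) =>
      s.1.head?.elim (s.1, a :: s.2) fun b => (s.1.tail, (a + b) :: s.2)) (m, o);
      s.2.reverse ++ s.1) = o.reverse ++ padd l m := by
    intro l
    induction l with
    | nil => intro m o; rfl
    | cons a l ih =>
      intro m o
      cases m with
      | nil =>
        refine (ih [] (a :: o)).trans ?_
        cases l <;> simp [padd]
      | cons b m =>
        refine (ih m ((a + b) :: o)).trans ?_
        simp [padd]
  rw [this]; rfl

@[fun_prop]
theorem pt_pmul {f g : α → List ℤ} (hf : PT f) (hg : PT g) : PT (fun x => pmul (f x) (g x)) := by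
  have hm : PT (fun p : α × ℤ => (g p.1).map fun b => p.2 * b) := by fun_prop
  obtain ⟨q, hq⟩ := hm.sz_bound
  have : PT (fun x => (f x).reverse.foldl
      (fun r a => padd ((g x).map fun b => a * b) (0 :: r)) []) :=
    PT.foldl (g := fun x r a => padd ((g x).map fun b => a * b) (0 :: r)) (by fun_prop)
      (by fun_prop) (by fun_prop) (q.comp (X + 1) + 4) fun x c b => by
        have h₁ := sz_padd_le ((g x).map fun a => b * a) (0 :: c)
        have h₂ := hq (x, b)
        simp only [sz_mk, sz_cons] at h₁ h₂
        have h₃ : sz (0 : ℤ) = 3 := by simp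
        simp only [eval_add, eval_comp, eval_X, eval_one, eval_ofNat]
        omega
  convert this using 2 with x
  rw [List.foldl_reverse]; rfl

/-- The sum of the absolute values of the coefficients. -/
def pnorm (l : List ℤ) : ℕ := (l.map Int.natAbs).sum

theorem pnorm_padd_le (l m : List ℤ) : pnorm (padd l m) ≤ pnorm l + pnorm m := by
  induction l, m using padd.induct with
  | case1 m => simp [padd, pnorm]
  | case2 l h => cases l <;> simp [padd, pnorm]
  | case3 a l b m ih =>
    have := Int.natAbs_add_le a b
    simp only [padd, pnorm, List.map_cons, List.sum_cons] at ih ⊢; omega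

/-- The coefficient norm is submultiplicative, which controls the number of digits of the
coefficients through a long product. -/
theorem pnorm_pmul_le (p q : List ℤ) : pnorm (pmul p q) ≤ pnorm p * pnorm q := by
  induction p with
  | nil => simp [pmul, pnorm]
  | cons a p ih =>
    refine (pnorm_padd_le _ _).trans ?_
    have : pnorm (q.map fun b => a * b) = a.natAbs * pnorm q := by
      simp only [pnorm, List.map_map, ← List.sum_map_mul_left]
      congr 2
      ext b
      simp [Int.natAbs_mul]
    have h₂ : pnorm (a :: p) = a.natAbs + pnorm p := rfl
    have h₃ : ∀ r, pnorm (0 :: r) = pnorm r := fun r => by simp [pnorm]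
    rw [this, h₂, add_mul, h₃]
    exact Nat.add_le_add_left ih _

theorem length_padd (l m : List ℤ) : (padd l m).length = max l.length m.length := by
  induction l, m using padd.induct with
  | case1 m => simp [padd]
  | case2 l h => cases l <;> simp [padd]
  | case3 a l b m ih => simp [padd, ih]

theorem length_pmul_le (p q : List ℤ) : (pmul p q).length ≤ p.length + q.length := by
  induction p with
  | nil => simp [pmul]
  | cons a p ih =>
    simp only [pmul, List.foldr_cons, length_padd, List.length_map, List.length_cons] at ih ⊢
    omega

theorem natAbs_le_pnorm {a : ℤ} {l : List ℤ} (h : a ∈ l) : a.natAbs ≤ pnorm l :=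
  List.le_sum_of_mem (List.mem_map_of_mem h)

theorem pnorm_le (l : List ℤ) : pnorm l ≤ 2 ^ sz l := by
  induction l with
  | nil => simp [pnorm]
  | cons a l ih =>
    have h₁ := (Nat.lt_size_self a.natAbs).le.trans
      (Nat.pow_le_pow_right two_pos (show a.natAbs.size ≤ sz a + sz l by simp; omega))
    have h₂ := ih.trans (Nat.pow_le_pow_right two_pos (show sz l ≤ sz a + sz l by omega))
    simp only [pnorm, List.map_cons, List.sum_cons, sz_cons, pow_succ] at *
    omega

/-- Norms multiply and lengths add, so the product has few coefficients, each with few digits. This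
gives the prefix bound in `pt_pprod`. -/
theorem pprod_bounds (l : List (List ℤ)) :
    pnorm (pprod l) ≤ 2 ^ sz l ∧ (pprod l).length ≤ sz l := by
  induction l using List.reverseRecOn with
  | nil => simp [pprod, pnorm]
  | append_singleton l p ih =>
    have h : pprod (l ++ [p]) = pmul p (pprod l) := by simp [pprod]
    have hs : sz (l ++ [p]) = sz p + sz l + 1 := by
      have := sz_append l [p]
      simp only [sz_cons, sz_nil] at this
      omega
    rw [h, hs]
    constructor
    · refine (pnorm_pmul_le _ _).trans ((Nat.mul_le_mul (pnorm_le p) ih.1).trans ?_)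
      rw [← pow_add]
      exact Nat.pow_le_pow_right two_pos (by omega)
    · have := length_pmul_le p (pprod l)
      have := length_lt_sz p
      omega

@[fun_prop]
theorem pt_pprod {f : α → List (List ℤ)} (hf : PT f) : PT (fun x => pprod (f x)) := by
  refine PT.comp (g := fun l => pprod l) ?_ hf
  refine PT.foldl_of_bound (g := fun _ r p => pmul p r) (by fun_prop) (by fun_prop) (by fun_prop)
    (X * (X + 5) + 1) fun l m hm => ?_
  have hml : sz m ≤ sz l := by
    obtain ⟨r, rfl⟩ := hm
    have := sz_append m r
    have := one_le_sz r
    omega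
  obtain ⟨h₁, h₂⟩ := pprod_bounds m
  refine (sz_list_le (l := pprod m) (b := sz l + 4) fun a ha => ?_).trans ?_
  · have h₃ : a.natAbs.size ≤ sz m + 1 := Nat.size_le.2
      (((natAbs_le_pnorm ha).trans h₁).trans_lt (Nat.pow_lt_pow_right one_lt_two (by omega)))
    simp only [sz_int]
    omega
  · rw [show sz l + 4 + 1 = sz l + 5 from rfl]
    simp only [eval_add, eval_mul, eval_X, eval_one, eval_ofNat]
    have := Nat.mul_le_mul_right (sz l + 5) (h₂.trans hml)
    omega

/-! ### Running programs with a clock -/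

/-- One step of the depth-first traversal of the trees on a stack, which uses up one unit of fuel
for each node. -/
def consumeStep (s : List Data × List Unit) : List Data × List Unit :=
  s.1.head?.elim s fun d =>
    (d.toList.head?.elim s.1.tail fun a => a :: d.snd :: s.1.tail, s.2.tail)

/-- Use up as many units of fuel as the size of `x`. -/
def consume (B : List Unit) (x : Data) : Option (List Unit) :=
  let s := B.foldl (fun s _ => consumeStep s) ([x], B)
  if s.1.isEmpty then some s.2 else none

/-- Use up one unit of fuel. -/
def tick (B : List Unit) : Option (List Unit) := B.head?.map fun _ => B.tail

/-- One round of a loop with a clock. The Boolean tells whether the loop has ended. -/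
def loopStep (r : List Unit → Data → Option (List Unit × Data))
    (s : Option (Bool × List Unit × Data)) : Option (Bool × List Unit × Data) :=
  s.bind fun p => if p.1 then some p else (tick p.2.1).bind fun B =>
    if decBool p.2.2.fst then (r B p.2.2).map fun q => (false, q.1, q.2)
    else some (true, B, p.2.2.snd)

/-- Run a program with the given amount of fuel; return the remaining fuel and the output. -/
def Code.run : Code → List Unit → Data → Option (List Unit × Data)
  | Code.id, B, x => (tick B).map fun B => (B, x)
  | Code.leaf, B, _ => (tick B).map fun B => (B, Data.leaf)
  | Code.fst, B, x => (tick B).map fun B => (B, x.fst)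
  | Code.snd, B, x => (tick B).map fun B => (B, x.snd)
  | Code.pair f g, B, x => (tick B).bind fun B => (consume B x).bind fun B =>
      (f.run B x).bind fun p => (g.run p.1 x).map fun q => (q.1, Data.node p.2 q.2)
  | Code.comp g f, B, x => (tick B).bind fun B => (f.run B x).bind fun p => g.run p.1 p.2
  | Code.cond f g, B, x => (tick B).bind fun B =>
      if decBool x.fst then g.run B x.snd else f.run B x.snd
  -- Every round uses up at least one unit, so the fuel also bounds the number of rounds and the
  -- recursion is structural in the program.
  | Code.loop f, B, x =>
      (B.foldl (fun s _ => loopStep f.run s) (some (false, B, x))).bind fun p =>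
        if p.1 then some p.2 else none

theorem tick_eq_some {B B' : List Unit} : tick B = some B' ↔ B = () :: B' := by
  cases B <;> simp [tick]

/-- The list `B` that counts rounds is separated from the fuel `R`: a round removes one node and one
unit while the stack is non-empty, and does nothing afterwards. -/
theorem consume_loop (B : List Unit) (st : List Data) (R : List Unit) :
    B.length ≤ R.length → ((st.map Data.size).sum ≤ B.length →
      B.foldl (fun s _ => consumeStep s) (st, R) = ([], R.drop (st.map Data.size).sum)) ∧
    (B.length < (st.map Data.size).sum →
      (B.foldl (fun s _ => consumeStep s) (st, R)).1 ≠ []) := by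
  induction B generalizing st R with
  | nil =>
    intro _
    cases st with
    | nil => simp
    | cons d st => have := d.one_le_size; simp; omega
  | cons u B ih =>
    intro hR
    obtain _ | ⟨u', R⟩ := R
    · simp at hR
    simp only [List.length_cons, add_le_add_iff_right] at hR
    rw [List.foldl_cons]
    cases st with
    | nil =>
      have h := (ih [] (u' :: R) (by simp; omega)).1 (by simp)
      rw [show consumeStep ([], u' :: R) = ([], u' :: R) from rfl, h]
      simp
    | cons d st =>
      cases d with
      | leaf =>
        rw [show consumeStep (Data.leaf :: st, u' :: R) = (st, R) from rfl]
        have h := ih st R hR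
        simp only [List.map_cons, Data.size, List.sum_cons, List.length_cons]
        rw [add_comm 1, List.drop_succ_cons]
        exact ⟨fun h' => h.1 (by omega), fun h' => h.2 (by omega)⟩
      | node a b =>
        rw [show consumeStep (Data.node a b :: st, u' :: R) = (a :: b :: st, R) from rfl]
        have h := ih (a :: b :: st) R hR
        simp only [List.map_cons, Data.size, List.sum_cons, List.length_cons] at h ⊢
        rw [show a.size + b.size + 1 + (st.map Data.size).sum =
          a.size + (b.size + (st.map Data.size).sum) + 1 by omega, List.drop_succ_cons]
        exact ⟨fun h' => h.1 (by omega), fun h' => h.2 (by omega)⟩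

theorem consume_eq (B : List Unit) (x : Data) :
    consume B x = if x.size ≤ B.length then some (B.drop x.size) else none := by
  have h := consume_loop B [x] B le_rfl
  simp only [List.map_cons, List.map_nil, List.sum_cons, List.sum_nil, add_zero] at h
  unfold consume
  by_cases hx : x.size ≤ B.length
  · rw [if_pos hx, h.1 hx]; rfl
  · rw [if_neg hx]
    exact if_neg fun h' => h.2 (by omega) (List.isEmpty_iff.1 h')

theorem consume_eq_some {B B' : List Unit} {x : Data} (h : consume B x = some B') :
    x.size + B'.length = B.length := by
  rw [consume_eq] at h
  split_ifs at h with h₁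
  simp only [Option.some.injEq] at h
  rw [← h, List.length_drop]; omega

theorem decBool_eq_true {x : Data} : decBool x = true ↔ x ≠ Data.leaf := by
  cases x <;> simp [decBool]

/-- The first part is soundness of a finished loop. The second also holds for unfinished loops: a
run that takes `t` steps enlarges the state by at most `t` and uses up `t` units. It bounds all
intermediate states in `Code.pt_run_aux`. -/
theorem loopStep_invariant {f : Code} (hf : ∀ B x B' y, f.run B x = some (B', y) →
      ∃ t, t + B'.length = B.length ∧ Runs f x y t) (L : List Unit) (B : List Unit) (x : Data)
    (b : Bool) (B' : List Unit) (y : Data)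
    (h : L.foldl (fun s _ => loopStep f.run s) (some (false, B, x)) = some (b, B', y)) :
    (b = true → ∃ t, t + B'.length = B.length ∧ Runs (Code.loop f) x y t) ∧
      y.size + B'.length ≤ x.size + B.length := by
  have hnone : ∀ L : List Unit, L.foldl (fun s _ => loopStep f.run s) none = none := by
    intro L
    induction L with
    | nil => rfl
    | cons a L ih => exact ih
  have htrue : ∀ (L : List Unit) q, L.foldl (fun s _ => loopStep f.run s) (some (true, q)) =
      some (true, q) := by
    intro L
    induction L with
    | nil => intro q; rfl
    | cons a L ih => intro q; exact ih q
  induction L generalizing B x with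
  | nil =>
    simp only [List.foldl_nil, Option.some.injEq, Prod.mk.injEq] at h
    obtain ⟨rfl, rfl, rfl⟩ := h
    simp
  | cons a L ih =>
    rw [List.foldl_cons] at h
    cases hB : tick B with
    | none =>
      have h₁ : loopStep f.run (some (false, B, x)) = none := by simp [loopStep, hB]
      rw [h₁, hnone] at h
      simp at h
    | some B₁ =>
      obtain rfl := tick_eq_some.1 hB
      by_cases hx : x.fst = Data.leaf
      · have h₁ : loopStep f.run (some (false, () :: B₁, x)) = some (true, B₁, x.snd) := by
          simp [loopStep, hB, hx, decBool]
        rw [h₁, htrue] at h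
        simp only [Option.some.injEq, Prod.mk.injEq] at h
        obtain ⟨rfl, rfl, rfl⟩ := h
        have := x.snd_size_le
        exact ⟨fun _ => ⟨1, by simp; omega, Runs.loop_stop hx⟩, by simp; omega⟩
      · have h₁ : loopStep f.run (some (false, () :: B₁, x)) =
            (f.run B₁ x).map fun q => (false, q.1, q.2) := by
          simp [loopStep, hB, decBool_eq_true.2 hx]
        rw [h₁] at h
        cases hr : f.run B₁ x with
        | none => rw [hr, Option.map_none, hnone] at h; simp at h
        | some q =>
          rw [hr, Option.map_some] at h
          obtain ⟨t, ht, htr⟩ := hf _ _ _ _ hr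
          obtain ⟨h₂, h₃⟩ := ih _ _ h
          have := htr.size_le
          refine ⟨fun hb => ?_, by simp; omega⟩
          obtain ⟨t', ht', htr'⟩ := h₂ hb
          exact ⟨_, by simp; omega, Runs.loop_step hx htr htr'⟩

/-- The fuel used is exactly the number of steps in `Runs`, which is why `consume` charges the
copying in `pair`. -/
theorem Code.run_sound (M : Code) : ∀ B x B' y, M.run B x = some (B', y) →
    ∃ t, t + B'.length = B.length ∧ Runs M x y t := by
  induction M with
  | id =>
    intro B x B' y h
    simp only [Code.run, Option.map_eq_some_iff, tick_eq_some, Prod.mk.injEq] at h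
    obtain ⟨B₁, rfl, rfl, rfl⟩ := h
    exact ⟨1, by simp; omega, Runs.id _⟩
  | leaf =>
    intro B x B' y h
    simp only [Code.run, Option.map_eq_some_iff, tick_eq_some, Prod.mk.injEq] at h
    obtain ⟨B₁, rfl, rfl, rfl⟩ := h
    exact ⟨1, by simp; omega, Runs.leaf _⟩
  | fst =>
    intro B x B' y h
    simp only [Code.run, Option.map_eq_some_iff, tick_eq_some, Prod.mk.injEq] at h
    obtain ⟨B₁, rfl, rfl, rfl⟩ := h
    exact ⟨1, by simp; omega, Runs.fst _⟩
  | snd =>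
    intro B x B' y h
    simp only [Code.run, Option.map_eq_some_iff, tick_eq_some, Prod.mk.injEq] at h
    obtain ⟨B₁, rfl, rfl, rfl⟩ := h
    exact ⟨1, by simp; omega, Runs.snd _⟩
  | pair f g hf hg =>
    intro B x B' y h
    simp only [Code.run, Option.map_eq_some_iff, Option.bind_eq_some_iff, tick_eq_some,
      Prod.mk.injEq] at h
    obtain ⟨B₁, rfl, B₂, h₂, ⟨B₃, a⟩, h₃, ⟨B₄, b⟩, h₄, rfl, rfl⟩ := h
    obtain ⟨s, hs, hsr⟩ := hf _ _ _ _ h₃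
    obtain ⟨t, ht, htr⟩ := hg _ _ _ _ h₄
    have := consume_eq_some h₂
    exact ⟨_, by simp only [List.length_cons] at *; omega, Runs.pair hsr htr⟩
  | comp g f hg hf =>
    intro B x B' y h
    simp only [Code.run, Option.bind_eq_some_iff, tick_eq_some] at h
    obtain ⟨B₁, rfl, ⟨B₃, a⟩, h₃, h₄⟩ := h
    obtain ⟨s, hs, hsr⟩ := hf _ _ _ _ h₃
    obtain ⟨t, ht, htr⟩ := hg _ _ _ _ h₄
    exact ⟨_, by simp only [List.length_cons] at *; omega, Runs.comp hsr htr⟩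
  | cond f g hf hg =>
    intro B x B' y h
    simp only [Code.run, Option.bind_eq_some_iff, tick_eq_some] at h
    obtain ⟨B₁, rfl, h⟩ := h
    split_ifs at h with hx
    · obtain ⟨t, ht, htr⟩ := hg _ _ _ _ h
      exact ⟨_, by simp only [List.length_cons]; omega, Runs.cond_node (decBool_eq_true.1 hx) htr⟩
    · obtain ⟨t, ht, htr⟩ := hf _ _ _ _ h
      refine ⟨_, by simp only [List.length_cons]; omega, Runs.cond_leaf ?_ htr⟩
      by_contra hx'
      exact hx (decBool_eq_true.2 hx')
  | loop f hf =>
    intro B x B' y h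
    simp only [Code.run, Option.bind_eq_some_iff] at h
    obtain ⟨⟨b, B₁, y₁⟩, h, h'⟩ := h
    have h₂ := (loopStep_invariant hf B B x b B₁ y₁ h).1
    split_ifs at h' with hb
    simp only [Option.some.injEq, Prod.mk.injEq] at h'
    obtain ⟨rfl, rfl⟩ := h'
    exact h₂ hb

theorem tick_eq {B : List Unit} (h : 1 ≤ B.length) : tick B = some (B.drop 1) := by
  cases B with
  | nil => simp at h
  | cons a B => rfl

/-- Rounds are counted by `L` and steps by `B`; these decrease at different rates along the
derivation, so both are generalised. -/
theorem loop_complete {f : Code} (hf : ∀ x y t, Runs f x y t → ∀ B : List Unit, t ≤ B.length →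
      f.run B x = some (B.drop t, y)) {M : Code} {x y : Data} {t : ℕ} (h : Runs M x y t)
    (hM : M = Code.loop f) (B L : List Unit) (hB : t ≤ B.length) (hL : t ≤ L.length) :
    L.foldl (fun s _ => loopStep f.run s) (some (false, B, x)) = some (true, B.drop t, y) := by
  have htrue : ∀ (L : List Unit) q, L.foldl (fun s _ => loopStep f.run s) (some (true, q)) =
      some (true, q) := by
    intro L
    induction L with
    | nil => intro q; rfl
    | cons a L ih => intro q; exact ih q
  induction h generalizing B L with
  | loop_stop hx =>
    rename_i f' x
    obtain rfl := Code.loop.inj hM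
    cases L with
    | nil => simp at hL
    | cons a L =>
      rw [List.foldl_cons]
      have e : loopStep f'.run (some (false, B, x)) = some (true, B.drop 1, x.snd) := by
        simp [loopStep, tick_eq hB, hx, decBool]
      rw [e, htrue]
  | @loop_step f' x y z s t hx h₁ h₂ _ ih =>
    obtain rfl := Code.loop.inj hM
    cases L with
    | nil => simp at hL
    | cons a L =>
      rw [List.foldl_cons]
      have e : loopStep f'.run (some (false, B, x)) =
          some (false, (B.drop 1).drop s, y) := by
        simp only [loopStep, Option.bind_some, tick_eq (show 1 ≤ B.length by omega),
          decBool_eq_true.2 hx, Bool.false_eq_true, if_false, if_true]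
        rw [hf _ _ _ h₁ _ (by rw [List.length_drop]; omega), Option.map_some]
      rw [e, ih rfl _ L (by simp only [List.length_drop]; omega) (by simp at hL; omega)]
      simp only [List.drop_drop]
      congr 4
      omega
  | _ => exact Code.noConfusion hM

theorem Code.run_complete (M : Code) : ∀ x y t, Runs M x y t → ∀ B : List Unit, t ≤ B.length →
    M.run B x = some (B.drop t, y) := by
  induction M with
  | id => intro x y t h B hB; cases h; rw [Code.run, tick_eq hB]; rfl
  | leaf => intro x y t h B hB; cases h; rw [Code.run, tick_eq hB]; rfl
  | fst => intro x y t h B hB; cases h; rw [Code.run, tick_eq hB]; rfl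
  | snd => intro x y t h B hB; cases h; rw [Code.run, tick_eq hB]; rfl
  | pair f g hf hg =>
    intro x y t h B hB
    cases h with
    | @pair _ _ _ a b s t h₁ h₂ =>
      rw [Code.run, tick_eq (by omega), Option.bind_some, consume_eq,
        if_pos (by rw [List.length_drop]; omega), Option.bind_some,
        hf _ _ _ h₁ _ (by simp only [List.length_drop]; omega), Option.bind_some,
        hg _ _ _ h₂ _ (by simp only [List.length_drop]; omega), Option.map_some]
      simp only [List.drop_drop]
      congr 3
      omega
  | comp g f hg hf =>
    intro x y t h B hB
    cases h with
    | comp h₁ h₂ =>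
      rw [Code.run, tick_eq (by omega), Option.bind_some,
        hf _ _ _ h₁ _ (by simp only [List.length_drop]; omega), Option.bind_some,
        hg _ _ _ h₂ _ (by simp only [List.length_drop]; omega)]
      simp only [List.drop_drop]
      congr 3
      omega
  | cond f g hf hg =>
    intro x y t h B hB
    cases h with
    | cond_leaf hx h₁ =>
      rw [Code.run, tick_eq (by omega), Option.bind_some, hx, decBool, if_neg (by simp),
        hf _ _ _ h₁ _ (by simp only [List.length_drop]; omega)]
      simp only [List.drop_drop]
      congr 3
      omega
    | cond_node hx h₁ =>
      rw [Code.run, tick_eq (by omega), Option.bind_some, if_pos (decBool_eq_true.2 hx),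
        hg _ _ _ h₁ _ (by simp only [List.length_drop]; omega)]
      simp only [List.drop_drop]
      congr 3
      omega
  | loop f hf =>
    intro x y t h B hB
    rw [Code.run, loop_complete hf h rfl B B hB hB]
    rfl

@[fun_prop]
theorem pt_tick {B : α → List Unit} (hB : PT B) : PT (fun x => tick (B x)) := by
  unfold tick; fun_prop

@[fun_prop]
theorem pt_consume {B : α → List Unit} {d : α → Data} (hB : PT B) (hd : PT d) :
    PT (fun x => consume (B x) (d x)) := by
  have h : PT (fun x => (B x).foldl (fun s _ => consumeStep s) ([d x], B x)) := by
    refine PT.foldl (g := fun (_ : α) (s : List Data × List Unit) _ => consumeStep s)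
      (by unfold consumeStep; fun_prop) hB (by fun_prop) 0 fun x s b => ?_
    obtain ⟨_ | ⟨_ | ⟨a, b⟩, l⟩, R⟩ := s <;> obtain _ | ⟨r, R⟩ := R <;>
      simp [consumeStep, Data.toList, Data.size, Data.snd] <;> omega
  unfold consume
  fun_prop

/-- Induction on the program: each fixed program gets its own polynomial, so no universal machine is
needed. The only delicate case is `loop`, where `loopStep_invariant` bounds the state by input size
plus fuel. -/
theorem Code.pt_run_aux (M : Code) : PT (fun p : List Unit × Data => M.run p.1 p.2) := by
  induction M with
  | id => unfold Code.run; fun_prop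
  | leaf => unfold Code.run; fun_prop
  | fst => unfold Code.run; fun_prop
  | snd => unfold Code.run; fun_prop
  | pair f g hf hg =>
    have hf' : ∀ {α : Type} [Enc α] {B : α → List Unit} {d : α → Data}, PT B → PT d →
      PT (fun x => f.run (B x) (d x)) := fun hB hd => hf.comp (hB.prodMk hd)
    have hg' : ∀ {α : Type} [Enc α] {B : α → List Unit} {d : α → Data}, PT B → PT d →
      PT (fun x => g.run (B x) (d x)) := fun hB hd => hg.comp (hB.prodMk hd)
    unfold Code.run
    exact PT.bind (by fun_prop) (PT.bind (by fun_prop) (PT.bind (hf' (by fun_prop) (by fun_prop))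
      (PT.option_map (hg' (by fun_prop) (by fun_prop)) (by fun_prop))))
  | comp g f hg hf =>
    have hf' : ∀ {α : Type} [Enc α] {B : α → List Unit} {d : α → Data}, PT B → PT d →
      PT (fun x => f.run (B x) (d x)) := fun hB hd => hf.comp (hB.prodMk hd)
    have hg' : ∀ {α : Type} [Enc α] {B : α → List Unit} {d : α → Data}, PT B → PT d →
      PT (fun x => g.run (B x) (d x)) := fun hB hd => hg.comp (hB.prodMk hd)
    unfold Code.run
    exact PT.bind (by fun_prop) (PT.bind (hf' (by fun_prop) (by fun_prop))
      (hg' (by fun_prop) (by fun_prop)))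
  | cond f g hf hg =>
    have hf' : ∀ {α : Type} [Enc α] {B : α → List Unit} {d : α → Data}, PT B → PT d →
      PT (fun x => f.run (B x) (d x)) := fun hB hd => hf.comp (hB.prodMk hd)
    have hg' : ∀ {α : Type} [Enc α] {B : α → List Unit} {d : α → Data}, PT B → PT d →
      PT (fun x => g.run (B x) (d x)) := fun hB hd => hg.comp (hB.prodMk hd)
    unfold Code.run
    exact PT.bind (by fun_prop) (PT.ite_bool (by fun_prop) (hg' (by fun_prop) (by fun_prop))
      (hf' (by fun_prop) (by fun_prop)))
  | loop f hf =>
    have hf' : ∀ {α : Type} [Enc α] {B : α → List Unit} {d : α → Data}, PT B → PT d →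
      PT (fun x => f.run (B x) (d x)) := fun hB hd => hf.comp (hB.prodMk hd)
    unfold Code.run
    refine PT.bind ?_ (by fun_prop)
    refine PT.foldl_of_bound (g := fun (_ : List Unit × Data) s _ => loopStep f.run s)
      ?_ (by fun_prop) (by fun_prop) (4 * X + 6) fun p m hm => ?_
    · unfold loopStep
      exact PT.bind (by fun_prop) (PT.ite_bool (by fun_prop) (by fun_prop)
        (PT.bind (by fun_prop) (PT.ite_bool (by fun_prop)
          (PT.option_map (hf' (by fun_prop) (by fun_prop)) (by fun_prop)) (by fun_prop))))
    · cases h : m.foldl (fun s _ => loopStep f.run s) (some (false, p.1, p.2)) with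
      | none => simp
      | some q =>
        have h₁ := (loopStep_invariant f.run_sound m p.1 p.2 q.1 q.2.1 q.2.2 h).2
        have h₂ := sz_list_le (l := q.2.1) (b := 1) fun _ _ => le_rfl
        have h₃ := length_lt_sz p.1
        obtain ⟨b, B, x⟩ := q
        obtain ⟨B', x'⟩ := p
        simp only [sz_some, sz_mk, sz_bool, sz_data, eval_add, eval_mul, eval_X, eval_ofNat] at *
        omega

theorem Code.pt_run (M : Code) {B : α → List Unit} {d : α → Data} (hB : PT B) (hd : PT d) :
    PT (fun x => M.run (B x) (d x)) :=
  M.pt_run_aux.comp (hB.prodMk hd)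

/-- The output of a program run with the given amount of fuel. -/
def Code.out (M : Code) (B : List Unit) (x : Data) : Option Data := (M.run B x).map fun p => p.2

@[fun_prop]
theorem Code.pt_out (M : Code) {B : α → List Unit} {d : α → Data} (hB : PT B) (hd : PT d) :
    PT (fun x => M.out (B x) (d x)) :=
  PT.option_map (M.pt_run hB hd) (by fun_prop)

theorem Code.out_eq {M : Code} {x y : Data} {t : ℕ} (h : Runs M x y t) {B : List Unit}
    (hB : t ≤ B.length) : M.out B x = some y := by
  rw [Code.out, M.run_complete _ _ _ h B hB]; rfl

/-- Determinism: two runs with different results would contradict completeness for a fuel that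
suffices for both. -/
theorem Code.eq_of_out {M : Code} {x y z : Data} {t : ℕ} (h : Runs M x y t) {B : List Unit}
    (hB : M.out B x = some z) : z = y := by
  simp only [Code.out, Option.map_eq_some_iff] at hB
  obtain ⟨⟨B', z'⟩, h₁, rfl⟩ := hB
  obtain ⟨t', -, h₂⟩ := M.run_sound _ _ _ _ h₁
  have h₃ := M.run_complete _ _ _ h (List.replicate (t + t') ()) (by simp)
  have h₄ := M.run_complete _ _ _ h₂ (List.replicate (t + t') ()) (by simp)
  rw [h₃] at h₄
  simp only [Option.some.injEq, Prod.mk.injEq] at h₄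
  exact h₄.2.symm

/-! ### Searching for sufficient fuel -/

theorem sz_replicate_unit (n : ℕ) : sz (List.replicate n ()) = 2 * n + 1 := by
  induction n with
  | zero => rfl
  | succ n ih => rw [List.replicate_succ, sz_cons, ih, sz_unit]; omega

/-- A search with increasing amounts of fuel takes time polynomial in the input size and the first
sufficient amount of fuel. -/
theorem exists_search {S : List Unit → Data → Option Data}
    (hS : PT (fun p : List Unit × Data => S p.1 p.2)) :
    ∃ (M : Code) (p : ℕ[X]), ∀ x y b, (∀ B z, S B x = some z → z = y) →
      (S (List.replicate b ()) x).isSome → ∃ t, Runs M x y t ∧ t ≤ p.eval (b + x.size) := by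
  -- The state begins with `true`, a node, as long as the search goes on. Failure adds one unit of
  -- fuel; success puts a leaf in front of the result, which ends the loop.
  have hstep : PT (fun q : Bool × List Unit × Data => (S q.2.1 q.2.2).elim
      (enc (true, () :: q.2.1, q.2.2)) fun z => Data.node Data.leaf z) :=
    PT.elim (hS.comp (f := fun q : Bool × List Unit × Data => (q.2.1, q.2.2)) (by fun_prop))
      (by fun_prop) (by fun_prop)
  have hinit : PT (fun x : Data => (true, ([] : List Unit), x)) := by fun_prop
  obtain ⟨M, p, hM⟩ := hstep
  obtain ⟨M₀, p₀, hM₀⟩ := hinit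
  refine ⟨Code.comp (Code.loop M) M₀, p₀ + (X + 1) * (p.comp (2 * X + 5) + 1) + 2,
    fun x y b hy hb => ?_⟩
  obtain ⟨t₀, ht₀, htp₀⟩ := hM₀ x
  classical
  -- Success is not monotone in the fuel, so the loop is followed up to the least successful amount
  -- `m ≤ b`. The result found there is `y`, since every success yields `y`.
  have hex : ∃ b, (S (List.replicate b ()) x).isSome := ⟨b, hb⟩
  have hfind := Nat.find_spec hex
  have hle : Nat.find hex ≤ b := Nat.find_min' hex hb
  have hmin : ∀ i < Nat.find hex, S (List.replicate i ()) x = none := fun i hi => by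
    simpa using Nat.find_min hex hi
  generalize Nat.find hex = m at hfind hle hmin
  obtain ⟨z, hz⟩ := Option.isSome_iff_exists.1 hfind
  have hzy := hy _ _ hz
  subst hzy
  have hrun : ∀ i, ∃ t, Runs M (enc (true, List.replicate i (), x))
      ((S (List.replicate i ()) x).elim (enc (true, List.replicate (i + 1) (), x))
        fun z => Data.node Data.leaf z) t ∧ t ≤ p.eval (2 * (i + x.size) + 5) := fun i => by
    obtain ⟨t, ht, htp⟩ := hM (true, List.replicate i (), x)
    refine ⟨t, ht, htp.trans (eval_mono p ?_)⟩
    simp only [sz_mk, sz_bool, sz_replicate_unit, sz_data]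
    omega
  obtain ⟨t, ht, htp⟩ := Runs.loop_of_steps (M := M)
    (fun i => if i ≤ m then enc (true, List.replicate i (), x) else Data.node Data.leaf z)
    (p.eval (2 * (b + x.size) + 5)) (m + 1) (fun i hi => by
      rw [if_pos (by omega)]
      refine ⟨by simp [Data.fst, enc, encBool], ?_⟩
      obtain ⟨t, ht, htp⟩ := hrun i
      refine ⟨t, ?_, htp.trans (eval_mono p (by omega))⟩
      rcases Nat.lt_or_ge i m with h | h
      · rw [if_pos (by omega)]
        rw [hmin i h] at ht
        exact ht
      · obtain rfl : i = m := by omega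
        rw [if_neg (by omega)]
        rw [hz] at ht
        exact ht) (by rw [if_neg (by omega)]; rfl)
  rw [if_pos (by omega), if_neg (by omega)] at ht
  refine ⟨_, Runs.comp ht₀ ht, ?_⟩
  have h₁ := htp₀.trans (eval_mono p₀ (show sz x ≤ b + x.size by simp))
  have h₂ : (m + 1) * (p.eval (2 * (b + x.size) + 5) + 1) ≤
      (b + x.size + 1) * (p.eval (2 * (b + x.size) + 5) + 1) :=
    Nat.mul_le_mul_right _ (by omega)
  simp only [eval_add, eval_mul, eval_comp, eval_X, eval_one, eval_ofNat]
  omega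

/-! ### The algorithm -/

/-- The positions of the non-zero entries of a matrix. -/
def ones (M : List (List Bool)) : List (ℕ × ℕ) :=
  M.zipIdx.flatMap fun r => (r.1.zipIdx.filter fun b => b.1).map fun b => (r.2, b.2)

/-- The edges of the graph with adjacency matrix `M`. -/
def matrixEdges (M : List (List Bool)) : List (ℕ × ℕ) := (ones M).filter fun e => e.1 < e.2

/-- All that is known about a weight: its index, the adjacency matrices of its gadgets, an integer
multiple of the Lagrange polynomial of the weight, and the reciprocal of the multiplier. -/
abbrev Letter : Type := ℕ × List (List Bool) × List (List Bool) × List ℤ × ℚ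

/-- The vertices with their weights. -/
def vertexLetters (M : List (List Bool)) (ws : List Letter) : List (ℕ × Letter) :=
  (List.range M.length).zip ws

/-- The edges with their weights. -/
def edgeLetters (M : List (List Bool)) (ws : List Letter) : List ((ℕ × ℕ) × Letter) :=
  (matrixEdges M).zip (ws.drop M.length)

/-- The weight index of the edge `(u, v)`. -/
def edgeIndex (l : List ((ℕ × ℕ) × Letter)) (u v : ℕ) : ℕ :=
  (l.filter fun p => p.1.1 = u ∧ p.1.2 = v).head?.elim 0 fun p => p.2.1

/-- The description of a weighted graph. -/
def weightedMatrix (M : List (List Bool)) (ws : List Letter) :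
    List (List Bool) × List ℕ × List (List ℕ) :=
  (M, (vertexLetters M ws).map fun p => p.2.1,
    (List.range M.length).map fun u => (List.range M.length).map fun v =>
      edgeIndex (edgeLetters M ws) u v)

/-- Names for the vertices of `T(G)`: vertices of `G` have names `(0, v, 0, 0)`, inner vertices of
vertex-gadgets have names `(1, v, j, 0)`, and those of edge-gadgets have names `(2, u, v, j)`. -/
abbrev VName : Type := ℕ × ℕ × ℕ × ℕ

def vnameEq (a b : VName) : Bool :=
  decide (a.1 = b.1) && (decide (a.2.1 = b.2.1) &&
    (decide (a.2.2.1 = b.2.2.1) && decide (a.2.2.2 = b.2.2.2)))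

/-- The name of the vertex `x` of the gadget at the vertex `v`. -/
def vertexPlace (v x : ℕ) : VName := if x = 0 then (0, v, 0, 0) else (1, v, x - 1, 0)

/-- The name of the vertex `x` of the gadget at the edge `e`. -/
def edgePlace (e : ℕ × ℕ) (x : ℕ) : VName :=
  if x = 0 then (0, e.1, 0, 0) else if x = 1 then (0, e.2, 0, 0) else (2, e.1, e.2, x - 2)

/-- The names of the vertices of `T(G)`. -/
def gadgetVertices (M : List (List Bool)) (ws : List Letter) : List VName :=
  (List.range M.length).map (fun v => (0, v, 0, 0)) ++
  ((vertexLetters M ws).flatMap fun p =>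
    (List.range p.2.2.1.tail.length).map fun j => (1, p.1, j, 0)) ++
  ((edgeLetters M ws).flatMap fun p =>
    (List.range p.2.2.2.1.tail.tail.length).map fun j => (2, p.1.1, p.1.2, j))

/-- The edges of `T(G)`, in at least one direction. -/
def gadgetEdges (M : List (List Bool)) (ws : List Letter) : List (VName × VName) :=
  ((vertexLetters M ws).flatMap fun p =>
    (ones p.2.2.1).map fun e => (vertexPlace p.1 e.1, vertexPlace p.1 e.2)) ++
  ((edgeLetters M ws).flatMap fun p =>
    (ones p.2.2.2.1).map fun e => (edgePlace p.1 e.1, edgePlace p.1 e.2))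

/-- The adjacency matrix of `T(G)`. -/
def gadgetMatrix (M : List (List Bool)) (ws : List Letter) : List (List Bool) :=
  (gadgetVertices M ws).map fun a => (gadgetVertices M ws).map fun b =>
    (!vnameEq a b) && (gadgetEdges M ws).any fun e =>
      (vnameEq e.1 a && vnameEq e.2 b) || (vnameEq e.1 b && vnameEq e.2 a)

/-- All words of length `k`. -/
def allWords {α : Type} (l : List α) : ℕ → List (List α)
  | 0 => [[]]
  | k + 1 => (allWords l k).flatMap fun w => l.map fun c => c :: w

/-- All words of the length of `m`, if there are at most as many words as units of fuel. -/
def words {α β : Type} (B : List Unit) (l : List α) (m : List β) : Option (List (List α)) :=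
  m.foldl (fun acc _ => acc.bind fun W =>
    if (W.flatMap fun w => l.map fun c => c :: w).length ≤ B.length then
      some (W.flatMap fun w => l.map fun c => c :: w) else none) (some [[]])

/-- The letter for the weight `w`, given the list of all weights. -/
def letter (MA MB : Code) (B : List Unit) (l : List (ℕ × ℚ)) (w : ℕ × ℚ) : Option Letter :=
  (MA.out B (enc w.1)).bind fun a => (MB.out B (enc w.1)).map fun b =>
    (w.1, decMatrix a, decMatrix b,
      pprod ((l.filter fun q => ¬ q.1 = w.1).map fun q => [-q.2.num, (q.2.den : ℤ)]),
      (((l.filter fun q => ¬ q.1 = w.1).map fun q =>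
        (((q.2.den : ℤ) : ℚ) * (w.2 + -q.2))).prod)⁻¹)

/-- The letters for the weights with indices `0, …, d`. -/
def letters (MW MA MB : Code) (B : List Unit) (d : ℕ) : Option (List Letter) :=
  (allSome (((List.range B.length).filter fun i => i ≤ d).map fun i =>
    (MW.out B (enc i)).map fun x => (i, decRat x))).bind fun l =>
      allSome (l.map fun w => letter MA MB B l w)

/-- The contribution of the assignment of weights given by the word `w`, each letter of which is
used for as many elements as the list `ds` has. -/
def term {α : Type} (MF ME : Code) (B : List Unit) (M : List (List Bool)) (z : List ℚ) (ds : List α)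
    (w : List Letter) : Option (List ℚ) :=
  (MF.out B (enc (weightedMatrix M (w.flatMap fun c => ds.map fun _ => c)))).bind fun f =>
    (ME.out B (enc (gadgetMatrix M (w.flatMap fun c => ds.map fun _ => c)))).map fun e =>
      -- Appending the zeros `z` makes every list long enough, so that adding the lists with
      -- `zipWith` cuts all of them to the length of `z`.
      (pprod (w.map fun c => c.2.2.2.1)).map (fun c : ℤ =>
        decRat e * (decRat f)⁻¹ * (w.map fun c => c.2.2.2.2).prod * (c : ℚ)) ++ z

/-- The sum of lists of numbers. -/
def addLists (z : List ℚ) (l : List (List ℚ)) : List ℚ :=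
  l.foldl (fun a b => List.zipWith (fun x y => x + y) a b) z

/-- Zeros, one more than there are vertices and edges. -/
def zeros (M : List (List Bool)) : List ℚ :=
  0 :: (M.map (fun _ => (0 : ℚ)) ++ (matrixEdges M).map fun _ => (0 : ℚ))

/-- Interpolation with blocks of `d` elements. -/
def interpolate (MW MA MB MF ME : Code) (B : List Unit) (M : List (List Bool)) (d : ℕ) :
    Option (List ℚ) :=
  (letters MW MA MB B d).bind fun l =>
    -- With `N` elements the filter keeps the `i` with `i * d ≤ N`; the number of blocks is thus `N
    -- / d + 1`, given in unary.
    (words B l ((List.range (zeros M).length).filter fun i => i * d + 1 ≤ (zeros M).length)).bind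
      -- There are `d + 1` letters, so `l.tail` serves as the block length `d` in unary.
      fun W => (allSome (W.map fun w => term MF ME B M (zeros M) l.tail w)).map fun t =>
        addLists (zeros M) t

/-- The first value in a list of options. -/
def firstSome {α : Type} (l : List (Option α)) : Option α :=
  l.foldl (fun acc o => if acc.isSome then acc else o) none

/-- Interpolation with all block sizes below the amount of fuel. -/
def search (MW MA MB MF ME : Code) (B : List Unit) (x : Data) : Option Data :=
  (firstSome (((List.range B.length).filter fun d => 1 ≤ d).map fun d =>
    interpolate MW MA MB MF ME B (decMatrix x) d)).map fun l => enc l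

/-! ### The algorithm runs in polynomial time -/

@[fun_prop]
theorem pt_ones {M : α → List (List Bool)} (hM : PT M) : PT (fun x => ones (M x)) := by
  unfold ones; fun_prop

@[fun_prop]
theorem pt_matrixEdges {M : α → List (List Bool)} (hM : PT M) :
    PT (fun x => matrixEdges (M x)) := by
  unfold matrixEdges; fun_prop

@[fun_prop]
theorem pt_vertexLetters {M : α → List (List Bool)} {ws : α → List Letter} (hM : PT M)
    (hws : PT ws) : PT (fun x => vertexLetters (M x) (ws x)) := by
  unfold vertexLetters; fun_prop

@[fun_prop]
theorem pt_edgeLetters {M : α → List (List Bool)} {ws : α → List Letter} (hM : PT M)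
    (hws : PT ws) : PT (fun x => edgeLetters (M x) (ws x)) := by
  unfold edgeLetters; fun_prop

@[fun_prop]
theorem pt_edgeIndex {l : α → List ((ℕ × ℕ) × Letter)} {u v : α → ℕ} (hl : PT l) (hu : PT u)
    (hv : PT v) : PT (fun x => edgeIndex (l x) (u x) (v x)) := by
  unfold edgeIndex; fun_prop

@[fun_prop]
theorem pt_weightedMatrix {M : α → List (List Bool)} {ws : α → List Letter} (hM : PT M)
    (hws : PT ws) : PT (fun x => weightedMatrix (M x) (ws x)) := by
  unfold weightedMatrix; fun_prop

@[fun_prop]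
theorem pt_vnameEq {a b : α → VName} (ha : PT a) (hb : PT b) :
    PT (fun x => vnameEq (a x) (b x)) := by
  unfold vnameEq; fun_prop

@[fun_prop]
theorem pt_vertexPlace {a b : α → ℕ} (ha : PT a) (hb : PT b) :
    PT (fun x => vertexPlace (a x) (b x)) := by
  unfold vertexPlace; fun_prop

@[fun_prop]
theorem pt_edgePlace {a : α → ℕ × ℕ} {b : α → ℕ} (ha : PT a) (hb : PT b) :
    PT (fun x => edgePlace (a x) (b x)) := by
  unfold edgePlace; fun_prop

@[fun_prop]
theorem pt_gadgetVertices {M : α → List (List Bool)} {ws : α → List Letter} (hM : PT M)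
    (hws : PT ws) : PT (fun x => gadgetVertices (M x) (ws x)) := by
  unfold gadgetVertices; fun_prop

@[fun_prop]
theorem pt_gadgetEdges {M : α → List (List Bool)} {ws : α → List Letter} (hM : PT M)
    (hws : PT ws) : PT (fun x => gadgetEdges (M x) (ws x)) := by
  unfold gadgetEdges; fun_prop

@[fun_prop]
theorem pt_gadgetMatrix {M : α → List (List Bool)} {ws : α → List Letter} (hM : PT M)
    (hws : PT ws) : PT (fun x => gadgetMatrix (M x) (ws x)) := by
  unfold gadgetMatrix; fun_prop

/-! ### Enumeration of words within the fuel. -/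

theorem words_append {α β : Type} (B : List Unit) (l : List α) (m : List β) (b : β) :
    words B l (m ++ [b]) = (words B l m).bind fun W =>
      if (W.flatMap fun w => l.map fun c => c :: w).length ≤ B.length then
        some (W.flatMap fun w => l.map fun c => c :: w) else none := by
  simp [words]

/-- The cutoff keeps the otherwise exponential list of words within the fuel; the extra one accounts
for the initial list `[[]]`, which is not checked. -/
theorem words_eq_some {α β : Type} {B : List Unit} {l : List α} {m : List β} {W : List (List α)}
    (h : words B l m = some W) : W = allWords l m.length ∧ W.length ≤ B.length + 1 := by
  induction m using List.reverseRecOn generalizing W with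
  | nil =>
    simp only [words, List.foldl_nil, Option.some.injEq] at h
    subst h
    simp [allWords]
  | append_singleton m b ih =>
    rw [words_append, Option.bind_eq_some_iff] at h
    obtain ⟨W', h₁, h₂⟩ := h
    split_ifs at h₂ with h₃
    obtain rfl := Option.some.inj h₂
    refine ⟨?_, by omega⟩
    rw [(ih h₁).1, List.length_append, List.length_singleton]
    rfl

theorem mem_allWords {α : Type} {l : List α} {k : ℕ} {w : List α} (h : w ∈ allWords l k) :
    w.length = k ∧ ∀ c ∈ w, c ∈ l := by
  induction k generalizing w with
  | zero => simp [allWords] at h; simp [h]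
  | succ k ih =>
    simp only [allWords, List.mem_flatMap, List.mem_map] at h
    obtain ⟨w', hw', c, hc, rfl⟩ := h
    obtain ⟨h₁, h₂⟩ := ih hw'
    refine ⟨by simp [h₁], fun a ha => ?_⟩
    rcases List.mem_cons.1 ha with rfl | ha
    · exact hc
    · exact h₂ a ha

theorem length_allWords {α : Type} (l : List α) (k : ℕ) :
    (allWords l k).length = l.length ^ k := by
  induction k with
  | zero => rfl
  | succ k ih => simp [allWords, List.length_flatMap, ih, pow_succ]

theorem words_isSome {α β : Type} {B : List Unit} {l : List α} {m : List β}
    (hl : 0 < l.length) (h : l.length ^ m.length ≤ B.length) :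
    words B l m = some (allWords l m.length) := by
  induction m using List.reverseRecOn with
  | nil => rfl
  | append_singleton m b ih =>
    rw [List.length_append, List.length_singleton] at h ⊢
    rw [words_append, ih ((Nat.pow_le_pow_right hl (by omega)).trans h), Option.bind_some]
    rw [if_pos]
    · rfl
    · rw [← length_allWords] at h
      exact h

@[fun_prop]
theorem pt_words {B : α → List Unit} {l : α → List β} {m : α → List γ} (hB : PT B) (hl : PT l)
    (hm : PT m) : PT (fun x => words (B x) (l x) (m x)) := by
  refine PT.comp (g := fun p : List Unit × List β × List γ => words p.1 p.2.1 p.2.2)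
    (f := fun x => (B x, l x, m x)) ?_ (by fun_prop)
  refine PT.foldl_of_bound (g := fun (p : List Unit × List β × List γ) (acc : Option (List (List β))) _ =>
    acc.bind fun W => if (W.flatMap fun w => p.2.1.map fun c => c :: w).length ≤ p.1.length then
      some (W.flatMap fun w => p.2.1.map fun c => c :: w) else none)
    (by fun_prop) (by fun_prop) (by fun_prop) ((X + 1) * (X * (X + 1) + 2) + 3) fun p n hn => ?_
  change sz (words p.1 p.2.1 n) ≤ _
  obtain ⟨B, l, m⟩ := p
  dsimp only at hn ⊢
  have hn' := hn.length_le
  have h₁ := length_lt_sz B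
  have h₂ := length_lt_sz m
  simp only [sz_mk]
  generalize hs : sz B + (sz l + sz m + 1) + 1 = s
  cases h : words B l n with
  | none => simp
  | some W =>
    obtain ⟨h₃, h₄⟩ := words_eq_some h
    have h₅ := sz_list_le (l := W) (b := s * (s + 1) + 1) fun w hw => by
      obtain ⟨h₆, h₇⟩ := mem_allWords (h₃ ▸ hw)
      have h₈ := sz_list_le (l := w) (b := s) fun c hc => by
        have := sz_le_of_mem (h₇ c hc)
        omega
      have := Nat.mul_le_mul_right (s + 1) (show w.length ≤ s by omega)
      omega
    have h₆ := Nat.mul_le_mul_right (s * (s + 1) + 1 + 1) (show W.length ≤ s + 1 by omega)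
    rw [show s * (s + 1) + 1 + 1 = s * (s + 1) + 2 from rfl] at h₅ h₆
    simp only [sz_some, eval_add, eval_mul, eval_X, eval_one, eval_ofNat]
    omega

@[fun_prop]
theorem pt_letter {MA MB : Code} {B : α → List Unit} {l : α → List (ℕ × ℚ)} {w : α → ℕ × ℚ}
    (hB : PT B) (hl : PT l) (hw : PT w) : PT (fun x => letter MA MB (B x) (l x) (w x)) := by
  unfold letter
  fun_prop

@[fun_prop]
theorem pt_letters {MW MA MB : Code} {B : α → List Unit} {d : α → ℕ}
    (hB : PT B) (hd : PT d) : PT (fun x => letters MW MA MB (B x) (d x)) := by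
  unfold letters
  fun_prop

@[fun_prop]
theorem pt_term {MF ME : Code} {B : α → List Unit} {M : α → List (List Bool)} {z : α → List ℚ}
    {ds : α → List β} {w : α → List Letter} (hB : PT B) (hM : PT M) (hz : PT z) (hds : PT ds)
    (hw : PT w) : PT (fun x => term MF ME (B x) (M x) (z x) (ds x) (w x)) := by
  unfold term
  fun_prop

theorem sz_zipWith_add_le (l m : List ℚ) :
    sz (List.zipWith (fun x y => x + y) l m) ≤ sz l + sz m := by
  induction l generalizing m with
  | nil => simp
  | cons a l ih =>
    cases m with
    | nil => simp
    | cons b m =>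
      have h₁ := ih m
      have h₂ := sz_rat_add_le a b
      simp only [List.zipWith_cons_cons, sz_cons]
      omega

@[fun_prop]
theorem pt_addLists {z : α → List ℚ} {l : α → List (List ℚ)} (hz : PT z) (hl : PT l) :
    PT (fun x => addLists (z x) (l x)) :=
  PT.foldl (g := fun _ a b => List.zipWith (fun x y => x + y) a b) (by fun_prop) hl hz X
    fun x c b => by
      have := sz_zipWith_add_le c b
      simp only [eval_X]
      omega

@[fun_prop]
theorem pt_zeros {M : α → List (List Bool)} (hM : PT M) : PT (fun x => zeros (M x)) := by
  unfold zeros; fun_prop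

@[fun_prop]
theorem pt_interpolate {MW MA MB MF ME : Code} {B : α → List Unit} {M : α → List (List Bool)}
    {d : α → ℕ} (hB : PT B) (hM : PT M) (hd : PT d) :
    PT (fun x => interpolate MW MA MB MF ME (B x) (M x) (d x)) := by
  unfold interpolate
  fun_prop

@[fun_prop]
theorem pt_firstSome {l : α → List (Option β)} (hl : PT l) : PT (fun x => firstSome (l x)) :=
  PT.foldl (g := fun _ (acc o : Option β) => if acc.isSome then acc else o) (by fun_prop) hl (PT.const _) X
    fun x c b => by
      split_ifs
      · omega
      · simp only [eval_X]; omega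

theorem pt_search {MW MA MB MF ME : Code} :
    PT (fun p : List Unit × Data => search MW MA MB MF ME p.1 p.2) := by
  unfold search
  fun_prop

/-! ### Correctness of the interpolation -/

theorem sum_map_flatMap {α β M : Type} [AddMonoid M] (l : List α) (f : α → List β) (g : β → M) :
    ((l.flatMap f).map g).sum = (l.map fun a => ((f a).map g).sum).sum := by
  induction l with
  | nil => rfl
  | cons a l ih => simp [ih]

theorem spread_getD {α β : Type} (ds : List β) (c c₀ : α) (w : List α) (p : ℕ) :
    ((c :: w).flatMap fun c => ds.map fun _ => c).getD p c₀ =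
      if p < ds.length then c else
        (w.flatMap fun c => ds.map fun _ => c).getD (p - ds.length) c₀ := by
  rw [List.flatMap_cons]
  split_ifs with h
  · rw [List.getD_append _ _ _ _ (by simpa using h)]
    simp [List.getD_eq_getElem?_getD, h]
  · rw [List.getD_append_right _ _ _ _ (by simpa using h)]
    simp

/-- Interpolation in all block variables at once. Injectivity of `pos` leaves at most `ds.length`
elements of `S` in a block, so summing over its letter turns the block into a power of `X` by `hL`.
The induction splits off the first block and shifts the remaining positions. -/
theorem sum_words {α β ι : Type} (l : List α) (v : α → ℚ) (L : α → ℚ[X]) (ds : List β)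
    (hL : ∀ e ≤ ds.length, (l.map fun c => C (v c ^ e) * L c).sum = X ^ e) (c₀ : α) (k : ℕ)
    (S : Finset ι) (pos : ι → ℕ) (hinj : Set.InjOn pos S)
    (hpos : ∀ a ∈ S, pos a < k * ds.length) :
    ((allWords l k).map fun w => C (∏ a ∈ S,
      v ((w.flatMap fun c => ds.map fun _ => c).getD (pos a) c₀)) * (w.map L).prod).sum =
        X ^ S.card := by
  classical
  induction k generalizing S pos with
  | zero =>
    obtain rfl : S = ∅ := Finset.eq_empty_of_forall_notMem fun a ha => by simpa using hpos a ha
    simp [allWords]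
  | succ k ih =>
    have hS := Finset.card_filter_add_card_filter_not (s := S) (p := fun a => pos a < ds.length)
    -- `S₁` is the part of `S` in the first block, where all elements have the same weight.
    set S₁ := S.filter fun a => pos a < ds.length with hS₁
    set S₂ := S.filter fun a => ¬ pos a < ds.length with hS₂
    have hc : S₁.card ≤ ds.length := by
      rw [← Finset.card_range ds.length]
      refine Finset.card_le_card_of_injOn pos (fun a ha => ?_) fun a ha b hb h => hinj ?_ ?_ h
      · simpa using (Finset.mem_filter.1 ha).2
      · exact (Finset.mem_filter.1 ha).1
      · exact (Finset.mem_filter.1 hb).1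
    have ih' := ih S₂ (fun a => pos a - ds.length) (fun a ha b hb h => by
      have ha := Finset.mem_filter.1 ha
      have hb := Finset.mem_filter.1 hb
      dsimp only at h
      exact hinj ha.1 hb.1 (by omega)) (fun a ha => by
      have ha := Finset.mem_filter.1 ha
      have := hpos a ha.1
      rw [add_mul] at this
      omega)
    have hsplit : ∀ (c : α) (w : List α),
        C (∏ a ∈ S, v (((c :: w).flatMap fun c => ds.map fun _ => c).getD (pos a) c₀)) *
          ((c :: w).map L).prod = (C (v c ^ S₁.card) * L c) * (C (∏ a ∈ S₂,
          v ((w.flatMap fun c => ds.map fun _ => c).getD (pos a - ds.length) c₀)) *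
            (w.map L).prod) := by
      intro c w
      rw [← Finset.prod_filter_mul_prod_filter_not S (fun a => pos a < ds.length), ← hS₁, ← hS₂,
        Finset.prod_congr rfl (g := fun _ => v c) (fun a ha => by
          rw [spread_getD, if_pos (Finset.mem_filter.1 ha).2]),
        Finset.prod_congr rfl (s₁ := S₂) (fun a ha => by
          rw [spread_getD, if_neg (Finset.mem_filter.1 ha).2]), Finset.prod_const,
        List.map_cons, List.prod_cons, C_mul]
      ring
    simp only [allWords, sum_map_flatMap, List.map_map, Function.comp_def, hsplit]
    -- The double sum over the first letter and the rest of the word factors.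
    simp only [List.sum_map_mul_right, hL _ hc, List.sum_map_mul_left]
    rw [ih', ← pow_add, hS]

/-- Linearity in the sieve function reduces this to `sum_words` for each monomial, with `S = ω n G
A`. -/
theorem sum_words_inducedPoly {α β : Type} (χ : SieveFunction) (ω : WeightSelector) {n : ℕ}
    (G : SimpleGraph (Fin n)) (l : List α) (v : α → ℚ) (L : α → ℚ[X]) (ds : List β)
    (hL : ∀ e ≤ ds.length, (l.map fun c => C (v c ^ e) * L c).sum = X ^ e) (c₀ : α) (k : ℕ)
    (pos : Elt G → ℕ) (hinj : Function.Injective pos) (hpos : ∀ a, pos a < k * ds.length) :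
    ((allWords l k).map fun w => C (MvPolynomial.eval (fun a =>
      v ((w.flatMap fun c => ds.map fun _ => c).getD (pos a) c₀)) (multiPoly χ ω G)) *
        (w.map L).prod).sum = inducedPoly χ ω n G := by
  have key : ∀ W : List (List α), (W.map fun w => C (MvPolynomial.eval (fun a =>
      v ((w.flatMap fun c => ds.map fun _ => c).getD (pos a) c₀)) (multiPoly χ ω G)) *
        (w.map L).prod).sum = ∑ A : Finset (Elt G), C (χ n G A) * (W.map fun w => C (∏ a ∈ ω n G A,
      v ((w.flatMap fun c => ds.map fun _ => c).getD (pos a) c₀)) * (w.map L).prod).sum := by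
    intro W
    induction W with
    | nil => simp
    | cons w W ih =>
      simp only [List.map_cons, List.sum_cons, mul_add, Finset.sum_add_distrib, ih]
      congr 1
      simp only [multiPoly, map_sum, map_mul, MvPolynomial.eval_C, MvPolynomial.eval_prod,
        MvPolynomial.eval_X, Finset.sum_mul, mul_assoc]
  rw [key, inducedPoly]
  refine Finset.sum_congr rfl fun A _ => ?_
  rw [sum_words l v L ds hL c₀ k (ω n G A) pos hinj.injOn fun a _ => hpos a]

/-! ### The letters -/

/-- The letter for the weight with index `i` among the weights with indices `0, …, d`. -/
noncomputable def trueLetter (W : ℕ → ℚ) (HV : ℕ → VertexGadget) (HE : ℕ → EdgeGadget) (d i : ℕ) :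
    Letter :=
  (i, decMatrix (encGraph (HV i).graph), decMatrix (encGraph (HE i).graph),
    pprod (((List.range (d + 1)).filter fun j => ¬ j = i).map fun j =>
      [-(W j).num, ((W j).den : ℤ)]),
    ((((List.range (d + 1)).filter fun j => ¬ j = i).map fun j =>
      ((((W j).den : ℤ) : ℚ) * (W i + -W j))).prod)⁻¹)

/-- The Lagrange polynomial stored in a letter. -/
noncomputable def letterPoly (c : Letter) : ℚ[X] := C c.2.2.2.2 * toPoly c.2.2.2.1

/-- Each factor `den * X - num` is `den * (X - W j)`; dividing the product by its value at `W i`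
gives the Lagrange basis. Keeping the multiplier apart leaves integer coefficients, whose growth is
controlled by `pnorm`. -/
theorem letterPoly_trueLetter (W : ℕ → ℚ) (HV : ℕ → VertexGadget) (HE : ℕ → EdgeGadget)
    (d i : ℕ) :
    letterPoly (trueLetter W HV HE d i) = Lagrange.basis (Finset.range (d + 1)) W i := by
  have hs : (Finset.range (d + 1)).erase i =
      ((List.range (d + 1)).filter fun j => ¬ j = i).toFinset := by
    ext j; simp [and_comm]
  have hnd : ((List.range (d + 1)).filter fun j => ¬ j = i).Nodup := List.nodup_range.filter _
  rw [Lagrange.basis, hs, List.prod_toFinset _ hnd, letterPoly, trueLetter]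
  dsimp only
  rw [toPoly_pprod, List.map_map]
  have hmem : ∀ j ∈ (List.range (d + 1)).filter fun j => ¬ j = i, j ≠ i := fun j hj => by
    simpa using (List.mem_filter.1 hj).2
  revert hmem
  generalize (List.range (d + 1)).filter (fun j => ¬ j = i) = l
  intro hmem
  induction l with
  | nil => simp
  | cons j l ih =>
    have ih := ih fun j hj => hmem j (List.mem_cons_of_mem _ hj)
    simp only [List.map_cons, List.prod_cons, mul_inv, C_mul, ← ih]
    have h₁ : (((W j).den : ℤ) : ℚ) ≠ 0 := by simp
    have h₂ : Lagrange.basisDivisor (W i) (W j) =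
        C (((((W j).den : ℤ) : ℚ)⁻¹) * (W i + -W j)⁻¹) *
          toPoly [-(W j).num, ((W j).den : ℤ)] := by
      have h₃ : toPoly [-(W j).num, ((W j).den : ℤ)] =
          C (((W j).den : ℤ) : ℚ) * (X - C (W j)) := by
        simp only [toPoly, List.foldr_cons, List.foldr_nil, mul_zero, add_zero, mul_sub, ← C_mul]
        rw [Int.cast_natCast, Rat.den_mul_eq_num, Int.cast_neg, C_neg]
        ring
      rw [h₃, Lagrange.basisDivisor, ← mul_assoc, ← C_mul, sub_eq_add_neg (W i)]
      congr 2
      field_simp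
    rw [h₂, C_mul]
    simp only [Function.comp]
    ring

/-- Interpolation at `d + 1` distinct nodes reproduces polynomials of degree at most `d`, in
particular `X ^ e`. -/
theorem sum_trueLetter {W : ℕ → ℚ} (hW : Function.Injective W) (HV : ℕ → VertexGadget)
    (HE : ℕ → EdgeGadget) (d e : ℕ) (he : e ≤ d) :
    (((List.range (d + 1)).map (trueLetter W HV HE d)).map
      fun c => C (W c.1 ^ e) * letterPoly c).sum = X ^ e := by
  rw [List.map_map]
  have h : (X ^ e : ℚ[X]) = Lagrange.interpolate (Finset.range (d + 1)) W fun i => W i ^ e := by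
    refine Lagrange.eq_interpolate_of_eval_eq _ hW.injOn ?_ fun i _ => by simp
    rw [degree_X_pow, Finset.card_range]
    exact_mod_cast Nat.lt_succ_of_le he
  rw [h, Lagrange.interpolate_apply, ← List.toFinset_range,
    List.sum_toFinset _ List.nodup_range]
  congr 1
  refine List.map_congr_left fun i _ => ?_
  simp only [Function.comp, List.toFinset_range]
  rw [letterPoly_trueLetter]
  rfl

/-! ### Sums of lists -/

/-- Since `zipWith` truncates to the shorter list, terms of length at least `N` leave the length `N`
unchanged. -/
theorem addLists_eq {N : ℕ} (z : List ℚ) (l : List (List ℚ)) (hz : z.length = N)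
    (hl : ∀ t ∈ l, N ≤ t.length) :
    addLists z l = (List.range N).map fun k => z.getD k 0 + (l.map fun t => t.getD k 0).sum := by
  induction l generalizing z with
  | nil =>
    refine List.ext_getElem (by simp [addLists, hz]) fun k h₁ h₂ => ?_
    simp only [addLists, List.foldl_nil] at h₁
    simp [addLists, h₁]
  | cons t l ih =>
    have ht := hl t (by simp)
    have hz' : (List.zipWith (fun x y => x + y) z t).length = N := by simp [hz, ht]
    refine (ih _ hz' fun t ht => hl t (by simp [ht])).trans ?_
    refine List.map_congr_left fun k hk => ?_
    have hk := List.mem_range.1 hk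
    rw [List.getD_eq_getElem _ _ (by omega), List.getElem_zipWith,
      List.getD_eq_getElem z _ (by omega), List.map_cons, List.sum_cons,
      List.getD_eq_getElem t _ (by omega)]
    ring

theorem getD_map_append_zeros (l : List ℤ) (r : ℚ) (z : List ℚ) (hz : ∀ a ∈ z, a = 0) (k : ℕ) :
    (l.map (fun c : ℤ => r * (c : ℚ)) ++ z).getD k 0 = r * (toPoly l).coeff k := by
  rw [coeff_toPoly]
  induction l generalizing k with
  | nil =>
    rcases Nat.lt_or_ge k z.length with h | h
    · simp [hz _ (List.getElem_mem h), h]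
    · simp [h]
  | cons a l ih => cases k <;> simp only [List.map_cons, List.cons_append, List.getD_cons_zero,
      List.getD_cons_succ, ih]

/-! ### Correctness of the graph transformations -/

open Classical in
/-- The adjacency matrix. -/
noncomputable def boolMatrix {n : ℕ} (G : SimpleGraph (Fin n)) : List (List Bool) :=
  (List.finRange n).map fun i => (List.finRange n).map fun j => decide (G.Adj i j)

theorem encList_eq_enc {α β : Type} [Enc β] (f : α → Data) (g : α → β) (h : ∀ a, f a = enc (g a))
    (l : List α) : encList f l = enc (l.map g) := by
  induction l with
  | nil => rfl
  | cons a l ih =>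
    rw [List.map_cons, enc_cons, ← ih, ← h]; rfl

open Classical in
theorem encGraph_eq {n : ℕ} (G : SimpleGraph (Fin n)) : encGraph G = enc (boolMatrix G) :=
  encList_eq_enc _ _ (fun i => encList_eq_enc _ (fun j => decide (G.Adj i j)) (fun _ => rfl) _) _

theorem decMatrix_encGraph {n : ℕ} (G : SimpleGraph (Fin n)) :
    decMatrix (encGraph G) = boolMatrix G := by
  rw [encGraph_eq, decMatrix_enc]

@[simp] theorem length_boolMatrix {n : ℕ} (G : SimpleGraph (Fin n)) :
    (boolMatrix G).length = n := by simp [boolMatrix]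

theorem zipIdx_map_finRange {α : Type} {n : ℕ} (f : Fin n → α) :
    ((List.finRange n).map f).zipIdx = (List.finRange n).map fun i => (f i, i.val) := by
  refine List.ext_getElem (by simp) fun k h₁ h₂ => ?_
  simp

open Classical in
theorem ones_boolMatrix {n : ℕ} (G : SimpleGraph (Fin n)) :
    ones (boolMatrix G) = (List.finRange n).flatMap fun u =>
      ((List.finRange n).filter fun v => G.Adj u v).map fun v => (u.val, v.val) := by
  rw [ones, boolMatrix, zipIdx_map_finRange, List.flatMap_map]
  refine List.flatMap_congr fun u _ => ?_
  dsimp only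
  rw [zipIdx_map_finRange, List.filter_map, List.map_map]
  rfl

theorem mem_ones_boolMatrix {n : ℕ} {G : SimpleGraph (Fin n)} {p : ℕ × ℕ} :
    p ∈ ones (boolMatrix G) ↔ ∃ x y : Fin n, G.Adj x y ∧ (x.val, y.val) = p := by
  classical
  rw [ones_boolMatrix]
  simp [List.mem_flatMap]

theorem matrixEdges_boolMatrix {n : ℕ} (G : SimpleGraph (Fin n)) :
    matrixEdges (boolMatrix G) = (edgeList G).map fun e => (e.1.1.val, e.1.2.val) := by
  classical
  rw [matrixEdges, ones_boolMatrix, edgeList, List.map_flatMap, List.filter_flatMap]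
  refine List.flatMap_congr fun u _ => ?_
  rw [List.map_filterMap, List.filter_map, List.filter_filter]
  induction List.finRange n with
  | nil => rfl
  | cons v l ih =>
    by_cases h : u < v ∧ G.Adj u v
    · rw [List.filterMap_cons_some (b := (u.val, v.val)) (by simp [h]), ← ih,
        List.filter_cons_of_pos (by simpa using h)]
      rfl
    · rw [List.filterMap_cons_none (by simp [h]), ← ih, List.filter_cons_of_neg (by simpa using h)]

theorem mem_edgeList {n : ℕ} {G : SimpleGraph (Fin n)} (e : Edge G) : e ∈ edgeList G := by
  classical
  obtain ⟨⟨u, v⟩, h⟩ := e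
  simp only [edgeList, List.mem_flatMap, List.mem_filterMap, List.mem_finRange, true_and]
  exact ⟨u, v, by rw [dif_pos h]⟩

theorem nodup_edgeList {n : ℕ} (G : SimpleGraph (Fin n)) : (edgeList G).Nodup := by
  classical
  have h : ((edgeList G).map fun e => (e.1.1.val, e.1.2.val)).Nodup := by
    rw [← matrixEdges_boolMatrix, matrixEdges, ones_boolMatrix]
    refine List.Nodup.filter _ (List.nodup_flatMap.2 ⟨fun u _ => ?_, ?_⟩)
    · exact ((List.nodup_finRange n).filter _).map fun a b h => by
        simpa [Fin.ext_iff] using h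
    · refine (List.nodup_finRange n).imp fun {u v} huv => ?_
      simp only [Function.onFun, List.disjoint_left, List.mem_map]
      rintro _ ⟨a, -, rfl⟩ ⟨b, -, h⟩
      simp only [Prod.mk.injEq] at h
      exact huv (Fin.ext h.1.symm)
  exact h.of_map _

theorem length_edgeList {n : ℕ} (G : SimpleGraph (Fin n)) :
    (edgeList G).length = Fintype.card (Edge G) := by
  classical
  rw [← List.toFinset_card_of_nodup (nodup_edgeList G), ← Finset.card_univ]
  congr 1
  ext e
  simp [mem_edgeList]

open Classical in
/-- The position of an element in the list of all vertices and edges. -/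
noncomputable def position {n : ℕ} {G : SimpleGraph (Fin n)} : Elt G → ℕ
  | Sum.inl v => v
  | Sum.inr e => n + (edgeList G).idxOf e

theorem position_injective {n : ℕ} (G : SimpleGraph (Fin n)) :
    Function.Injective (position (G := G)) := by
  classical
  rintro (u | e) (v | f) h <;> simp only [position] at h
  · rw [Fin.ext h]
  · have := u.isLt; omega
  · have := v.isLt; omega
  · have h' : (edgeList G).idxOf e = (edgeList G).idxOf f := by omega
    rw [(List.idxOf_inj (mem_edgeList e)).1 h']

theorem position_lt {n : ℕ} {G : SimpleGraph (Fin n)} (a : Elt G) :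
    position a < n + (edgeList G).length := by
  classical
  rcases a with v | e <;> simp only [position]
  · have := v.isLt; omega
  · have := List.idxOf_lt_length_iff.2 (mem_edgeList e); omega

/-- The default letter. -/
def noLetter : Letter := (0, [], [], [], 0)

/-- The weighted graph in which the elements have the weights given by the list `ws`. -/
noncomputable def assignWeights {n : ℕ} (G : SimpleGraph (Fin n)) (ws : List Letter) : WGraph where
  n := n
  graph := G
  idx a := (ws.getD (position a) noLetter).1

section
variable {n : ℕ} {G : SimpleGraph (Fin n)} {ws : List Letter}

theorem vertexLetters_eq (hlen : n + (edgeList G).length ≤ ws.length) :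
    vertexLetters (boolMatrix G) ws = (List.finRange n).map fun v =>
      (v.val, ws.getD (position (G := G) (Sum.inl v)) noLetter) := by
  rw [vertexLetters, length_boolMatrix]
  refine List.ext_getElem (by simp; omega) fun k h₁ h₂ => ?_
  have : k < ws.length := by simp at h₁; omega
  simp [position, this]

theorem edgeLetters_eq (hlen : n + (edgeList G).length ≤ ws.length) :
    edgeLetters (boolMatrix G) ws = (edgeList G).map fun e =>
      ((e.1.1.val, e.1.2.val), ws.getD (position (G := G) (Sum.inr e)) noLetter) := by
  classical
  rw [edgeLetters, length_boolMatrix, matrixEdges_boolMatrix]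
  refine List.ext_getElem (by simp; omega) fun k h₁ h₂ => ?_
  have h₃ : k < (edgeList G).length := by simpa using h₂
  have h₄ : n + k < ws.length := by omega
  simp only [List.getElem_zip, List.getElem_map, List.getElem_drop, position,
    (nodup_edgeList G).idxOf_getElem k h₃, List.getD_eq_getElem _ _ h₄]

theorem edgeIndex_eq (hlen : n + (edgeList G).length ≤ ws.length) (u v : Fin n)
    [Decidable (u < v ∧ G.Adj u v)] :
    edgeIndex (edgeLetters (boolMatrix G) ws) u v =
      if h : u < v ∧ G.Adj u v then (assignWeights G ws).idx (Sum.inr ⟨(u, v), h⟩) else 0 := by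
  rw [edgeIndex, edgeLetters_eq hlen, List.head?_filter, List.find?_map]
  split_ifs with h
  · have hf : (edgeList G).find? ((fun p : (ℕ × ℕ) × Letter => decide (p.1.1 = u ∧ p.1.2 = v)) ∘
        fun e => ((e.1.1.val, e.1.2.val), ws.getD (position (G := G) (Sum.inr e)) noLetter)) =
          some ⟨(u, v), h⟩ := by
      cases hf : (edgeList G).find? ((fun p : (ℕ × ℕ) × Letter => decide (p.1.1 = u ∧ p.1.2 = v)) ∘
        fun e => ((e.1.1.val, e.1.2.val), ws.getD (position (G := G) (Sum.inr e)) noLetter)) with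
      | none =>
        have := List.find?_eq_none.1 hf _ (mem_edgeList ⟨(u, v), h⟩)
        simp at this
      | some e =>
        have h₁ := List.find?_some hf
        simp only [Function.comp, decide_eq_true_eq] at h₁
        congr 1
        exact Subtype.ext (Prod.ext (Fin.ext h₁.1) (Fin.ext h₁.2))
    rw [hf]
    rfl
  · have hf : (edgeList G).find? ((fun p : (ℕ × ℕ) × Letter => decide (p.1.1 = u ∧ p.1.2 = v)) ∘
        fun e => ((e.1.1.val, e.1.2.val), ws.getD (position (G := G) (Sum.inr e)) noLetter)) =
          none := by
      refine List.find?_eq_none.2 fun e _ he => h ?_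
      simp only [Function.comp, decide_eq_true_eq] at he
      have h₁ : e.1.1 = u := Fin.ext he.1
      have h₂ : e.1.2 = v := Fin.ext he.2
      exact h₁ ▸ h₂ ▸ e.2
    rw [hf]
    rfl

theorem range_eq_map_finRange (n : ℕ) : List.range n = (List.finRange n).map Fin.val := by
  simp

theorem enc_weightedMatrix (hlen : n + (edgeList G).length ≤ ws.length) :
    enc (weightedMatrix (boolMatrix G) ws) = encWGraph (assignWeights G ws) := by
  classical
  rw [weightedMatrix, encWGraph, enc_mk, enc_mk, vertexLetters_eq hlen, length_boolMatrix,
    encGraph_eq]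
  have h₁ : ((List.finRange n).map fun v =>
      (v.val, ws.getD (position (G := G) (Sum.inl v)) noLetter)).map (fun p => p.2.1) =
      (List.finRange n).map fun v => (assignWeights G ws).idx (Sum.inl v) := by
    rw [List.map_map]; rfl
  have h₂ : ((List.range n).map fun u => (List.range n).map fun v =>
      edgeIndex (edgeLetters (boolMatrix G) ws) u v) =
      (List.finRange n).map fun u => (List.finRange n).map fun v =>
        if h : u < v ∧ G.Adj u v then (assignWeights G ws).idx (Sum.inr ⟨(u, v), h⟩) else 0 := by
    rw [range_eq_map_finRange, List.map_map]
    refine List.map_congr_left fun u _ => ?_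
    rw [Function.comp, List.map_map]
    exact List.map_congr_left fun v _ => edgeIndex_eq hlen u v
  rw [h₁, h₂]
  congr 2
  · exact (encList_eq_enc _ _ (fun _ => rfl) _).symm
  · exact (encList_eq_enc _ _ (fun u => encList_eq_enc _ (fun v =>
      if h : u < v ∧ G.Adj u v then (assignWeights G ws).idx (Sum.inr ⟨(u, v), h⟩) else 0)
      (fun _ => rfl) _) _).symm

/-! ### Names for the vertices of `T(G)` and its adjacency matrix. -/

theorem vnameEq_iff {a b : VName} : vnameEq a b = true ↔ a = b := by
  simp only [vnameEq, Bool.and_eq_true, decide_eq_true_eq, Prod.ext_iff]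

variable {HV : ℕ → VertexGadget} {HE : ℕ → EdgeGadget}

/-- The name of a vertex of `T(G)`. -/
def vname {HV : ℕ → VertexGadget} {HE : ℕ → EdgeGadget} {G : WGraph} : TVertex HV HE G → VName
  | Sum.inl v => (0, v, 0, 0)
  | Sum.inr (Sum.inl ⟨v, j⟩) => (1, v, j, 0)
  | Sum.inr (Sum.inr ⟨e, j⟩) => (2, e.1.1, e.1.2, j)

/-- The leading tag separates the three kinds of vertices, and an edge is determined by its
endpoints. -/
theorem vname_injective {G : WGraph} : Function.Injective (vname (HV := HV) (HE := HE) (G := G)) := by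
  rintro (u | ⟨u, i⟩ | ⟨⟨⟨u, u'⟩, hu⟩, i⟩) (v | ⟨v, j⟩ | ⟨⟨⟨v, v'⟩, hv⟩, j⟩) h <;>
    simp only [vname, Prod.mk.injEq, false_and, and_true, true_and,
      OfNat.ofNat_ne_zero, OfNat.zero_ne_ofNat, zero_ne_one, one_ne_zero, OfNat.ofNat_ne_one,
      OfNat.one_ne_ofNat] at h
  · rw [Fin.ext h]
  · obtain ⟨h₁, h₂⟩ := h
    obtain rfl := Fin.ext h₁
    rw [Fin.ext h₂]
  · obtain ⟨h₁, h₂, h₃⟩ := h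
    obtain rfl := Fin.ext h₁
    obtain rfl := Fin.ext h₂
    rw [Fin.ext h₃]

theorem vname_placeV {G : WGraph} (v : Fin G.n) (x : Fin ((HV (G.idx (Sum.inl v))).inner + 1)) :
    vname (placeV HV HE G v x) = vertexPlace v x := by
  induction x using Fin.cases <;> simp [placeV, vname, vertexPlace]

theorem vname_placeE {G : WGraph} (e : Edge G.graph)
    (x : Fin ((HE (G.idx (Sum.inr e))).inner + 2)) :
    vname (placeE HV HE G e x) = edgePlace (e.1.1, e.1.2) x := by
  induction x using Fin.cases with
  | zero => simp [placeE, vname, edgePlace]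
  | succ x =>
    induction x using Fin.cases with
    | zero => rfl
    | succ x => simp [placeE, vname, edgePlace]

/-- The order of the vertices matters, because the polynomial need not be invariant under
isomorphism. The hypotheses identify the matrices stored in the letters; removing one or two rows
leaves as many rows as there are inner vertices. -/
theorem gadgetVertices_eq (hlen : n + (edgeList G).length ≤ ws.length)
    (hV : ∀ c ∈ ws, c.2.1 = boolMatrix (HV c.1).graph)
    (hE : ∀ c ∈ ws, c.2.2.1 = boolMatrix (HE c.1).graph) :
    gadgetVertices (boolMatrix G) ws = (TList HV HE (assignWeights G ws)).map vname := by
  have hmem : ∀ a : Elt G, ws.getD (position a) noLetter ∈ ws := fun a => by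
    rw [List.getD_eq_getElem _ _ ((position_lt a).trans_le hlen)]
    exact List.getElem_mem _
  rw [gadgetVertices, TList, List.map_append, List.map_append, vertexLetters_eq hlen,
    edgeLetters_eq hlen, length_boolMatrix, List.flatMap_map, List.flatMap_map, List.map_flatMap,
    List.map_flatMap, List.map_map, range_eq_map_finRange, List.map_map]
  congr 1
  · congr 1
    refine List.flatMap_congr fun v _ => ?_
    dsimp only
    rw [hV _ (hmem _), List.length_tail, length_boolMatrix, List.map_map, Nat.add_sub_cancel,
      range_eq_map_finRange, List.map_map]
    rfl
  · refine List.flatMap_congr fun e _ => ?_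
    dsimp only
    rw [hE _ (hmem _), List.length_tail, List.length_tail, length_boolMatrix, List.map_map,
      Nat.sub_sub, Nat.add_sub_cancel, range_eq_map_finRange, List.map_map]
    rfl

theorem mem_gadgetEdges (hlen : n + (edgeList G).length ≤ ws.length)
    (hV : ∀ c ∈ ws, c.2.1 = boolMatrix (HV c.1).graph)
    (hE : ∀ c ∈ ws, c.2.2.1 = boolMatrix (HE c.1).graph)
    (a b : TVertex HV HE (assignWeights G ws)) :
    (vname a, vname b) ∈ gadgetEdges (boolMatrix G) ws ↔
      ((∃ v x y, (HV ((assignWeights G ws).idx (Sum.inl v))).graph.Adj x y ∧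
        placeV HV HE _ v x = a ∧ placeV HV HE _ v y = b) ∨
      (∃ e x y, (HE ((assignWeights G ws).idx (Sum.inr e))).graph.Adj x y ∧
        placeE HV HE _ e x = a ∧ placeE HV HE _ e y = b)) := by
  have hmem : ∀ a : Elt G, ws.getD (position a) noLetter ∈ ws := fun a => by
    rw [List.getD_eq_getElem _ _ ((position_lt a).trans_le hlen)]
    exact List.getElem_mem _
  rw [gadgetEdges, vertexLetters_eq hlen, edgeLetters_eq hlen, List.mem_append, List.flatMap_map,
    List.flatMap_map]
  refine or_congr ?_ ?_
  · rw [List.mem_flatMap]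
    refine ⟨?_, ?_⟩
    · rintro ⟨v, -, h⟩
      dsimp only at h
      rw [hV _ (hmem _), List.mem_map] at h
      obtain ⟨p, hp, h⟩ := h
      obtain ⟨x, y, hxy, rfl⟩ := mem_ones_boolMatrix.1 hp
      simp only [Prod.mk.injEq] at h
      refine ⟨v, x, y, hxy, vname_injective ?_, vname_injective ?_⟩
      · exact (vname_placeV (G := assignWeights G ws) v x).trans h.1
      · exact (vname_placeV (G := assignWeights G ws) v y).trans h.2
    · rintro ⟨v, x, y, hxy, rfl, rfl⟩
      refine ⟨v, List.mem_finRange _, ?_⟩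
      dsimp only
      rw [hV _ (hmem _), List.mem_map]
      refine ⟨(x.val, y.val), mem_ones_boolMatrix.2 ⟨x, y, hxy, rfl⟩, ?_⟩
      rw [vname_placeV, vname_placeV]
  · rw [List.mem_flatMap]
    refine ⟨?_, ?_⟩
    · rintro ⟨e, -, h⟩
      dsimp only at h
      rw [hE _ (hmem _), List.mem_map] at h
      obtain ⟨p, hp, h⟩ := h
      obtain ⟨x, y, hxy, rfl⟩ := mem_ones_boolMatrix.1 hp
      simp only [Prod.mk.injEq] at h
      refine ⟨e, x, y, hxy, vname_injective ?_, vname_injective ?_⟩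
      · exact (vname_placeE (G := assignWeights G ws) e x).trans h.1
      · exact (vname_placeE (G := assignWeights G ws) e y).trans h.2
    · rintro ⟨e, x, y, hxy, rfl, rfl⟩
      refine ⟨e, mem_edgeList _, ?_⟩
      dsimp only
      rw [hE _ (hmem _), List.mem_map]
      refine ⟨(x.val, y.val), mem_ones_boolMatrix.2 ⟨x, y, hxy, rfl⟩, ?_⟩
      rw [vname_placeE, vname_placeE]

/-- `SimpleGraph.fromRel` takes the symmetric closure without loops, and the matrix does the same on
names. Since `vname` is injective, the two agree entry by entry. -/
theorem enc_gadgetMatrix (hlen : n + (edgeList G).length ≤ ws.length)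
    (hV : ∀ c ∈ ws, c.2.1 = boolMatrix (HV c.1).graph)
    (hE : ∀ c ∈ ws, c.2.2.1 = boolMatrix (HE c.1).graph) :
    enc (gadgetMatrix (boolMatrix G) ws) = encGraph (gadgetGraph HV HE (assignWeights G ws)) := by
  classical
  rw [encGraph_eq]
  congr 1
  have h₁ : boolMatrix (gadgetGraph HV HE (assignWeights G ws)) =
      (TList HV HE (assignWeights G ws)).map fun a => (TList HV HE (assignWeights G ws)).map fun b =>
        decide ((TGraph HV HE (assignWeights G ws)).Adj a b) := by
    conv_rhs => rw [← List.map_get_finRange (TList HV HE (assignWeights G ws))]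
    rw [List.map_map, boolMatrix]
    refine List.map_congr_left fun i _ => ?_
    rw [Function.comp, List.map_map]
    refine List.map_congr_left fun j _ => ?_
    simp [gadgetGraph]
  rw [h₁, gadgetMatrix, gadgetVertices_eq hlen hV hE, List.map_map]
  refine List.map_congr_left fun a _ => ?_
  rw [Function.comp, List.map_map]
  refine List.map_congr_left fun b _ => ?_
  rw [Function.comp, Bool.eq_iff_iff, decide_eq_true_eq, TGraph, SimpleGraph.fromRel_adj,
    ← mem_gadgetEdges hlen hV hE, ← mem_gadgetEdges hlen hV hE]
  simp only [Bool.and_eq_true, Bool.not_eq_true', ← Bool.not_eq_true, vnameEq_iff, List.any_eq_true,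
    Bool.or_eq_true, vname_injective.eq_iff, ne_eq]
  refine and_congr Iff.rfl ⟨?_, ?_⟩
  · rintro ⟨⟨c, d⟩, he, ⟨rfl, rfl⟩ | ⟨rfl, rfl⟩⟩
    · exact Or.inl he
    · exact Or.inr he
  · rintro (h | h)
    · exact ⟨_, h, Or.inl ⟨rfl, rfl⟩⟩
    · exact ⟨_, h, Or.inr ⟨rfl, rfl⟩⟩

end

/-! ### Correctness of the algorithm -/

theorem allSome_cons {α : Type} (a : Option α) (l : List (Option α)) :
    allSome (a :: l) = (allSome l).bind fun t => a.map fun b => b :: t := rfl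

theorem allSome_map_sound {α β : Type} {L : List α} {f : α → Option β} {g : α → β} {r : List β}
    (h : ∀ a ∈ L, ∀ b, f a = some b → b = g a) (hr : allSome (L.map f) = some r) :
    r = L.map g := by
  induction L generalizing r with
  | nil => simpa [allSome] using hr.symm
  | cons a L ih =>
    simp only [List.map_cons, allSome_cons, Option.bind_eq_some_iff, Option.map_eq_some_iff] at hr
    obtain ⟨t, ht, b, hb, rfl⟩ := hr
    rw [List.map_cons, ih (fun a ha => h a (by simp [ha])) ht, h a (by simp) b hb]

theorem allSome_map_complete {α β : Type} {L : List α} {f : α → Option β} {g : α → β}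
    (h : ∀ a ∈ L, f a = some (g a)) : allSome (L.map f) = some (L.map g) := by
  induction L with
  | nil => rfl
  | cons a L ih =>
    rw [List.map_cons, allSome_cons, ih fun a ha => h a (by simp [ha]), h a (by simp)]
    rfl

theorem filter_range_lt {n m : ℕ} (h : m ≤ n) (p : ℕ → Bool) (hp : ∀ i, p i = true ↔ i < m) :
    (List.range n).filter p = List.range m := by
  obtain ⟨k, rfl⟩ := Nat.exists_eq_add_of_le h
  rw [List.range_add, List.filter_append, List.filter_eq_self.2, List.filter_eq_nil_iff.2,
    List.append_nil]
  · intro a ha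
    obtain ⟨b, -, rfl⟩ := List.mem_map.1 ha
    rw [hp]; omega
  · intro a ha
    rw [hp]
    exact List.mem_range.1 ha

theorem firstSome_eq {α : Type} (l : List (Option α)) :
    (∀ a, firstSome l = some a → some a ∈ l) ∧ (∀ a, some a ∈ l → (firstSome l).isSome) := by
  induction l using List.reverseRecOn with
  | nil => simp [firstSome]
  | append_singleton l o ih =>
    have h : firstSome (l ++ [o]) = if (firstSome l).isSome then firstSome l else o := by
      rw [firstSome, List.foldl_append]; rfl
    rw [h]
    split_ifs with h₁
    · exact ⟨fun a ha => by simp [ih.1 a ha], fun _ _ => h₁⟩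
    · refine ⟨fun a ha => by simp [ha], fun a ha => ?_⟩
      rcases List.mem_append.1 ha with ha | ha
      · exact absurd (ih.2 a ha) h₁
      · rw [← List.mem_singleton.1 ha]; rfl

section
variable {MW MA MB MF ME : Code} {W : ℕ → ℚ} {HV : ℕ → VertexGadget} {HE : ℕ → EdgeGadget}
  {F : WGraph → ℚ} {χ : SieveFunction} {ω : WeightSelector} {ξ : ℚ}

/-- The weights with indices `0, …, d`. -/
def trueWeights (W : ℕ → ℚ) (d : ℕ) : List (ℕ × ℚ) := (List.range (d + 1)).map fun i => (i, W i)

theorem letter_eq (W : ℕ → ℚ) (HV : ℕ → VertexGadget) (HE : ℕ → EdgeGadget) (B : List Unit)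
    (d i : ℕ) : letter MA MB B (trueWeights W d) (i, W i) =
      (MA.out B (enc i)).bind fun a => (MB.out B (enc i)).map fun b =>
        (i, decMatrix a, decMatrix b, (trueLetter W HV HE d i).2.2.2) := by
  simp only [letter, trueLetter, trueWeights, List.filter_map, List.map_map, Function.comp_def]

/-- The programs for weights and gadgets have no time bound, but by determinism any output obtained
within the fuel is the right one. -/
theorem letters_sound (hMW : ∀ i, ∃ t, Runs MW (encNat i) (encRat (W i)) t)
    (hMA : ∀ i, ∃ t, Runs MA (encNat i) (encGraph (HV i).graph) t)
    (hMB : ∀ i, ∃ t, Runs MB (encNat i) (encGraph (HE i).graph) t) {B : List Unit} {d : ℕ}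
    (hd : d < B.length) {l : List Letter} (h : letters MW MA MB B d = some l) :
    l = (List.range (d + 1)).map (trueLetter W HV HE d) := by
  rw [letters, Option.bind_eq_some_iff,
    filter_range_lt (m := d + 1) hd _ (fun i => by rw [decide_eq_true_eq]; omega)] at h
  obtain ⟨r, hr, h⟩ := h
  obtain rfl : r = trueWeights W d := by
    refine allSome_map_sound (fun i _ b hb => ?_) hr
    obtain ⟨x, hx, rfl⟩ := Option.map_eq_some_iff.1 hb
    obtain ⟨t, ht⟩ := hMW i
    rw [Code.eq_of_out ht hx]
    congr 1
    exact decRat_enc (W i)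
  rw [trueWeights, List.map_map] at h
  refine allSome_map_sound (fun i _ b hb => ?_) h
  rw [Function.comp, ← trueWeights, letter_eq W HV HE, Option.bind_eq_some_iff] at hb
  obtain ⟨a, ha, hb⟩ := hb
  obtain ⟨b', hb', rfl⟩ := Option.map_eq_some_iff.1 hb
  obtain ⟨t, ht⟩ := hMA i
  obtain ⟨t', ht'⟩ := hMB i
  rw [Code.eq_of_out ht ha, Code.eq_of_out ht' hb']
  rfl

theorem letters_complete {B : List Unit} {d : ℕ} (hd : d < B.length)
    (hMW : ∀ i ≤ d, ∃ t, Runs MW (encNat i) (encRat (W i)) t ∧ t ≤ B.length)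
    (hMA : ∀ i ≤ d, ∃ t, Runs MA (encNat i) (encGraph (HV i).graph) t ∧ t ≤ B.length)
    (hMB : ∀ i ≤ d, ∃ t, Runs MB (encNat i) (encGraph (HE i).graph) t ∧ t ≤ B.length) :
    letters MW MA MB B d = some ((List.range (d + 1)).map (trueLetter W HV HE d)) := by
  rw [letters, filter_range_lt (m := d + 1) hd _ (fun i => by rw [decide_eq_true_eq]; omega),
    allSome_map_complete (g := fun i => (i, W i)) (fun i hi => ?_), Option.bind_some, ← trueWeights]
  · conv_lhs => arg 1; arg 2; rw [trueWeights]
    rw [List.map_map]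
    refine allSome_map_complete fun i hi => ?_
    have hi : i ≤ d := by have := List.mem_range.1 hi; omega
    obtain ⟨t, ht, htB⟩ := hMA i hi
    obtain ⟨t', ht', htB'⟩ := hMB i hi
    rw [Function.comp, letter_eq W HV HE, show enc i = encNat i from rfl, Code.out_eq ht htB,
      Code.out_eq ht' htB']
    rfl
  · have hi : i ≤ d := by have := List.mem_range.1 hi; omega
    obtain ⟨t, ht, htB⟩ := hMW i hi
    rw [show enc i = encNat i from rfl, Code.out_eq ht htB, Option.map_some]
    congr 2
    exact decRat_enc (W i)

/-- The letters of the word, each repeated `d` times. -/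
def spread (d : ℕ) (w : List Letter) : List Letter :=
  w.flatMap fun c => (List.replicate d ()).map fun _ => c

theorem spread_eq {α : Type} (ds : List α) (w : List Letter) :
    (w.flatMap fun c => ds.map fun _ => c) = spread ds.length w := by
  simp [spread]

/-- The true contribution of a word. -/
noncomputable def trueTerm (HV : ℕ → VertexGadget) (HE : ℕ → EdgeGadget) (F : WGraph → ℚ)
    (χ : SieveFunction) (ω : WeightSelector) (ξ : ℚ) (d : ℕ) {n : ℕ} (G : SimpleGraph (Fin n))
    (w : List Letter) : List ℚ :=
  (pprod (w.map fun c => c.2.2.2.1)).map (fun c : ℤ =>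
    (inducedPoly χ ω _ (gadgetGraph HV HE (assignWeights G (spread d w)))).eval ξ *
      (F (assignWeights G (spread d w)))⁻¹ * (w.map fun c => c.2.2.2.2).prod * (c : ℚ)) ++
    zeros (boolMatrix G)

theorem spread_spec {d k : ℕ} {l w : List Letter}
    (hl : l = (List.range (d + 1)).map (trueLetter W HV HE d)) (hw : w ∈ allWords l k) :
    (spread d w).length = k * d ∧ (∀ c ∈ spread d w, c.1 ≤ d) ∧
      (∀ c ∈ spread d w, c.2.1 = boolMatrix (HV c.1).graph) ∧
      (∀ c ∈ spread d w, c.2.2.1 = boolMatrix (HE c.1).graph) := by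
  obtain ⟨h₁, h₂⟩ := mem_allWords hw
  have h₃ : ∀ c ∈ spread d w, ∃ i ≤ d, c = trueLetter W HV HE d i := by
    intro c hc
    simp only [spread, List.mem_flatMap, List.mem_map] at hc
    obtain ⟨c', hc', -, -, rfl⟩ := hc
    have := h₂ _ hc'
    rw [hl, List.mem_map] at this
    obtain ⟨i, hi, rfl⟩ := this
    exact ⟨i, by have := List.mem_range.1 hi; omega, rfl⟩
  refine ⟨by simp [spread, h₁], fun c hc => ?_, fun c hc => ?_, fun c hc => ?_⟩
  all_goals obtain ⟨i, hi, rfl⟩ := h₃ c hc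
  · exact hi
  · exact decMatrix_encGraph _
  · exact decMatrix_encGraph _

theorem length_zeros {n : ℕ} (G : SimpleGraph (Fin n)) :
    (zeros (boolMatrix G)).length = n + (edgeList G).length + 1 := by
  simp [zeros, matrixEdges_boolMatrix]

/-- The identity `sum_words_inducedPoly`, read coefficient by coefficient, with the values of
`multiPoly` replaced by evaluations at `ξ` on `T(G)` through `hred`. -/
theorem addLists_trueTerm (hW : Function.Injective W) (hred : AllowsReduction χ ω ξ W HV HE F)
    {n : ℕ} (G : SimpleGraph (Fin n)) {d k : ℕ} (hk : n + (edgeList G).length ≤ k * d)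
    {l : List Letter} (hl : l = (List.range (d + 1)).map (trueLetter W HV HE d)) :
    addLists (zeros (boolMatrix G)) ((allWords l k).map (trueTerm HV HE F χ ω ξ d G)) =
      (List.range (n + Fintype.card (Edge G) + 1)).map fun i => (inducedPoly χ ω n G).coeff i := by
  have hz : ∀ a ∈ zeros (boolMatrix G), a = 0 := by
    simp only [zeros, List.mem_cons, List.mem_append, List.mem_map]
    rintro a (rfl | ⟨_, -, rfl⟩ | ⟨_, -, rfl⟩) <;> rfl
  rw [addLists_eq _ _ rfl (fun t ht => by
    obtain ⟨w, -, rfl⟩ := List.mem_map.1 ht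
    simp [trueTerm]), length_zeros, length_edgeList]
  refine List.map_congr_left fun i hi => ?_
  have hlist := sum_words_inducedPoly χ ω G l (fun c => W c.1) letterPoly (List.replicate d ())
    (fun e he => by rw [hl]; exact sum_trueLetter hW HV HE d e (by simpa using he)) noLetter k
    position (position_injective G) (fun a => by
      rw [List.length_replicate]; exact (position_lt a).trans_le hk)
  have hcoeff : ∀ L : List ℚ[X], L.sum.coeff i = (L.map fun q => q.coeff i).sum := by
    intro L
    induction L with
    | nil => simp
    | cons q L ih => simp [ih]
  have hi' : (zeros (boolMatrix G)).getD i 0 = 0 := by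
    rw [List.getD_eq_getElem _ _ (by
      rw [length_zeros, length_edgeList]; exact List.mem_range.1 hi)]
    exact hz _ (List.getElem_mem _)
  rw [← hlist, hcoeff, List.map_map, List.map_map, hi', zero_add]
  congr 1
  refine List.map_congr_left fun w _ => ?_
  simp only [Function.comp]
  rw [trueTerm, getD_map_append_zeros _ _ _ hz, ← coeff_C_mul]
  congr 1
  have h₁ := hred (assignWeights G (spread d w))
  have h₂ : ∀ w : List Letter, (w.map letterPoly).prod =
      C (w.map fun c => c.2.2.2.2).prod * toPoly (pprod (w.map fun c => c.2.2.2.1)) := by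
    intro w
    rw [toPoly_pprod]
    induction w with
    | nil => simp
    | cons c w ih =>
      simp only [List.map_cons, List.prod_cons, ih, letterPoly, C_mul]
      ring
  rw [h₂, ← mul_assoc, ← C_mul, ← div_eq_mul_inv, ← h₁]
  rfl

theorem blocks_eq {N d : ℕ} (hd : 1 ≤ d) :
    (List.range (N + 1)).filter (fun i => i * d + 1 ≤ N + 1) = List.range (N / d + 1) := by
  refine filter_range_lt (Nat.succ_le_succ (Nat.div_le_self _ _)) _ fun i => ?_
  rw [decide_eq_true_eq, Nat.lt_succ_iff, Nat.le_div_iff_mul_le hd]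
  omega

/-- The additional block takes the remainder. If it is superfluous it does no harm, because the
Lagrange polynomials sum to one. -/
theorem le_blocks_mul {N d : ℕ} (hd : 1 ≤ d) : N ≤ (N / d + 1) * d := by
  have h₁ := Nat.mod_lt N hd
  have h₂ := Nat.div_add_mod N d
  rw [add_mul, mul_comm (N / d)]
  omega

/-- Only halting with the right output is required of the programs, without time bounds; hence this
applies to every block size and every fuel. -/
theorem interpolate_sound (hMW : ∀ i, ∃ t, Runs MW (encNat i) (encRat (W i)) t)
    (hMA : ∀ i, ∃ t, Runs MA (encNat i) (encGraph (HV i).graph) t)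
    (hMB : ∀ i, ∃ t, Runs MB (encNat i) (encGraph (HE i).graph) t)
    (hMF : ∀ G, ∃ t, Runs MF (encWGraph G) (encRat (F G)) t)
    (hME : ∀ n (G : SimpleGraph (Fin n)), ∃ t,
      Runs ME (encGraph G) (encRat ((inducedPoly χ ω n G).eval ξ)) t)
    (hW : Function.Injective W) (hred : AllowsReduction χ ω ξ W HV HE F)
    {n : ℕ} (G : SimpleGraph (Fin n)) {B : List Unit} {d : ℕ} (hd : 1 ≤ d) (hdB : d < B.length)
    {r : List ℚ} (h : interpolate MW MA MB MF ME B (boolMatrix G) d = some r) :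
    r = (List.range (n + Fintype.card (Edge G) + 1)).map fun i =>
      (inducedPoly χ ω n G).coeff i := by
  simp only [interpolate, Option.bind_eq_some_iff, Option.map_eq_some_iff] at h
  obtain ⟨l, hl, Ws, hWs, T, hT, rfl⟩ := h
  have hl' := letters_sound hMW hMA hMB hdB hl
  have hlen : l.tail.length = d := by simp [hl']
  rw [length_zeros, blocks_eq hd] at hWs
  obtain rfl := (words_eq_some hWs).1
  rw [List.length_range] at hT
  rw [← addLists_trueTerm hW hred G (le_blocks_mul hd) hl']
  congr 1
  refine allSome_map_sound (fun w hw t ht => ?_) hT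
  obtain ⟨h₁, -, h₂, h₃⟩ := spread_spec hl' hw
  have h₁ : n + (edgeList G).length ≤ (spread d w).length := h₁ ▸ le_blocks_mul hd
  rw [term, spread_eq, hlen, enc_weightedMatrix h₁, enc_gadgetMatrix h₁ h₂ h₃,
    Option.bind_eq_some_iff] at ht
  obtain ⟨f, hf, ht⟩ := ht
  obtain ⟨e, he, rfl⟩ := Option.map_eq_some_iff.1 ht
  obtain ⟨tf, htf⟩ := hMF (assignWeights G (spread d w))
  obtain ⟨te, hte⟩ := hME _ (gadgetGraph HV HE (assignWeights G (spread d w)))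
  have h₄ : ∀ q : ℚ, decRat (encRat q) = q := decRat_enc
  rw [Code.eq_of_out htf hf, Code.eq_of_out hte he, h₄, h₄]
  rfl

/-- Time bounds are needed only for the data actually used: indices up to `d` and graphs with such
weights. -/
theorem interpolate_complete {n : ℕ} (G : SimpleGraph (Fin n)) {B : List Unit} {d : ℕ}
    (hd : 1 ≤ d) (hdB : d < B.length)
    (hMW : ∀ i ≤ d, ∃ t, Runs MW (encNat i) (encRat (W i)) t ∧ t ≤ B.length)
    (hMA : ∀ i ≤ d, ∃ t, Runs MA (encNat i) (encGraph (HV i).graph) t ∧ t ≤ B.length)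
    (hMB : ∀ i ≤ d, ∃ t, Runs MB (encNat i) (encGraph (HE i).graph) t ∧ t ≤ B.length)
    (hwords : (d + 1) ^ ((n + (edgeList G).length) / d + 1) ≤ B.length)
    (hM : ∀ ws : List Letter, n + (edgeList G).length ≤ ws.length →
      (∀ c ∈ ws, c.1 ≤ d) → (∀ c ∈ ws, c.2.1 = boolMatrix (HV c.1).graph) →
      (∀ c ∈ ws, c.2.2.1 = boolMatrix (HE c.1).graph) →
      (∃ t, Runs MF (encWGraph (assignWeights G ws)) (encRat (F (assignWeights G ws))) t ∧
        t ≤ B.length) ∧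
      ∃ t, Runs ME (encGraph (gadgetGraph HV HE (assignWeights G ws)))
        (encRat ((inducedPoly χ ω _ (gadgetGraph HV HE (assignWeights G ws))).eval ξ)) t ∧
          t ≤ B.length) :
    ∃ r, interpolate MW MA MB MF ME B (boolMatrix G) d = some r := by
  obtain ⟨l, hl⟩ : ∃ l, l = (List.range (d + 1)).map (trueLetter W HV HE d) := ⟨_, rfl⟩
  have hlen : l.length = d + 1 := by simp [hl]
  rw [interpolate, letters_complete hdB hMW hMA hMB, ← hl, Option.bind_some, length_zeros,
    blocks_eq hd, words_isSome (by omega) (by rw [hlen, List.length_range]; exact hwords),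
    Option.bind_some, List.length_range,
    allSome_map_complete (g := trueTerm HV HE F χ ω ξ d G) (fun w hw => ?_)]
  · exact ⟨_, rfl⟩
  · obtain ⟨h₁, h₀, h₂, h₃⟩ := spread_spec hl hw
    have h₁ : n + (edgeList G).length ≤ (spread d w).length := h₁ ▸ le_blocks_mul hd
    obtain ⟨⟨tf, htf, htfB⟩, te, hte, hteB⟩ := hM _ h₁ h₀ h₂ h₃
    have h₄ : ∀ q : ℚ, decRat (encRat q) = q := decRat_enc
    rw [term, spread_eq, List.length_tail, hlen, Nat.add_sub_cancel, enc_weightedMatrix h₁,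
      enc_gadgetMatrix h₁ h₂ h₃, Code.out_eq htf htfB, Code.out_eq hte hteB, Option.bind_some,
      Option.map_some, h₄, h₄]
    rfl

theorem search_sound (hMW : ∀ i, ∃ t, Runs MW (encNat i) (encRat (W i)) t)
    (hMA : ∀ i, ∃ t, Runs MA (encNat i) (encGraph (HV i).graph) t)
    (hMB : ∀ i, ∃ t, Runs MB (encNat i) (encGraph (HE i).graph) t)
    (hMF : ∀ G, ∃ t, Runs MF (encWGraph G) (encRat (F G)) t)
    (hME : ∀ n (G : SimpleGraph (Fin n)), ∃ t,
      Runs ME (encGraph G) (encRat ((inducedPoly χ ω n G).eval ξ)) t)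
    (hW : Function.Injective W) (hred : AllowsReduction χ ω ξ W HV HE F)
    {n : ℕ} (G : SimpleGraph (Fin n)) {B : List Unit} {z : Data}
    (h : search MW MA MB MF ME B (encGraph G) = some z) :
    z = enc ((List.range (n + Fintype.card (Edge G) + 1)).map fun i =>
      (inducedPoly χ ω n G).coeff i) := by
  rw [search, decMatrix_encGraph, Option.map_eq_some_iff] at h
  obtain ⟨r, hr, rfl⟩ := h
  have hr := (firstSome_eq _).1 _ hr
  rw [List.mem_map] at hr
  obtain ⟨d, hd, hr⟩ := hr
  rw [List.mem_filter, List.mem_range, decide_eq_true_eq] at hd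
  rw [interpolate_sound hMW hMA hMB hMF hME hW hred G hd.2 hd.1 hr]

theorem search_isSome {n : ℕ} (G : SimpleGraph (Fin n)) {B : List Unit} {d : ℕ} (hd : 1 ≤ d)
    (hdB : d < B.length) (h : ∃ r, interpolate MW MA MB MF ME B (boolMatrix G) d = some r) :
    (search MW MA MB MF ME B (encGraph G)).isSome := by
  obtain ⟨r, hr⟩ := h
  rw [search, decMatrix_encGraph, Option.isSome_map]
  refine (firstSome_eq _).2 r ?_
  rw [List.mem_map]
  exact ⟨d, by simp [hd, hdB], hr⟩

end

/-! ### The size of `T(G)` -/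

section
variable {HV : ℕ → VertexGadget} {HE : ℕ → EdgeGadget} {G : WGraph} {s : ℕ}

/-- The sparsity of `T(G)` is measured against its own vertex number, so a lower bound is needed to
carry over edge bounds linear in `G.n`. -/
theorem le_length_TList : G.n ≤ (TList HV HE G).length := by
  simp only [TList, List.length_append, List.length_map, List.length_finRange]
  omega

theorem sum_map_le_length_mul {α : Type} (l : List α) (f : α → ℕ) (h : ∀ a, f a ≤ s) :
    (l.map f).sum ≤ l.length * s := by
  have := List.sum_le_card_nsmul (l.map f) s (by simpa using fun a _ => h a)
  simpa using this

theorem length_TList_le (hV : ∀ v, (HV (G.idx (Sum.inl v))).inner ≤ s)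
    (hE : ∀ e, (HE (G.idx (Sum.inr e))).inner ≤ s) :
    (TList HV HE G).length ≤ (G.n + Fintype.card (Edge G.graph)) * (s + 1) := by
  have h₁ := sum_map_le_length_mul (List.finRange G.n) _ hV
  have h₂ := sum_map_le_length_mul (edgeList G.graph) _ hE
  rw [length_edgeList] at h₂
  simp only [TList, List.length_append, List.length_map, List.length_finRange,
    List.length_flatMap] at h₁ h₂ ⊢
  rw [add_mul, mul_add, mul_add]
  omega

theorem nodup_TList : (TList HV HE G).Nodup := by
  rw [TList, List.nodup_append', List.nodup_append', List.nodup_flatMap, List.nodup_flatMap]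
  refine ⟨⟨(List.nodup_finRange _).map Sum.inl_injective, ⟨fun v _ => ?_, ?_⟩, ?_⟩,
    ⟨fun e _ => ?_, ?_⟩, ?_⟩
  · exact (List.nodup_finRange _).map fun i j h => by simpa using h
  · refine (List.nodup_finRange _).imp fun {u v} huv => ?_
    simp only [Function.onFun, List.disjoint_left, List.mem_map]
    rintro _ ⟨i, -, rfl⟩ ⟨j, -, h⟩
    exact huv (congrArg Sigma.fst (Sum.inl_injective (Sum.inr_injective h))).symm
  · simp [List.disjoint_left]
  · exact (List.nodup_finRange _).map fun i j h => by simpa using h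
  · refine (nodup_edgeList _).imp fun {u v} huv => ?_
    simp only [Function.onFun, List.disjoint_left, List.mem_map]
    rintro _ ⟨i, -, rfl⟩ ⟨j, -, h⟩
    exact huv (congrArg Sigma.fst (Sum.inr_injective (Sum.inr_injective h))).symm
  · simp only [List.disjoint_left, List.mem_append, List.mem_map, List.mem_flatMap]
    rintro _ (⟨_, -, rfl⟩ | ⟨_, -, _, -, rfl⟩) ⟨_, -, _, -, h⟩ <;> simp at h

/-- An edge of `T(G)` is determined by a copy of a gadget, two vertices of that gadget and a
direction. An edge-gadget has at most `s + 2` vertices, hence the square. -/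
theorem card_edge_gadgetGraph_le (hV : ∀ v, (HV (G.idx (Sum.inl v))).inner ≤ s)
    (hE : ∀ e, (HE (G.idx (Sum.inr e))).inner ≤ s) :
    Fintype.card (Edge (gadgetGraph HV HE G)) ≤
      2 * ((G.n + Fintype.card (Edge G.graph)) * (s + 2) ^ 2) := by
  let Z : Type := (Fin G.n × Fin (s + 2) × Fin (s + 2)) ⊕
    (Edge G.graph × Fin (s + 2) × Fin (s + 2))
  have hZ : Fintype.card (Bool × Z) =
      2 * ((G.n + Fintype.card (Edge G.graph)) * (s + 2) ^ 2) := by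
    simp only [Z, Fintype.card_prod, Fintype.card_bool, Fintype.card_sum, Fintype.card_fin]
    ring
  let P : Z → VName × VName := Sum.elim
    (fun z => (vertexPlace z.1 z.2.1, vertexPlace z.1 z.2.2))
    (fun z => (edgePlace (z.1.1.1, z.1.1.2) z.2.1, edgePlace (z.1.1.1, z.1.1.2) z.2.2))
  -- A code determines at most one ordered pair of names; the Boolean tells whether the numbering of
  -- `T(G)` lists the endpoints in the order of the gadget copy.
  let R : Bool × Z → VName × VName → Prop := fun x p => (if x.1 then p else p.swap) = P x.2
  have hR : ∀ x p q, R x p → R x q → p = q := by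
    intro x p q hp hq
    have h := hp.trans hq.symm
    split_ifs at h
    · exact h
    · exact Prod.swap_injective h
  have hP : ∀ a b : TVertex HV HE G,
      ((∃ v x y, (HV (G.idx (Sum.inl v))).graph.Adj x y ∧
        placeV HV HE G v x = a ∧ placeV HV HE G v y = b) ∨
      (∃ e x y, (HE (G.idx (Sum.inr e))).graph.Adj x y ∧
        placeE HV HE G e x = a ∧ placeE HV HE G e y = b)) →
      ∃ z, (vname a, vname b) = P z := by
    rintro _ _ (⟨v, x, y, -, rfl, rfl⟩ | ⟨e, x, y, -, rfl, rfl⟩)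
    · have := hV v
      exact ⟨Sum.inl (v, ⟨x, by omega⟩, ⟨y, by omega⟩), by simp [P, vname_placeV]⟩
    · have := hE e
      exact ⟨Sum.inr (e, ⟨x, by omega⟩, ⟨y, by omega⟩), by simp [P, vname_placeE]⟩
  have hex : ∀ e : Edge (gadgetGraph HV HE G), ∃ x : Bool × Z,
      R x (vname ((TList HV HE G).get e.1.1), vname ((TList HV HE G).get e.1.2)) := by
    intro e
    have h : (TGraph HV HE G).Adj ((TList HV HE G).get e.1.1) ((TList HV HE G).get e.1.2) := e.2.2
    rw [TGraph, SimpleGraph.fromRel_adj] at h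
    rcases h.2 with h | h
    · obtain ⟨z, hz⟩ := hP _ _ h
      exact ⟨(true, z), hz⟩
    · obtain ⟨z, hz⟩ := hP _ _ h
      exact ⟨(false, z), hz⟩
  choose f hf using hex
  rw [← hZ]
  refine Fintype.card_le_of_injective f fun e e' h => ?_
  have := hR _ _ _ (hf e) (h ▸ hf e')
  simp only [Prod.mk.injEq, vname_injective.eq_iff] at this
  have hget := List.nodup_iff_injective_get.1 (nodup_TList (HV := HV) (HE := HE) (G := G))
  exact Subtype.ext (Prod.ext (hget this.1) (hget this.2))

end

/-! ### Growth of running times -/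

theorem exists_eval_le_pow (P : ℕ[X]) : ∃ k : ℕ, ∀ x : ℕ, P.eval x ≤ (x + 2) ^ k := by
  induction P using Polynomial.induction_on' with
  | add P Q hP hQ =>
    obtain ⟨k, hk⟩ := hP
    obtain ⟨l, hl⟩ := hQ
    refine ⟨k + l + 1, fun x => ?_⟩
    have h₁ := (hk x).trans (Nat.pow_le_pow_right (by omega) (Nat.le_add_right k l))
    have h₂ := (hl x).trans (Nat.pow_le_pow_right (by omega) (Nat.le_add_left l k))
    have h₃ := Nat.mul_le_mul_left ((x + 2) ^ (k + l)) (show 2 ≤ x + 2 by omega)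
    rw [eval_add, pow_succ]
    omega
  | monomial n c =>
    refine ⟨c + n, fun x => ?_⟩
    rw [eval_monomial, pow_add]
    exact Nat.mul_le_mul (Nat.lt_two_pow_self.le.trans (Nat.pow_le_pow_left (by omega) c))
      (Nat.pow_le_pow_left (by omega) n)

theorem eventually_eval_le (P : ℕ[X]) {η : ℝ} (hη : 0 < η) :
    ∀ᶠ n : ℕ in atTop, ((P.eval n : ℕ) : ℝ) ≤ (2 : ℝ) ^ (η * n) := by
  obtain ⟨k, hk⟩ := exists_eval_le_pow P
  have h := (isLittleO_pow_const_const_pow_of_one_lt (R := ℝ) k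
    (Real.one_lt_rpow one_lt_two hη)).bound (c := ((2 : ℝ) ^ k)⁻¹) (by positivity)
  filter_upwards [h, eventually_ge_atTop 2] with n hn hn₂
  have h₁ : ((P.eval n : ℕ) : ℝ) ≤ 2 ^ k * (n : ℝ) ^ k := by
    rw [← mul_pow]
    have h₂ : P.eval n ≤ (2 * n) ^ k := (hk n).trans (Nat.pow_le_pow_left (by omega) k)
    exact_mod_cast h₂
  rw [Real.norm_of_nonneg (by positivity), Real.norm_of_nonneg (by positivity),
    le_inv_mul_iff₀ (by positivity), ← Real.rpow_natCast _ n, ← Real.rpow_mul (by norm_num)] at hn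
  exact h₁.trans hn

/-- The program `M` solves the instances with `m ≤ c n` of size `n` within `T` steps. -/
def Problem.SolvedIn (P : Problem) (M : Code) (c n T : ℕ) : Prop :=
  ∀ I : P.Inst, P.n I = n → P.m I ≤ c * n → ∃ t ≤ T, Runs M (P.input I) (P.output I) t

/-- The exponent is the logarithm of the least valid time bound for size `n`. It does not mention
`ε`, and minimality makes it at most `ε * n` eventually for each `ε`. Finiteness for every size
comes from `h₁`. -/
theorem Problem.SubexpOnSparse.of_eventually {P : Problem} (M : Code)
    (h₁ : ∀ c n, ∃ T, P.SolvedIn M c n T)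
    (h₂ : ∀ c : ℕ, ∀ ε : ℝ, 0 < ε → ∀ᶠ n : ℕ in atTop,
      ∃ T : ℕ, P.SolvedIn M c n T ∧ (T : ℝ) ≤ (2 : ℝ) ^ (ε * n)) : P.SubexpOnSparse := by
  classical
  refine ⟨M, fun c => ⟨fun n => Real.logb 2 (max 1 (Nat.find (h₁ c n))), ?_, fun I hI => ?_⟩⟩
  · refine IsLittleO.of_bound fun ε hε => ?_
    filter_upwards [h₂ c ε hε] with n ⟨T, hT, hTn⟩
    rw [Real.norm_of_nonneg (Real.logb_nonneg one_lt_two (le_max_left _ _)),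
      Real.norm_of_nonneg (Nat.cast_nonneg n),
      Real.logb_le_iff_le_rpow one_lt_two (lt_max_of_lt_left one_pos)]
    refine max_le (Real.one_le_rpow one_le_two (by positivity)) (le_trans ?_ hTn)
    exact_mod_cast Nat.find_min' (h₁ c n) hT
  · obtain ⟨t, ht, hrun⟩ := Nat.find_spec (h₁ c (P.n I)) I rfl hI
    refine ⟨t, hrun, ?_⟩
    rw [Real.rpow_logb two_pos (by norm_num) (lt_max_of_lt_left one_pos)]
    exact le_max_of_le_right (by exact_mod_cast ht)

/-- A bound for the running time on instances of size between `n` and `K * n`. -/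
theorem exists_time_bound (s : ℕ → ℝ) (K n : ℕ) :
    ∃ E : ℕ, ∀ n', n ≤ n' → n' ≤ K * n → (2 : ℝ) ^ s n' ≤ E := by
  refine ⟨⌈∑ i ∈ Finset.Icc n (K * n), (2 : ℝ) ^ s i⌉₊, fun n' h₁ h₂ => ?_⟩
  exact (Finset.single_le_sum (f := fun i => (2 : ℝ) ^ s i) (fun i _ => by positivity)
    (Finset.mem_Icc.2 ⟨h₁, h₂⟩)).trans (Nat.le_ceil _)

/-- Instances of size at most `K * n` still take time `2 ^ (η * n)` if the bound on `s` is applied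
with `η / (K + 1)`; the added one avoids division by zero. -/
theorem eventually_time_bound {s : ℕ → ℝ} (hs : s =o[atTop] (fun n : ℕ => (n : ℝ))) (K : ℕ)
    {η : ℝ} (hη : 0 < η) : ∀ᶠ n : ℕ in atTop,
      ∀ n', n ≤ n' → n' ≤ K * n → (2 : ℝ) ^ s n' ≤ ⌈(2 : ℝ) ^ (η * n)⌉₊ := by
  obtain ⟨n₀, h⟩ := eventually_atTop.1 (hs.bound (c := η / (K + 1)) (by positivity))
  filter_upwards [eventually_ge_atTop n₀] with n hn n' h₁ h₂
  refine (Real.rpow_le_rpow_of_exponent_le one_le_two ?_).trans (Nat.le_ceil _)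
  have h₃ := (le_abs_self _).trans (h n' (hn.trans h₁))
  rw [Real.norm_of_nonneg (Nat.cast_nonneg n')] at h₃
  have h₄ : (n' : ℝ) ≤ K * n := by exact_mod_cast h₂
  calc s n' ≤ η / (K + 1) * n' := h₃
    _ ≤ η / (K + 1) * ((K + 1) * n) := by
      gcongr
      exact h₄.trans (by gcongr; linarith)
    _ = η * n := by field_simp

/-- The main power is `((d + 1) ^ (1 + c)) ^ (n / d)`. Its base is polynomial in `d`, hence at most
`2 ^ (η * d)` for large `d`. The factor `d + 1` pays for the additional block. -/
theorem exists_block_size (c : ℕ) {η : ℝ} (hη : 0 < η) : ∃ d : ℕ, 1 ≤ d ∧ ∀ n : ℕ,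
    (((d + 1) ^ ((1 + c) * n / d + 1) : ℕ) : ℝ) ≤ (d + 1) * (2 : ℝ) ^ (η * n) := by
  obtain ⟨d, hd, hd₁⟩ := ((eventually_eval_le ((X + 1) ^ (1 + c)) hη).and
    (eventually_ge_atTop 1)).exists
  refine ⟨d, hd₁, fun n => ?_⟩
  have hd₀ : (0 : ℝ) < d := by exact_mod_cast hd₁
  rw [eval_pow, eval_add, eval_X, eval_one] at hd
  have h₁ : (((1 + c) * n / d : ℕ) : ℝ) ≤ (1 + c) * n / d := by
    refine Nat.cast_div_le.trans ?_
    push_cast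
    exact le_rfl
  rw [Nat.cast_pow, pow_succ, mul_comm]
  push_cast at hd ⊢
  gcongr
  calc ((d : ℝ) + 1) ^ ((1 + c) * n / d : ℕ)
      = ((d : ℝ) + 1) ^ (((1 + c) * n / d : ℕ) : ℝ) := (Real.rpow_natCast _ _).symm
    _ ≤ ((d : ℝ) + 1) ^ ((1 + c) * n / d : ℝ) :=
      Real.rpow_le_rpow_of_exponent_le (by linarith) h₁
    _ = (((d : ℝ) + 1) ^ (1 + c)) ^ (n / d : ℝ) := by
      rw [← Real.rpow_natCast _ (1 + c), ← Real.rpow_mul (by linarith), mul_div_assoc]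
      push_cast
      rfl
    _ ≤ ((2 : ℝ) ^ (η * d)) ^ (n / d : ℝ) := by gcongr
    _ = (2 : ℝ) ^ (η * n) := by
      rw [← Real.rpow_mul (by norm_num)]
      congr 1
      field_simp

/-- If `p x ≤ (x + 2) ^ k`, it is enough that the argument plus two is eventually at most `y ^ 2`
with `y = 2 ^ (η * n)` and `η = ε / (2 * (k + 1))`. The quantifier order matters: `Q` is chosen
after `d`, since it involves constants depending on `d`. -/
theorem exists_eventually_bound (p : ℕ[X]) (c : ℕ) {ε : ℝ} (hε : 0 < ε) :
    ∃ d : ℕ, 1 ≤ d ∧ ∃ η : ℝ, 0 < η ∧ ∀ Q : ℕ[X], ∀ᶠ n : ℕ in atTop,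
      ((p.eval ((d + 1) ^ ((1 + c) * n / d + 1) + ⌈(2 : ℝ) ^ (η * n)⌉₊ + Q.eval n) : ℕ) : ℝ) ≤
        (2 : ℝ) ^ (ε * n) := by
  obtain ⟨k, hk⟩ := exists_eval_le_pow p
  have hη : 0 < ε / (2 * (k + 1)) := by positivity
  obtain ⟨d, hd₁, hd⟩ := exists_block_size c hη
  refine ⟨d, hd₁, _, hη, fun Q => ?_⟩
  generalize hη' : ε / (2 * (k + 1)) = η at *
  -- As `y ≥ 1`, the words, the rounded evaluation time, `Q` and the additional two sum to at most
  -- `(Q + d + 5) * y ≤ y * y`.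
  filter_upwards [eventually_eval_le (Q + Polynomial.C (d + 5)) hη] with n hn
  have h₀ : 1 ≤ (2 : ℝ) ^ (η * n) := Real.one_le_rpow one_le_two (by positivity)
  have h₁ := (Nat.ceil_lt_add_one (show 0 ≤ (2 : ℝ) ^ (η * n) by positivity)).le
  have h₂ := hd n
  rw [eval_add, eval_C] at hn
  obtain ⟨y, hy⟩ : ∃ y, (2 : ℝ) ^ (η * n) = y := ⟨_, rfl⟩
  have h₃ : y ^ (2 * k) ≤ (2 : ℝ) ^ (ε * n) := by
    rw [← hy, ← Real.rpow_natCast, ← Real.rpow_mul (by norm_num)]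
    refine Real.rpow_le_rpow_of_exponent_le one_le_two ?_
    push_cast
    have h₄ : η * (2 * (k + 1)) = ε := by rw [← hη']; field_simp
    have h₅ : 0 ≤ η * n := by positivity
    calc η * n * (2 * k) ≤ η * n * (2 * (k + 1)) := by gcongr; linarith
      _ = ε * n := by rw [← h₄]; ring
  rw [hy] at h₀ h₁ h₂ hn ⊢
  refine le_trans ?_ h₃
  refine (Nat.cast_le.2 (hk _)).trans ?_
  rw [pow_mul, Nat.cast_pow]
  refine pow_le_pow_left₀ (Nat.cast_nonneg _) ?_ k
  rw [Nat.cast_add, Nat.cast_add, Nat.cast_add]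
  push_cast at hn
  have h₄ : (0 : ℝ) ≤ (Q.eval n : ℕ) := Nat.cast_nonneg _
  have h₅ : ((Q.eval n : ℕ) + (d + 5) : ℝ) * y ≤ y * y := by gcongr
  have h₆ := mul_le_mul_of_nonneg_left h₀ h₄
  rw [sq]
  push_cast
  push_cast at h₂
  linarith

/-! ### The fuel needed for interpolation -/

theorem exists_bound_of_le (f : ℕ → ℕ) (d : ℕ) : ∃ C, ∀ i ≤ d, f i ≤ C :=
  ⟨∑ i ∈ Finset.range (d + 1), f i, fun _ hi => Finset.single_le_sum (fun _ _ => Nat.zero_le _)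
    (Finset.mem_range.2 (Nat.lt_succ_of_le hi))⟩

theorem exists_run_bound {α : Type} {M : Code} {f : α → Data} {a : ℕ → α}
    (h : ∀ i, ∃ t, Runs M (encNat i) (f (a i)) t) (d : ℕ) :
    ∃ C, ∀ i ≤ d, ∃ t, Runs M (encNat i) (f (a i)) t ∧ t ≤ C := by
  choose t ht using h
  obtain ⟨C, hC⟩ := exists_bound_of_le t d
  exact ⟨C, fun i hi => ⟨t i, ht i, hC i hi⟩⟩

theorem idx_assignWeights_le {n : ℕ} {G : SimpleGraph (Fin n)} {ws : List Letter} {d : ℕ}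
    (hlen : n + (edgeList G).length ≤ ws.length) (h : ∀ c ∈ ws, c.1 ≤ d) (a : Elt G) :
    (assignWeights G ws).idx a ≤ d := by
  have ha := (position_lt a).trans_le hlen
  change (ws.getD (position a) noLetter).1 ≤ d
  rw [List.getD_eq_getElem _ _ ha]
  exact h _ (List.getElem_mem ha)

/-- Each subcomputation needs a fuel bounded by one of the summands: the words, the evaluations on
`T(G)` (time `E`), the weights and gadgets up to index `d` (a constant) and the factor function (a
power of `n + 2`). -/
theorem exists_fuel {MW MA MB MF ME : Code} {W : ℕ → ℚ} {HV : ℕ → VertexGadget}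
    {HE : ℕ → EdgeGadget} {F : WGraph → ℚ} {χ : SieveFunction} {ω : WeightSelector} {ξ : ℚ}
    (hMW : ∀ i, ∃ t, Runs MW (encNat i) (encRat (W i)) t)
    (hMA : ∀ i, ∃ t, Runs MA (encNat i) (encGraph (HV i).graph) t)
    (hMB : ∀ i, ∃ t, Runs MB (encNat i) (encGraph (HE i).graph) t)
    (hMF : ∀ d : ℕ, ∃ k : ℕ, ∀ G : WGraph, (∀ a, G.idx a ≤ d) →
      ∃ t : ℕ, Runs MF (encWGraph G) (encRat (F G)) t ∧ t ≤ (G.n + 2) ^ k)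
    (hME : ∀ c : ℕ, ∃ s : ℕ → ℝ, s =o[atTop] (fun n : ℕ => (n : ℝ)) ∧
      ∀ n (G : SimpleGraph (Fin n)), Fintype.card (Edge G) ≤ c * n →
        ∃ t : ℕ, Runs ME (encGraph G) (encRat ((inducedPoly χ ω n G).eval ξ)) t ∧
          (t : ℝ) ≤ (2 : ℝ) ^ s n)
    (c : ℕ) {d : ℕ} (hd : 1 ≤ d) :
    ∃ C k K : ℕ, ∃ s : ℕ → ℝ, s =o[atTop] (fun n : ℕ => (n : ℝ)) ∧
      ∀ n E : ℕ, (∀ n', n ≤ n' → n' ≤ K * n → (2 : ℝ) ^ s n' ≤ E) →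
        ∀ G : SimpleGraph (Fin n), Fintype.card (Edge G) ≤ c * n → ∀ B : List Unit,
          (d + 1) ^ ((1 + c) * n / d + 1) + E + (C + (n + 2) ^ k) ≤ B.length →
            (search MW MA MB MF ME B (encGraph G)).isSome := by
  obtain ⟨CW, hCW⟩ := exists_run_bound hMW d
  obtain ⟨CA, hCA⟩ := exists_run_bound (f := fun H : VertexGadget => encGraph H.graph) hMA d
  obtain ⟨CB, hCB⟩ := exists_run_bound (f := fun H : EdgeGadget => encGraph H.graph) hMB d
  obtain ⟨r₁, hr₁⟩ := exists_bound_of_le (fun i => (HV i).inner) d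
  obtain ⟨r₂, hr₂⟩ := exists_bound_of_le (fun i => (HE i).inner) d
  obtain ⟨k, hk⟩ := hMF d
  -- This is the density of `T(G)` from `card_edge_gadgetGraph_le`, where `r₁ + r₂` bounds the inner
  -- vertices of all gadgets in use.
  obtain ⟨s, hs, hsE⟩ := hME (2 * ((1 + c) * (r₁ + r₂ + 2) ^ 2))
  refine ⟨CW + CA + CB + d + 1, k, (1 + c) * (r₁ + r₂ + 1), s, hs, fun n E hE G hG B hB => ?_⟩
  have hN : n + Fintype.card (Edge G) ≤ (1 + c) * n := by rw [add_mul, one_mul]; omega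
  refine search_isSome G hd (by omega) (interpolate_complete (W := W) (HV := HV)
    (HE := HE) (F := F) (χ := χ) (ω := ω) (ξ := ξ) G hd (by omega)
    (fun i hi => ?_) (fun i hi => ?_) (fun i hi => ?_) ?_ fun ws hlen hws hV hE' => ⟨?_, ?_⟩)
  · obtain ⟨t, ht, htC⟩ := hCW i hi
    exact ⟨t, ht, by omega⟩
  · obtain ⟨t, ht, htC⟩ := hCA i hi
    exact ⟨t, ht, by omega⟩
  · obtain ⟨t, ht, htC⟩ := hCB i hi
    exact ⟨t, ht, by omega⟩
  · rw [length_edgeList]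
    have := Nat.pow_le_pow_right (show 0 < d + 1 by omega)
      (Nat.add_le_add_right (Nat.div_le_div_right (c := d) hN) 1)
    exact this.trans (by omega)
  · obtain ⟨t, ht, htk⟩ := hk (assignWeights G ws) (idx_assignWeights_le hlen hws)
    exact ⟨t, ht, htk.trans (show (n + 2) ^ k ≤ B.length by omega)⟩
  · have hidx := idx_assignWeights_le hlen hws
    have h₁ : ∀ v, (HV ((assignWeights G ws).idx (Sum.inl v))).inner ≤ r₁ + r₂ := fun v =>
      (hr₁ _ (hidx _)).trans (Nat.le_add_right _ _)
    have h₂ : ∀ e, (HE ((assignWeights G ws).idx (Sum.inr e))).inner ≤ r₁ + r₂ := fun e =>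
      (hr₂ _ (hidx _)).trans (Nat.le_add_left _ _)
    have h₃ : n ≤ _ := le_length_TList (HV := HV) (HE := HE) (G := assignWeights G ws)
    have h₄ : _ ≤ (n + Fintype.card (Edge G)) * _ := length_TList_le h₁ h₂
    have h₅ : _ ≤ 2 * ((n + Fintype.card (Edge G)) * _) := card_edge_gadgetGraph_le h₁ h₂
    obtain ⟨t, ht, hts⟩ := hsE _ (gadgetGraph HV HE (assignWeights G ws)) (by
      refine h₅.trans ?_
      rw [mul_assoc 2]
      refine Nat.mul_le_mul_left 2 ((Nat.mul_le_mul_right _ hN).trans ?_)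
      rw [mul_right_comm]
      exact Nat.mul_le_mul_left _ h₃)
    refine ⟨t, ht, ?_⟩
    have h₆ : (t : ℝ) ≤ E := hts.trans (hE _ h₃ (by
      refine h₄.trans ((Nat.mul_le_mul_right _ hN).trans ?_)
      rw [mul_right_comm]))
    have h₇ : t ≤ E := by exact_mod_cast h₆
    omega

/-- Every graph is sparse for some constant, so an algorithm for all sparse classes halts with the
right answer on every graph. -/
theorem card_edge_le_mul {n : ℕ} (G : SimpleGraph (Fin n)) :
    Fintype.card (Edge G) ≤ Fintype.card (Edge G) * n := by
  rcases Nat.eq_zero_or_pos n with rfl | hn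
  · have : IsEmpty (Edge G) := ⟨fun e => e.1.1.elim0⟩
    simp
  · exact Nat.le_mul_of_pos_right _ hn

theorem size_encGraph_le {n : ℕ} (G : SimpleGraph (Fin n)) :
    (encGraph G).size ≤ 8 * (n * (n * 2 + 2) + 1) := by
  classical
  rw [encGraph_eq]
  refine (Enc.size_le _).trans (Nat.mul_le_mul_left 8 ?_)
  have h := sz_list_le (l := boolMatrix G) (b := n * 2 + 1) fun r hr => by
    obtain ⟨i, -, rfl⟩ := List.mem_map.1 hr
    have h := sz_list_le (l := (List.finRange n).map fun j => decide (G.Adj i j)) (b := 1)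
      fun a _ => le_rfl
    rwa [List.length_map, List.length_finRange] at h
  rwa [length_boolMatrix] at h

end BlockInterp

/-! ### From evaluation to coefficients: the reduction. -/

theorem mainTheorem4 (χ : BlockInterp.SieveFunction) (ω : BlockInterp.WeightSelector) (ξ : ℚ)
    (hcoeff : BlockInterp.SharpETH →
      ¬ (BlockInterp.coeffProblem (BlockInterp.inducedPoly χ ω)).SubexpOnSparse)
    (hsim : BlockInterp.WeightSimulation χ ω ξ) :
    BlockInterp.SharpETH →
      ¬ (BlockInterp.evalProblem ξ (BlockInterp.inducedPoly χ ω)).SubexpOnSparse := by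
  open BlockInterp in
  intro hETH ⟨ME, hME⟩
  refine hcoeff hETH ?_
  obtain ⟨W, ⟨MW, hMW⟩, hW, HV, HE, ⟨MA, hMA⟩, ⟨MB, hMB⟩, F, ⟨-, MF, hMF⟩, hred⟩ := hsim
  replace hME : ∀ c : ℕ, ∃ s : ℕ → ℝ, s =o[atTop] (fun n : ℕ => (n : ℝ)) ∧
      ∀ n (G : SimpleGraph (Fin n)), Fintype.card (Edge G) ≤ c * n →
        ∃ t : ℕ, Runs ME (encGraph G) (encRat ((inducedPoly χ ω n G).eval ξ)) t ∧
          (t : ℝ) ≤ (2 : ℝ) ^ s n := fun c => by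
    obtain ⟨s, hs, h⟩ := hME c
    exact ⟨s, hs, fun n G hG => h ⟨n, G⟩ hG⟩
  obtain ⟨M, p, hM⟩ := exists_search (pt_search (MW := MW) (MA := MA) (MB := MB) (MF := MF)
    (ME := ME))
  have hsound := fun {n : ℕ} (G : SimpleGraph (Fin n)) (B : List Unit) (z : Data) =>
    search_sound (ME := ME) (B := B) (z := z) hMW hMA hMB (fun G => by
      -- A finite graph uses finitely many weights, so the program for the factor function halts on
      -- it; the sum is a crude bound for the indices.
      obtain ⟨d, hd⟩ : ∃ d, ∀ a, G.idx a ≤ d := ⟨∑ a, G.idx a, fun a =>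
        Finset.single_le_sum (fun _ _ => Nat.zero_le _) (Finset.mem_univ a)⟩
      obtain ⟨k, hk⟩ := hMF d
      obtain ⟨t, ht, -⟩ := hk G hd
      exact ⟨t, ht⟩) (fun n G => by
      obtain ⟨s, -, h⟩ := hME (Fintype.card (Edge G))
      obtain ⟨t, ht, -⟩ := h n G (card_edge_le_mul G)
      exact ⟨t, ht⟩) hW hred G
  have hsolve : ∀ c d : ℕ, 1 ≤ d → ∃ (Q : ℕ[X]) (K : ℕ) (s : ℕ → ℝ),
      s =o[atTop] (fun n : ℕ => (n : ℝ)) ∧ ∀ n E : ℕ,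
        (∀ n', n ≤ n' → n' ≤ K * n → (2 : ℝ) ^ s n' ≤ E) →
          (coeffProblem (inducedPoly χ ω)).SolvedIn M c n
            (p.eval ((d + 1) ^ ((1 + c) * n / d + 1) + E + Q.eval n)) := by
    intro c d hd
    obtain ⟨C, k, K, s, hs, h⟩ := exists_fuel hMW hMA hMB hMF hME c hd
    -- The last summand bounds the size of the input matrix, which enters the time of the search
    -- besides the fuel.
    refine ⟨Polynomial.C C + (X + 2) ^ k + 8 * (X * (X * 2 + 2) + 1), K, s, hs, fun n E hE => ?_⟩
    rintro ⟨n, G⟩ rfl hG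
    obtain ⟨t, ht, htp⟩ := hM (encGraph G) _
      ((d + 1) ^ ((1 + c) * n / d + 1) + E + (C + (n + 2) ^ k)) (hsound G)
      (h n E hE G hG _ (by rw [List.length_replicate]))
    refine ⟨t, htp.trans (eval_mono p ?_), ht⟩
    have := size_encGraph_le G
    change _ ≤ (d + 1) ^ ((1 + c) * n / d + 1) + E + eval n _
    simp only [eval_add, eval_mul, eval_pow, eval_C, eval_X, eval_one, eval_ofNat]
    omega
  refine Problem.SubexpOnSparse.of_eventually M (fun c n => ?_) fun c ε hε => ?_
  -- For a mere time bound at each size any block size works; the choice depending on `ε` is needed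
  -- only for the growth.
  · obtain ⟨Q, K, s, -, h⟩ := hsolve c 1 le_rfl
    obtain ⟨E, hE⟩ := exists_time_bound s K n
    exact ⟨_, h n E hE⟩
  · obtain ⟨d, hd, η, hη, hQ⟩ := exists_eventually_bound p c hε
    obtain ⟨Q, K, s, hs, h⟩ := hsolve c d hd
    filter_upwards [hQ Q, eventually_time_bound hs K hη] with n h₁ h₂
    exact ⟨_, h n _ h₂, h₁⟩
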